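/- **Setting.** Let $M$ be a manifold with corners of codimension at most $2$, of dimension $N$, with finitely many boundary hypersurfaces: a main face $\mathrm{mf}$ and further hypersurfaces $H$ that are pairwise disjoint and each meet $\mathrm{mf}$. Each $H\neq\mathrm{mf}$ carries a fibration $\phi_H:H\to Z_H$ over a compact manifold without boundary whose fibres meet $\mathrm{mf}$ transversally, and $\phi_{\mathrm{mf}}=\mathrm{id}$. A total boundary defining function $x$ is given. Let $\mathcal V_{s\Phi}(M)$ be the smooth vector fields $V$ on $M$ that are tangent to the fibres of all these fibrations and satisfy $Vx\in x^2C^\infty(M)$, and let ${}^{s\Phi}T^*M$ be the dual of the bundle whose sections they are. Near a point of $\mathrm{mf}\cap H$ use coordinates $(x'',\tilde x,y',y'')$ in which $x''=0$ defines $\mathrm{mf}$, $\tilde x=x/x''=0$ defines $H$ and the fibres of $\phi_H$ are $y'=\mathrm{const}$, and write covectors as $\tau\frac{dx}{x^2}+\eta\frac{d\tilde x}{x}+\mu'\cdot\frac{dy'}{x}+\mu''\cdot\frac{dy''}{x''}$; near an interior point of $\mathrm{mf}$ use coordinates $(x,y)$ and write covectors as $\tau\frac{dx}{x^2}+\mu\cdot\frac{dy}{x}$.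 A *Legendre submanifold* $L$ is a submanifold of ${}^{s\Phi}T^*_{\mathrm{mf}}M$ of dimension $N-1$, transversal to the part over $\mathrm{mf}\cap H$ for every $H\ne\mathrm{mf}$, on which the contact form ($d\tau+\mu\cdot dy$, respectively $d\tau+\eta\,d\tilde x+\mu'\cdot dy'+\tilde x\,\mu''\cdot dy''$) vanishes, such that over $\mathrm{mf}\cap H$ the map $(y',y'',\tau,\eta,\mu',\mu'')\mapsto(y',\tau,\mu')$ makes $L$ fibre (submersively) over a Legendre submanifold for $d\tau+\mu'\cdot dy'$, with fibres that are Legendre for $d\tau''+\mu''\cdot dy''$, $\tau''=-\eta$. A *nondegenerate parametrization* of $L$ near $Q\in L$ over a point of $\mathrm{mf}\cap H$ is a function $\phi/x$ with $\phi=\phi_1(y',v)+\tilde x\,\phi_2(\tilde x,y',y'',v,w)$, $v\in\mathbb R^k$, $w\in\mathbb R^{k'}$, where $\phi_1$ and $\phi_2$ are smooth near a point $Q'=(0,y'_0,y''_0,v_0,w_0)$ of $C_\phi=\{\tilde x\ge 0,\ d_v\phi=0,\ d_w\phi_2=0\}$ with $(0,y_0',y_0'',d(\phi/x)(Q'))=Q$;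 the differentials $d_{(y',v)}\partial_{v_j}\phi_1$ are independent at $(y_0',v_0)$ and the $d_{(y'',w)}\partial_{w_j}\phi_2$ are independent at $Q'$; and near $Q$, $L=\{(\tilde x,y',y'',d(\phi/x)):(\tilde x,y',y'',v,w)\in C_\phi\}$. Over an interior point of $\mathrm{mf}$ it is a function $\phi(y,w)/x$, $w\in\mathbb R^k$, with the differentials $d_{(y,w)}\partial_{w_j}\phi$ independent at a point $Q'=(y_0,w_0)$ with $d_w\phi(Q')=0$ and $(y_0,d(\phi/x)(Q'))=Q$, and with $L=\{(y,d(\phi/x)):d_w\phi=0\}$ near $Q$. Finally, $\dot C^\infty(M)$ is the space of smooth functions on $M$ that vanish to infinite order at the boundary. **Proposition 4.4.** Let $L$ be a Legendre submanifold and $Q\in L$. (a) Suppose that $Q$ lies over $\mathrm{mf}\cap H$, and let $\phi$ (with $k,k'$ and $Q'$) and $\tilde\phi$ (with $\tilde k,\tilde k'$ and $\tilde Q'$) be two nondegenerate parametrizations of $L$ near $Q$ in the same coordinates. Then there is a neighbourhood $O$ of $(x''=0,Q')$ such that for all $q,r\in\mathbb R$ and every smooth compactly supported $a$ with support in $O$,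 the function $$u=x^q\tilde x^r\int e^{i\phi(\tilde x,y',y'',v,w)/x}\,a(x'',\tilde x,y',y'',v,w)\,dv\,dw$$ can be written, on the interior of $M$, as $$u=u_0+x^{\tilde q}\tilde x^{\tilde r}\int e^{i\tilde\phi(\tilde x,y',y'',\tilde v,\tilde w)/x}\,\tilde a(x'',\tilde x,y',y'',\tilde v,\tilde w)\,d\tilde v\,d\tilde w$$ with $u_0\in\dot C^\infty(M)$, $\tilde a$ smooth and compactly supported in the domain of $\tilde\phi$ and of the coordinates, and $\tilde q=q+\frac{(k+k')-(\tilde k+\tilde k')}{2}$, $\tilde r=r-\frac{k'-\tilde k'}{2}$. (b) Suppose that $Q$ lies over the interior of $\mathrm{mf}$, and let $\phi$ (with $k$ and $Q'$) and $\tilde\phi$ (with $\tilde k$) be two nondegenerate parametrizations of $L$ near $Q$ in the same coordinates. Then there is a neighbourhood $O$ of $(x=0,Q')$ such that for all $q\in\mathbb R$ and every smooth compactly supported $a$ with support in $O$, the function $u=x^q\int e^{i\phi(y,w)/x}a(x,y,w)\,dw$ can be written, on the interior of $M$, as $u=u_0+x^{\tilde q}\int e^{i\tilde\phi(y,\tilde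 w)/x}\,\tilde a(x,y,\tilde w)\,d\tilde w$ with $u_0\in\dot C^\infty(M)$, $\tilde a$ smooth and compactly supported in the domain of $\tilde\phi$ and of the coordinates, and $\tilde q=q+\frac{k-\tilde k}{2}$. Here functions given in coordinates are extended by zero to $M$. -/

import Mathlib

open scoped Manifold ContDiff Topology

namespace FibredLegendre

noncomputable section

abbrev Vec (n : ℕ) : Type := Fin n → ℝ

/-- The model with corners `[0, ∞)^N`. -/
abbrev IQ (N : ℕ) := modelWithCornersEuclideanQuadrant N

/-- The differential of a real function at a point of a manifold with corners. -/
def dAt (N : ℕ) {M : Type*} [TopologicalSpace M] [ChartedSpace (EuclideanQuadrant N) M]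
    (f : M → ℝ) (p : M) : TangentSpace (IQ N) p →L[ℝ] ℝ :=
  mfderiv (IQ N) 𝓘(ℝ, ℝ) f p

/-! ### Manifolds with corners of codimension two with a stratified boundary -/

/-- A manifold with corners `M` of dimension `n + 1`, of codimension at most two, with boundary
hypersurfaces `mf` and `H i` (`i : ι`), fibrations `φ_i : H i → Z i` (and the identity on `mf`), and
a distinguished total boundary defining function `x`, the product of the boundary defining functions
`ρmf` of `mf` and `ρ i` of `H i`.  The base `Z i` has dimension `l i`, and the fibres of `φ_i` have
dimension `m i + 1`.  Only the values of `proj i` on `H i` matter: `proj i` is any extension of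
`φ_i` to `M` that is smooth near `H i`. -/
structure FibredCorners (n : ℕ) (M : Type*) [TopologicalSpace M]
    [ChartedSpace (EuclideanQuadrant (n + 1)) M]
    {ι : Type*} [Fintype ι] (l m : ι → ℕ) (Z : ι → Type*) [∀ i, TopologicalSpace (Z i)]
    [∀ i, ChartedSpace (EuclideanSpace ℝ (Fin (l i))) (Z i)] where
  ρmf : M → ℝ
  ρ : ι → M → ℝ
  proj : ∀ i, M → Z i
  dim_eq : ∀ i, l i + m i + 1 = n
  smooth_ρmf : ContMDiff (IQ (n + 1)) 𝓘(ℝ, ℝ) ∞ ρmf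
  smooth_ρ : ∀ i, ContMDiff (IQ (n + 1)) 𝓘(ℝ, ℝ) ∞ (ρ i)
  nonneg_ρmf : ∀ p, 0 ≤ ρmf p
  nonneg_ρ : ∀ i p, 0 ≤ ρ i p
  boundary_iff : ∀ p, p ∈ (IQ (n + 1)).boundary M ↔ ρmf p = 0 ∨ ∃ i, ρ i p = 0
  d_ρmf : ∀ p, ρmf p = 0 → dAt (n + 1) ρmf p ≠ 0
  d_ρ : ∀ i p, ρ i p = 0 → dAt (n + 1) (ρ i) p ≠ 0
  d_indep : ∀ i p, ρmf p = 0 → ρ i p = 0 →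
    LinearIndependent ℝ ![dAt (n + 1) ρmf p, dAt (n + 1) (ρ i) p]
  disjoint : ∀ i j p, i ≠ j → ρ i p = 0 → ρ j p ≠ 0
  meets : ∀ i, ∃ p, ρ i p = 0 ∧ ρmf p = 0
  smooth_proj : ∀ i p, ρ i p = 0 → ContMDiffAt (IQ (n + 1)) (𝓡 (l i)) ∞ (proj i) p
  surj_proj : ∀ i (z : Z i), ∃ p, ρ i p = 0 ∧ proj i p = z
  /-- `φ_i` is locally trivial: over a neighbourhood `V` of `z`, the hypersurface `H i` is
  diffeomorphic to the product of `V` and the fibre over `z`. -/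
  locally_trivial : ∀ i (z : Z i), ∃ (V : Set (Z i)) (r : M → M) (s : Z i × M → M),
    IsOpen V ∧ z ∈ V ∧
    ContMDiffOn (IQ (n + 1)) (IQ (n + 1)) ∞ r {p | ρ i p = 0 ∧ proj i p ∈ V} ∧
    ContMDiffOn ((𝓡 (l i)).prod (IQ (n + 1))) (IQ (n + 1)) ∞ s
      (V ×ˢ {p | ρ i p = 0 ∧ proj i p = z}) ∧
    (∀ p, ρ i p = 0 → proj i p ∈ V →
      ρ i (r p) = 0 ∧ proj i (r p) = z ∧ s (proj i p, r p) = p) ∧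
    (∀ b ∈ V, ∀ p, ρ i p = 0 → proj i p = z →
      ρ i (s (b, p)) = 0 ∧ proj i (s (b, p)) = b ∧ r (s (b, p)) = p)
  /-- The fibres of `φ_i` intersect `mf` transversally: the tangent space of the fibre is not
  contained in that of `mf`. -/
  transversal : ∀ i p, ρ i p = 0 → ρmf p = 0 →
    ∃ v : TangentSpace (IQ (n + 1)) p, dAt (n + 1) (ρ i) p v = 0 ∧
      mfderiv (IQ (n + 1)) (𝓡 (l i)) (proj i) p v = 0 ∧ dAt (n + 1) ρmf p v ≠ 0

/-- Smooth vector fields on a manifold with corners. -/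
abbrev VField (N : ℕ) (M : Type*) [TopologicalSpace M] [ChartedSpace (EuclideanQuadrant N) M]
    [IsManifold (IQ N) ∞ M] :=
  ContMDiffSection (IQ N) (EuclideanSpace ℝ (Fin N)) ∞ (TangentSpace (IQ N) : M → Type _)

/-- Points `(y, τ, μ)` of the scattering cotangent bundle over the boundary, for `n` boundary
variables `y`; the covector is `τ dx/x² + μ · dy/x`. -/
abbrev JetSpace (n : ℕ) : Type := Vec n × ℝ × Vec n

/-- Points `((x̃, y', y''), (τ, η, μ', μ''))` of the rescaled cotangent bundle over the main face near
its boundary; the covector is `τ dx/x² + η dx̃/x + μ' · dy'/x + μ'' · dy''/x''`. -/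
abbrev CornerPhase (l m : ℕ) : Type := (ℝ × Vec l × Vec m) × (ℝ × ℝ × Vec l × Vec m)

/-- `S` is an (embedded) Legendre submanifold for the contact form `dτ + μ · dy`: it has dimension
`n`, so it is locally cut out by `n + 1` functions with independent differentials, and the contact
form vanishes on its tangent spaces. -/
def IsLegendreJet {n : ℕ} (S : Set (JetSpace n)) : Prop :=
  ∀ g ∈ S, ∃ (W : Set (JetSpace n)) (F : JetSpace n → Vec (n + 1)),
    IsOpen W ∧ g ∈ W ∧ ContDiffOn ℝ ∞ F W ∧ S ∩ W = {z ∈ W | F z = 0} ∧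
    ∀ z ∈ S ∩ W, Function.Surjective (fderiv ℝ F z) ∧
      ∀ v, fderiv ℝ F z v = 0 → v.2.1 + ∑ j, z.2.2 j * v.1 j = 0

/-- `S ⊆ {x̃ ≥ 0}` is an (embedded) submanifold of dimension `l + m + 1`, transversal to
`{x̃ = 0}`, on which the contact form `dτ + η dx̃ + μ' · dy' + x̃ μ'' · dy''` vanishes. -/
def IsLegendreCorner {l m : ℕ} (S : Set (CornerPhase l m)) : Prop :=
  ∀ g ∈ S, ∃ (W : Set (CornerPhase l m)) (F : CornerPhase l m → Vec (l + m + 2)),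
    IsOpen W ∧ g ∈ W ∧ ContDiffOn ℝ ∞ F W ∧ S ∩ W = {z ∈ W | 0 ≤ z.1.1 ∧ F z = 0} ∧
    ∀ z ∈ S ∩ W, Function.Surjective (fderiv ℝ F z) ∧
      (z.1.1 = 0 → ∀ c, ∃ v, v.1.1 = 0 ∧ fderiv ℝ F z v = c) ∧
      ∀ v, fderiv ℝ F z v = 0 →
        v.2.1 + z.2.2.1 * v.1.1 + ∑ j, z.2.2.2.1 j * v.1.2.1 j
          + z.1.1 * ∑ j, z.2.2.2.2 j * v.1.2.2 j = 0

/-- The projection `(y', y'', τ, η, μ', μ'') ↦ (y', τ, μ')` over the corner. -/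
def toBase {l m : ℕ} (c : CornerPhase l m) : JetSpace l := (c.1.2.1, c.2.1, c.2.2.2.1)

namespace FibredCorners

variable {n : ℕ} {M : Type*} [TopologicalSpace M] [ChartedSpace (EuclideanQuadrant (n + 1)) M]
  {ι : Type*} [Fintype ι] {l m : ι → ℕ} {Z : ι → Type*} [∀ i, TopologicalSpace (Z i)]
  [∀ i, ChartedSpace (EuclideanSpace ℝ (Fin (l i))) (Z i)]
  (S : FibredCorners n M l m Z)

/-- The total boundary defining function. -/
def x (p : M) : ℝ := S.ρmf p * ∏ i, S.ρ i p

/-- Smooth functions on `M` that vanish to infinite order at the boundary. -/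
def IsDotSmooth (u : M → ℂ) : Prop :=
  ContMDiff (IQ (n + 1)) 𝓘(ℝ, ℂ) ∞ u ∧
    ∀ j : ℕ, ∃ g : M → ℂ, ContMDiff (IQ (n + 1)) 𝓘(ℝ, ℂ) ∞ g ∧
      ∀ p, u p = ((S.x p ^ j : ℝ) : ℂ) * g p

section Bundle

variable [IsManifold (IQ (n + 1)) ∞ M]

/-- The fibred scattering structure: the smooth vector fields `V` that are tangent to the fibres of
all the boundary fibrations (hence vanish on `mf`) and satisfy `V x ∈ x² C^∞(M)`. -/
def Vsf : Submodule ℝ (VField (n + 1) M) where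
  carrier := {V | (∃ g : M → ℝ, ContMDiff (IQ (n + 1)) 𝓘(ℝ, ℝ) ∞ g ∧
      ∀ p, dAt (n + 1) S.x p (V p) = S.x p ^ 2 * g p) ∧
    (∀ p, S.ρmf p = 0 → V p = 0) ∧
    (∀ i p, S.ρ i p = 0 → dAt (n + 1) (S.ρ i) p (V p) = 0 ∧
      mfderiv (IQ (n + 1)) (𝓡 (l i)) (S.proj i) p (V p) = 0)}
  zero_mem' := by
    refine ⟨⟨0, contMDiff_const, fun p => ?_⟩, fun p _ => rfl, fun i p _ => ⟨?_, ?_⟩⟩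
    · have : (0 : VField (n + 1) M) p = 0 := rfl
      rw [this]; simp
    · have : (0 : VField (n + 1) M) p = 0 := rfl
      rw [this]; simp
    · have : (0 : VField (n + 1) M) p = 0 := rfl
      rw [this]; simp
  add_mem' := by
    rintro V W ⟨⟨g, hg, hV⟩, hV1, hV2⟩ ⟨⟨h, hh, hW⟩, hW1, hW2⟩
    have key : ∀ p, (V + W) p = V p + W p := fun p => rfl
    refine ⟨⟨g + h, hg.add hh, fun p => ?_⟩, fun p hp => ?_, fun i p hp => ⟨?_, ?_⟩⟩
    · rw [key, map_add, hV, hW]; simp [mul_add]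
    · rw [key, hV1 p hp, hW1 p hp, add_zero]
    · rw [key, map_add, (hV2 i p hp).1, (hW2 i p hp).1, add_zero]
    · rw [key, map_add, (hV2 i p hp).2, (hW2 i p hp).2, add_zero]
  smul_mem' := by
    rintro c V ⟨⟨g, hg, hV⟩, hV1, hV2⟩
    have key : ∀ p, (c • V) p = c • V p := fun p => rfl
    refine ⟨⟨fun p => c * g p, contMDiff_const.mul hg, fun p => ?_⟩, fun p hp => ?_,
      fun i p hp => ⟨?_, ?_⟩⟩
    · rw [key, map_smul, hV]; simp only [smul_eq_mul]; ring
    · rw [key, hV1 p hp, smul_zero]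
    · rw [key, map_smul, (hV2 i p hp).1, smul_zero]
    · rw [key, map_smul, (hV2 i p hp).2, smul_zero]

/-- The fibre at `p` of the rescaled cotangent bundle, the bundle dual to the one whose sections are
the elements of `Vsf`: the functionals on `Vsf` that factor through evaluation at `p`. -/
structure SfCotangent (p : M) where
  toFun : S.Vsf →ₗ[ℝ] ℝ
  eval_at : ∀ (f : M → ℝ) (V W : S.Vsf), ContMDiff (IQ (n + 1)) 𝓘(ℝ, ℝ) ∞ f →
    (∀ p', W.1 p' = f p' • V.1 p') → toFun W = f p * toFun V

/-- The total space of the rescaled cotangent bundle. -/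
abbrev SfPoint := Σ p : M, S.SfCotangent p

end Bundle

/-- Local coordinates `(x, y)` on `M` near interior points of the main face. -/
structure MfChart where
  e : PartialEquiv M (ℝ × Vec n)
  open_source : IsOpen e.source
  open_target : ∃ V : Set (ℝ × Vec n), IsOpen V ∧ e.target = {b ∈ V | 0 ≤ b.1}
  smooth : ContMDiffOn (IQ (n + 1)) 𝓘(ℝ, ℝ × Vec n) ∞ e e.source
  smooth_symm : ContMDiffOn 𝓘(ℝ, ℝ × Vec n) (IQ (n + 1)) ∞ e.symm e.target
  away : ∀ p ∈ e.source, ∀ i, S.ρ i p ≠ 0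
  x_eq : ∀ p ∈ e.source, (e p).1 = S.x p

/-- Local coordinates `(x'', x̃, y', y'')` on `M` near the corner of the main face and `H i`: here
`x''` and `x̃` define the main face and `H i`, `x = x̃ x''`, and the fibres of `φ_i` are given by
`y' = const`. -/
structure CornerChart (i : ι) where
  e : PartialEquiv M (ℝ × ℝ × Vec (l i) × Vec (m i))
  open_source : IsOpen e.source
  open_target : ∃ V : Set (ℝ × ℝ × Vec (l i) × Vec (m i)), IsOpen V ∧
    e.target = {b ∈ V | 0 ≤ b.1 ∧ 0 ≤ b.2.1}
  smooth : ContMDiffOn (IQ (n + 1)) 𝓘(ℝ, ℝ × ℝ × Vec (l i) × Vec (m i)) ∞ e e.source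
  smooth_symm : ContMDiffOn 𝓘(ℝ, ℝ × ℝ × Vec (l i) × Vec (m i)) (IQ (n + 1)) ∞ e.symm e.target
  mf_iff : ∀ p ∈ e.source, S.ρmf p = 0 ↔ (e p).1 = 0
  hyp_iff : ∀ p ∈ e.source, S.ρ i p = 0 ↔ (e p).2.1 = 0
  x_eq : ∀ p ∈ e.source, S.x p = (e p).2.1 * (e p).1
  fibre_iff : ∀ p ∈ e.source, ∀ p' ∈ e.source, S.ρ i p = 0 → S.ρ i p' = 0 →
    (S.proj i p = S.proj i p' ↔ (e p).2.2.1 = (e p').2.2.1)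

section Coordinates

variable [IsManifold (IQ (n + 1)) ∞ M] {S}

/-- The point `P` over the interior of the main face has coordinates `c = (y, τ, μ)`, that is, it
lies over `y` and equals `τ dx/x² + μ · dy/x`. -/
def MfChart.IsCoord (χ : S.MfChart) (P : S.SfPoint) (c : JetSpace n) : Prop :=
  P.1 ∈ χ.e.source ∧ S.ρmf P.1 = 0 ∧ c.1 = (χ.e P.1).2 ∧
    ∀ V : S.Vsf, Filter.Tendsto
      (fun p => c.2.1 * (dAt (n + 1) S.x p (V.1 p) / S.x p ^ 2)
        + ∑ j, c.2.2 j * (dAt (n + 1) (fun p' => (χ.e p').2 j) p (V.1 p) / S.x p))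
      (𝓝[{p | 0 < S.x p}] P.1) (𝓝 (P.2.toFun V))

/-- The point `P` over the main face has coordinates `c = ((x̃, y', y''), (τ, η, μ', μ''))`, that is,
it lies over `(x̃, y', y'')` and equals `τ dx/x² + η dx̃/x + μ' · dy'/x + μ'' · dy''/x''`. -/
def CornerChart.IsCoord {i : ι} (χ : S.CornerChart i) (P : S.SfPoint)
    (c : CornerPhase (l i) (m i)) : Prop :=
  P.1 ∈ χ.e.source ∧ S.ρmf P.1 = 0 ∧ c.1 = (χ.e P.1).2 ∧
    ∀ V : S.Vsf, Filter.Tendsto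
      (fun p => c.2.1 * (dAt (n + 1) S.x p (V.1 p) / S.x p ^ 2)
        + c.2.2.1 * (dAt (n + 1) (fun p' => (χ.e p').2.1) p (V.1 p) / S.x p)
        + ∑ j, c.2.2.2.1 j * (dAt (n + 1) (fun p' => (χ.e p').2.2.1 j) p (V.1 p) / S.x p)
        + ∑ j, c.2.2.2.2 j * (dAt (n + 1) (fun p' => (χ.e p').2.2.2 j) p (V.1 p) / (χ.e p).1))
      (𝓝[{p | 0 < S.x p}] P.1) (𝓝 (P.2.toFun V))

/-- The part of `L` in a coordinate patch, written in coordinates. -/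
def MfChart.image (χ : S.MfChart) (L : Set S.SfPoint) : Set (JetSpace n) :=
  {c | ∃ P ∈ L, χ.IsCoord P c}

/-- The part of `L` in a coordinate patch, written in coordinates. -/
def CornerChart.image {i : ι} (χ : S.CornerChart i) (L : Set S.SfPoint) :
    Set (CornerPhase (l i) (m i)) :=
  {c | ∃ P ∈ L, χ.IsCoord P c}

/-- The contact manifold over the base `Z i`: the quotient of the rescaled cotangent bundle
over `H i` by the scattering cotangent bundle of the fibres is the pull-back of this bundle, whose
elements are `τ dx/x² + ξ/x` with `ξ` a covector on `Z i`. -/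
abbrev SfN (_S : FibredCorners n M l m Z) (i : ι) :=
  Σ z : Z i, ℝ × (TangentSpace (𝓡 (l i)) z →L[ℝ] ℝ)

/-- The covector `ξ` on the base is `μ · dy'`. -/
def CornerChart.IsBaseCoord {i : ι} (χ : S.CornerChart i) (p : M)
    (ξ : TangentSpace (𝓡 (l i)) (S.proj i p) →L[ℝ] ℝ) (μ : Vec (l i)) : Prop :=
  ∀ v : TangentSpace (IQ (n + 1)) p, dAt (n + 1) (S.ρ i) p v = 0 →
    ξ (mfderiv (IQ (n + 1)) (𝓡 (l i)) (S.proj i) p v) =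
      ∑ j, μ j * dAt (n + 1) (fun p' => (χ.e p').2.2.1 j) p v

/-- The image of the part of `L` over the corner of the main face and `H i` in the contact manifold
over `Z i`. -/
def baseImage (L : Set S.SfPoint) (i : ι) : Set (SfN S i) :=
  {b | ∃ P ∈ L, ∃ χ : S.CornerChart i, ∃ c, χ.IsCoord P c ∧ S.ρ i P.1 = 0 ∧
    ∃ ξ, χ.IsBaseCoord P.1 ξ c.2.2.2.1 ∧ b = ⟨S.proj i P.1, c.2.1, ξ⟩}

/-- A set in the contact manifold over `Z i`, written in the coordinates `(y', τ, μ')`. -/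
def CornerChart.baseCoords {i : ι} (χ : S.CornerChart i) (B : Set (SfN S i)) :
    Set (JetSpace (l i)) :=
  {c | ∃ p ∈ χ.e.source, S.ρ i p = 0 ∧ c.1 = (χ.e p).2.2.1 ∧
    ∃ ξ, χ.IsBaseCoord p ξ c.2.2 ∧ (⟨S.proj i p, c.2.1, ξ⟩ : SfN S i) ∈ B}

/-- Legendre submanifolds: `L` is a Legendre submanifold over the main face, it is transversal to the
boundary of the main face, and over the corner it fibres over a Legendre submanifold of the contact
manifold over `Z i`, with fibres that are Legendre submanifolds for `dτ'' + μ'' · dy''`, `τ'' = -η`. -/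
structure IsLegendre (L : Set S.SfPoint) : Prop where
  over_mf : ∀ P ∈ L, S.ρmf P.1 = 0
  interior : ∀ χ : S.MfChart, IsLegendreJet (χ.image L)
  corner : ∀ i (χ : S.CornerChart i), IsLegendreCorner (χ.image L)
  base : ∀ i (χ : S.CornerChart i), IsLegendreJet (χ.baseCoords (baseImage L i))
  /-- The map onto the base is a submersion: it has a smooth local section through every point. -/
  submersion : ∀ i (χ : S.CornerChart i), ∀ g ∈ χ.image L, g.1.1 = 0 →
    ∃ (W : Set (JetSpace (l i))) (σ : JetSpace (l i) → CornerPhase (l i) (m i)),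
      IsOpen W ∧ toBase g ∈ W ∧ ContDiffOn ℝ ∞ σ W ∧ σ (toBase g) = g ∧
      ∀ b ∈ W ∩ χ.baseCoords (baseImage L i),
        σ b ∈ χ.image L ∧ (σ b).1.1 = 0 ∧ toBase (σ b) = b
  fibre : ∀ i (χ : S.CornerChart i), ∀ b ∈ χ.baseCoords (baseImage L i),
    IsLegendreJet {d : JetSpace (m i) |
      (((0, b.1, d.1), (b.2.1, -d.2.1, b.2.2, d.2.2)) : CornerPhase (l i) (m i)) ∈ χ.image L}

end Coordinates

end FibredCorners

/-! ### Parametrizations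

Smoothness up to the faces `x̃ = 0`, `x'' = 0` or `x = 0` means being the restriction of a smooth
function that is defined on both sides of the face; the values off the domain `x̃, x'', x ≥ 0` never
matter. -/

/-- A nondegenerate parametrization near `c`, by a phase function `φ(y, w) / x` with `w ∈ ℝ^k`, of
the Legendrian `G` over the interior of the main face. -/
structure MfParam {n : ℕ} (G : Set (JetSpace n)) (c : JetSpace n) (k : ℕ) where
  φ : Vec n × Vec k → ℝ
  dom : Set (Vec n × Vec k)
  pt : Vec n × Vec k
  isOpen_dom : IsOpen dom
  pt_mem : pt ∈ dom
  smooth : ContDiffOn ℝ ∞ φ dom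
  crit_pt : ∀ j, fderiv ℝ φ pt (0, Pi.single j 1) = 0
  /-- The point of the Legendrian is `d(φ/x)`, with components `τ = -φ`, `μ = d_y φ`. -/
  pt_eq : (pt.1, -φ pt, fun j => fderiv ℝ φ pt (Pi.single j 1, 0)) = c
  nondegenerate : LinearIndependent ℝ fun j : Fin k =>
    fderiv ℝ (fun z => fderiv ℝ φ z (0, Pi.single j 1)) pt
  parametrizes : ∃ W : Set (JetSpace n), IsOpen W ∧ c ∈ W ∧
    G ∩ W = (fun z : Vec n × Vec k => (z.1, -φ z, fun j => fderiv ℝ φ z (Pi.single j 1, 0))) ''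
      {z ∈ dom | ∀ j, fderiv ℝ φ z (0, Pi.single j 1) = 0} ∩ W

/-- The variables `(x̃, y', y'', v, w)`. -/
abbrev CornerVar (l m k k' : ℕ) : Type := ℝ × Vec l × Vec m × Vec k × Vec k'

/-- The phase `φ = φ₁(y', v) + x̃ φ₂(x̃, y', y'', v, w)`. -/
def cornerPhase {l m k k' : ℕ} (φ₁ : Vec l × Vec k → ℝ) (φ₂ : CornerVar l m k k' → ℝ)
    (z : CornerVar l m k k') : ℝ :=
  φ₁ (z.2.1, z.2.2.2.1) + z.1 * φ₂ z

/-- The set `C_φ = {x̃ ≥ 0, d_v φ = 0, d_w φ₂ = 0}`. -/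
def cornerCrit {l m k k' : ℕ} (φ₁ : Vec l × Vec k → ℝ) (φ₂ : CornerVar l m k k' → ℝ) :
    Set (CornerVar l m k k') :=
  {z | 0 ≤ z.1 ∧ (∀ j, fderiv ℝ (cornerPhase φ₁ φ₂) z (0, 0, 0, Pi.single j 1, 0) = 0) ∧
    ∀ j, fderiv ℝ φ₂ z (0, 0, 0, 0, Pi.single j 1) = 0}

/-- The point `(x̃, y', y'', d(φ/x))`: as `x = x̃ x''`, the components of `d(φ/x)` are `τ = -φ`,
`η = ∂φ/∂x̃`, `μ' = d_{y'} φ`, `μ'' = d_{y''} φ₂`. -/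
def cornerMap {l m k k' : ℕ} (φ₁ : Vec l × Vec k → ℝ) (φ₂ : CornerVar l m k k' → ℝ)
    (z : CornerVar l m k k') : CornerPhase l m :=
  ((z.1, z.2.1, z.2.2.1),
    (-cornerPhase φ₁ φ₂ z,
      fderiv ℝ (cornerPhase φ₁ φ₂) z (1, 0, 0, 0, 0),
      (fun j => fderiv ℝ (cornerPhase φ₁ φ₂) z (0, Pi.single j 1, 0, 0, 0)),
      (fun j => fderiv ℝ φ₂ z (0, 0, Pi.single j 1, 0, 0))))

/-- A nondegenerate parametrization near `c`, a point with `x̃ = 0`, by a phase function `φ / x`,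
`φ = φ₁(y', v) + x̃ φ₂(x̃, y', y'', v, w)` with `v ∈ ℝ^k`, `w ∈ ℝ^{k'}`, of the Legendrian `G` over
the main face. -/
structure CornerParam {l m : ℕ} (G : Set (CornerPhase l m)) (c : CornerPhase l m) (k k' : ℕ) where
  φ₁ : Vec l × Vec k → ℝ
  φ₂ : CornerVar l m k k' → ℝ
  dom : Set (CornerVar l m k k')
  pt : CornerVar l m k k'
  isOpen_dom : IsOpen dom
  pt_mem : pt ∈ dom
  pt_zero : pt.1 = 0
  smooth₁ : ContDiffOn ℝ ∞ φ₁ ((fun z => (z.2.1, z.2.2.2.1)) '' dom)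
  smooth₂ : ContDiffOn ℝ ∞ φ₂ dom
  crit_pt : pt ∈ cornerCrit φ₁ φ₂
  pt_eq : cornerMap φ₁ φ₂ pt = c
  /-- The differentials in `(y', v)` of the `∂φ₁/∂v_j` are independent. -/
  nondegenerate₁ : LinearIndependent ℝ fun j : Fin k =>
    fderiv ℝ (fun z : Vec l × Vec k => fderiv ℝ φ₁ z (0, Pi.single j 1)) (pt.2.1, pt.2.2.2.1)
  /-- The differentials in `(y'', w)` of the `∂φ₂/∂w_j` are independent. -/
  nondegenerate₂ : LinearIndependent ℝ fun j : Fin k' =>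
    fderiv ℝ (fun z : Vec m × Vec k' =>
      fderiv ℝ φ₂ (pt.1, pt.2.1, z.1, pt.2.2.2.1, z.2) (0, 0, 0, 0, Pi.single j 1))
      (pt.2.2.1, pt.2.2.2.2)
  parametrizes : ∃ W : Set (CornerPhase l m), IsOpen W ∧ c ∈ W ∧
    G ∩ W = cornerMap φ₁ φ₂ '' (dom ∩ cornerCrit φ₁ φ₂) ∩ W

/-! ### Oscillatory integrals -/

/-- The function `x^q ∫ e^{iφ(y, w)/x} a(x, y, w) dw` of `b = (x, y)`. -/
def mfOsc {n k : ℕ} (φ : Vec n × Vec k → ℝ) (a : ℝ × Vec n × Vec k → ℂ) (q : ℝ)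
    (b : ℝ × Vec n) : ℂ :=
  ((b.1 ^ q : ℝ) : ℂ) *
    ∫ w : Vec k, Complex.exp (Complex.I * ((φ (b.2, w) / b.1 : ℝ) : ℂ)) * a (b.1, b.2, w)

/-- The function `x^q x̃^r ∫ e^{iφ(x̃, y', y'', v, w)/x} a(x'', x̃, y', y'', v, w) dv dw`, where
`φ = φ₁ + x̃ φ₂` and `x = x̃ x''`, of `b = (x'', x̃, y', y'')`. -/
def cornerOsc {l m k k' : ℕ} (φ₁ : Vec l × Vec k → ℝ) (φ₂ : CornerVar l m k k' → ℝ)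
    (a : ℝ × CornerVar l m k k' → ℂ) (q r : ℝ) (b : ℝ × ℝ × Vec l × Vec m) : ℂ :=
  (((b.2.1 * b.1) ^ q * b.2.1 ^ r : ℝ) : ℂ) *
    ∫ t : Vec k × Vec k',
      Complex.exp (Complex.I *
        ((cornerPhase φ₁ φ₂ (b.2.1, b.2.2.1, b.2.2.2, t.1, t.2) / (b.2.1 * b.1) : ℝ) : ℂ)) *
      a (b.1, b.2.1, b.2.2.1, b.2.2.2, t.1, t.2)

end

end FibredLegendre

set_option linter.unusedSectionVars false
set_option synthInstance.maxSize 1024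

/-! Every nondegenerate phase near `Q` defines the same oscillatory integrals as one canonical phase
that depends only on `L` and on an auxiliary number `t`. The comparison is exact: the amplitudes
correspond with no remainder, so `u₀ = 0` works.

The analytic engine is the integral `h^(-1/2) ∫ e^{iws²/h} a(p, s) ds`. On the Fourier side it is a
constant times `∫ e^{iκhξ²} â(p, ξ) dξ`, which is smooth in `(h, p)` across `h = 0`. A quadratic
phase variable can therefore be integrated out. Conversely, one can be created by inserting a cutoff
in `s` and dividing by the resulting function of `h`, which does not vanish at `h = 0`
(`OscEquiv.addSquare`). With the Morse lemma with parameters, any phase variables with nondegenerate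
Hessian can be removed or introduced at scale `h` (`OscEquiv.eliminate`). Off the boundary `φ/x =
φ₁/x + φ₂/x''`, so there are two scales: `x` for `v` and `x''` for `w`.

To reach the canonical phase, introduce variables `(z', ν')` at scale `x` and `(z'', ν'')` at scale
`x''` through Fourier inversion in `y'` and `y''` (`OscEquiv.fourier`), with the terms `t/2 (|z|² -
|y|²)` added; these vanish at `z = y`. Now eliminate other variables than those that were added:
`(z'', w)` at scale `x''`, then `(z', v)` at scale `x`. The Hessians are of the form `t|u₁|² + b(u,
u)`, and nondegeneracy of the parametrization makes them invertible for all but finitely many `t`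
(`finite_degenerate_pencil`). Only `(ν', ν'')` remain, and the critical value is expressed by the
point `Γ(ν)` of `L` at which `(x̃, μ' + ty', μ'' + ty'')` equals `ν`.

For two parametrizations choose one `t` good for both. The map `momentum t` is a local
diffeomorphism on `L`, so `L` determines `Γ` for `x̃ ≥ 0` (`eventually_eq_of_sections`) and the
canonical phases agree there.

Each variable at scale `x` or `x''` costs a factor `x^(-1/2)` or `(x'')^(-1/2)`; as `x'' = x/x̃`,
this gives the stated exponents. Part (b) follows from part (a) applied to the product of `L` with a
half line in `x̃`, restricted to a slice `x̃ = ε`. -/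

namespace OscInt

open MeasureTheory Filter Complex FourierTransform

/-! ### The Schrödinger propagator and its smoothness across time zero. -/

section Schrodinger

variable {P V : Type} [NormedAddCommGroup P] [NormedSpace ℝ P]
  [NormedAddCommGroup V] [NormedSpace ℂ V]

/-- A compactly supported continuous function on `P × ℝ` is bounded by a multiple of the indicator
function of a bounded interval, uniformly in the parameter. -/
theorem exists_norm_le_indicator {V : Type} [NormedAddCommGroup V] {a : P × ℝ → V}
    (ha : Continuous a) (hc : HasCompactSupport a) :
    ∃ C R : ℝ, 0 ≤ C ∧ ∀ p s, ‖a (p, s)‖ ≤ (Set.Icc (-R) R).indicator (fun _ => C) s := by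
  obtain ⟨C, hC⟩ := hc.exists_bound_of_continuous ha
  obtain ⟨R, hR⟩ := (hc.image continuous_snd).isBounded.subset_closedBall (0 : ℝ)
  refine ⟨max C 0, R, le_max_right _ _, fun p s => ?_⟩
  by_cases hs : s ∈ Set.Icc (-R) R
  · rw [Set.indicator_of_mem hs]; exact (hC _).trans (le_max_left _ _)
  · rw [Set.indicator_of_notMem hs]
    have : a (p, s) = 0 := by
      by_contra h
      apply hs
      have : s ∈ Metric.closedBall (0 : ℝ) R :=
        hR ⟨(p, s), subset_tsupport _ (Function.mem_support.2 h), rfl⟩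
      rwa [Real.closedBall_eq_Icc, zero_sub, zero_add] at this
    simp [this]

theorem integrable_indicator_Icc (C R : ℝ) :
    Integrable ((Set.Icc (-R) R).indicator (fun _ : ℝ => C)) := by
  rw [integrable_indicator_iff measurableSet_Icc]
  exact integrableOn_const (by simp)

theorem integrable_slice {V : Type} [NormedAddCommGroup V] {a : P × ℝ → V}
    (ha : Continuous a) (hc : HasCompactSupport a) (p : P) : Integrable fun s => a (p, s) := by
  obtain ⟨C, R, -, h⟩ := exists_norm_le_indicator ha hc
  exact (integrable_indicator_Icc C R).mono' (by fun_prop) (.of_forall (h p))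

/-- The partial derivative in the last variable. -/
noncomputable def derivLast (a : P × ℝ → V) (z : P × ℝ) : V := fderiv ℝ a z (0, 1)

/-- The differential in the parameter. -/
noncomputable def derivParam (a : P × ℝ → V) (z : P × ℝ) : P →L[ℝ] V :=
  fderiv ℝ a z ∘L ContinuousLinearMap.inl ℝ P ℝ

theorem contDiff_derivLast {a : P × ℝ → V} (ha : ContDiff ℝ ∞ a) :
    ContDiff ℝ ∞ (derivLast a) :=
  (ha.fderiv_right (m := ∞) (by simp)).clm_apply contDiff_const

theorem contDiff_derivParam {a : P × ℝ → V} (ha : ContDiff ℝ ∞ a) :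
    ContDiff ℝ ∞ (derivParam a) :=
  (ha.fderiv_right (m := ∞) (by simp)).clm_comp contDiff_const

theorem hasCompactSupport_derivLast {a : P × ℝ → V} (hc : HasCompactSupport a) :
    HasCompactSupport (derivLast a) :=
  (hc.fderiv ℝ).comp_left (g := fun T : P × ℝ →L[ℝ] V => T (0, 1)) (by simp)

theorem hasCompactSupport_derivParam {a : P × ℝ → V} (hc : HasCompactSupport a) :
    HasCompactSupport (derivParam a) :=
  (hc.fderiv ℝ).comp_left
    (g := fun T : P × ℝ →L[ℝ] V => T ∘L ContinuousLinearMap.inl ℝ P ℝ) (by simp)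

/-- The Fourier transform in the last variable. -/
noncomputable def fourierLast (a : P × ℝ → V) (p : P) (ξ : ℝ) : V := 𝓕 (fun s => a (p, s)) ξ

theorem fourierLast_eq (a : P × ℝ → V) (p : P) (ξ : ℝ) :
    fourierLast a p ξ = ∫ s, cexp (↑(-2 * Real.pi * s * ξ) * I) • a (p, s) := by
  rw [fourierLast, Real.fourier_real_eq_integral_exp_smul]

theorem fourierLast_derivLast {a : P × ℝ → V} (ha : ContDiff ℝ ∞ a) (hc : HasCompactSupport a)
    (p : P) (ξ : ℝ) :
    fourierLast (derivLast a) p ξ = (2 * Real.pi * I * ξ) • fourierLast a p ξ := by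
  have hd : ∀ s, HasDerivAt (fun s => a (p, s)) (derivLast a (p, s)) s := fun s => by
    have h1 : HasFDerivAt a (fderiv ℝ a (p, s)) (p, s) :=
      (ha.differentiable (by simp)).differentiableAt.hasFDerivAt
    exact h1.comp_hasDerivAt s ((hasDerivAt_const s p).prodMk (hasDerivAt_id s))
  have hde : deriv (fun s => a (p, s)) = fun s => derivLast a (p, s) :=
    funext fun s => (hd s).deriv
  have := Real.fourier_deriv (integrable_slice ha.continuous hc p)
    (fun s => (hd s).differentiableAt) (by
      rw [hde]
      exact integrable_slice (contDiff_derivLast ha).continuous (hasCompactSupport_derivLast hc) p)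
  rw [hde] at this
  exact congrFun this ξ

theorem exists_norm_fourierLast_le {a : P × ℝ → V} (ha : ContDiff ℝ ∞ a)
    (hc : HasCompactSupport a) : ∃ C, ∀ p ξ, ‖fourierLast a p ξ‖ ≤ C := by
  obtain ⟨C, R, -, h⟩ := exists_norm_le_indicator ha.continuous hc
  refine ⟨∫ s, (Set.Icc (-R) R).indicator (fun _ => C) s, fun p ξ => ?_⟩
  rw [fourierLast_eq]
  refine norm_integral_le_of_norm_le (integrable_indicator_Icc C R) (.of_forall fun s => ?_)
  rw [norm_smul, Complex.norm_exp_ofReal_mul_I, one_mul]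
  exact h p s

/-- Two integrations by parts give a factor `ξ⁻²`, uniformly in the parameter. This is the
integrable majorant used below for differentiation under the integral. -/
theorem exists_norm_fourierLast_decay {a : P × ℝ → V} (ha : ContDiff ℝ ∞ a)
    (hc : HasCompactSupport a) :
    ∃ C, ∀ p ξ, ‖fourierLast a p ξ‖ ≤ C * (1 + ξ ^ 2)⁻¹ := by
  obtain ⟨C₀, h₀⟩ := exists_norm_fourierLast_le ha hc
  obtain ⟨C₂, h₂⟩ := exists_norm_fourierLast_le
    (contDiff_derivLast (contDiff_derivLast ha))
    (hasCompactSupport_derivLast (hasCompactSupport_derivLast hc))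
  refine ⟨C₀ + C₂, fun p ξ => ?_⟩
  have hpos : (0 : ℝ) < 1 + ξ ^ 2 := by positivity
  rw [← div_eq_mul_inv, le_div_iff₀ hpos]
  have h := h₂ p ξ
  rw [fourierLast_derivLast (contDiff_derivLast ha) (hasCompactSupport_derivLast hc),
    fourierLast_derivLast ha hc, smul_smul, norm_smul] at h
  have e : ‖(2 * Real.pi * I * ξ : ℂ) * (2 * Real.pi * I * ξ)‖ = (2 * Real.pi) ^ 2 * ξ ^ 2 := by
    simp only [norm_mul, Complex.norm_I, Complex.norm_real, Real.norm_eq_abs, Complex.norm_ofNat,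
      abs_of_pos Real.pi_pos]
    rw [← sq_abs ξ]; ring
  rw [e] at h
  have hpi : (1 : ℝ) ≤ (2 * Real.pi) ^ 2 := by
    have := Real.pi_gt_three; nlinarith
  have h3 : ξ ^ 2 * ‖fourierLast a p ξ‖ ≤ C₂ := by
    refine le_trans ?_ h
    have : 0 ≤ ξ ^ 2 * ‖fourierLast a p ξ‖ := by positivity
    nlinarith
  nlinarith [h₀ p ξ]

theorem hasFDerivAt_fourierLast [CompleteSpace V] {a : P × ℝ → V} (ha : ContDiff ℝ ∞ a)
    (hc : HasCompactSupport a) (p : P) (ξ : ℝ) :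
    HasFDerivAt (fun p => fourierLast a p ξ) (fourierLast (derivParam a) p ξ) p := by
  have e : ∀ s : ℝ, Continuous fun s : ℝ => cexp (↑(-2 * Real.pi * s * ξ) * I) := fun s => by
    fun_prop
  obtain ⟨C, R, -, h⟩ := exists_norm_le_indicator (contDiff_derivParam ha).continuous
    (hasCompactSupport_derivParam hc)
  have hInt : ∀ p, Integrable fun s => cexp (↑(-2 * Real.pi * s * ξ) * I) • a (p, s) := fun p =>
    (integrable_slice ha.continuous hc p).bdd_smul 1
      (Continuous.aestronglyMeasurable (by fun_prop)) (.of_forall fun s => by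
        rw [Complex.norm_exp_ofReal_mul_I])
  simp only [fourierLast_eq]
  refine hasFDerivAt_integral_of_dominated_of_fderiv_le
    (F' := fun p s => cexp (↑(-2 * Real.pi * s * ξ) * I) • derivParam a (p, s)) univ_mem
    (.of_forall fun p => (hInt p).1) (hInt p) ?_ (.of_forall fun s p _ => ?_)
    (integrable_indicator_Icc C R) (.of_forall fun s p _ => ?_)
  · have := (contDiff_derivParam ha).continuous
    fun_prop
  · rw [norm_smul, Complex.norm_exp_ofReal_mul_I, one_mul]
    exact h p s
  · have h1 : HasFDerivAt a (fderiv ℝ a (p, s)) (p, s) :=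
      (ha.differentiable (by simp)).differentiableAt.hasFDerivAt
    exact (h1.comp p (hasFDerivAt_prodMk_left p s)).const_smul _

theorem continuous_fourierLast [CompleteSpace V] {a : P × ℝ → V} (ha : ContDiff ℝ ∞ a)
    (hc : HasCompactSupport a) (p : P) : Continuous (fourierLast a p) := by
  have := VectorFourier.fourierIntegral_continuous (e := Real.fourierChar) (μ := volume)
    (L := innerₗ ℝ) Real.continuous_fourierChar continuous_inner
    (integrable_slice ha.continuous hc p)
  exact this

/-- The Schrödinger propagator in the last variable, evaluated at the origin. -/
noncomputable def schrodinger (κ : ℝ) (a : P × ℝ → V) (z : ℝ × P) : V :=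
  ∫ ξ : ℝ, cexp (↑(κ * z.1 * ξ ^ 2) * I) • fourierLast a z.2 ξ

theorem integrable_schrodinger [CompleteSpace V] {a : P × ℝ → V} (ha : ContDiff ℝ ∞ a)
    (hc : HasCompactSupport a) (κ h : ℝ) (p : P) :
    Integrable fun ξ : ℝ => cexp (↑(κ * h * ξ ^ 2) * I) • fourierLast a p ξ := by
  obtain ⟨C, hC⟩ := exists_norm_fourierLast_decay ha hc
  have := continuous_fourierLast ha hc p
  refine (integrable_inv_one_add_sq.const_mul C).mono' (by fun_prop) (.of_forall fun ξ => ?_)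
  rw [norm_smul, Complex.norm_exp_ofReal_mul_I, one_mul]
  exact hC p ξ

/-- Differentiating in time brings down `iκξ²`, which on the Fourier side is a constant times `∂ₛ²`.
The derivative is thus again made of propagators of compactly supported smooth amplitudes, and the
argument can be iterated. -/
theorem hasFDerivAt_schrodinger [CompleteSpace V] {a : P × ℝ → V} (ha : ContDiff ℝ ∞ a)
    (hc : HasCompactSupport a) (κ : ℝ) (z : ℝ × P) :
    HasFDerivAt (schrodinger κ a)
      ((ContinuousLinearMap.fst ℝ ℝ P).smulRight
          ((-(κ / (2 * Real.pi) ^ 2) * I : ℂ) • schrodinger κ (derivLast (derivLast a)) z) +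
        schrodinger κ (derivParam a) z ∘L ContinuousLinearMap.snd ℝ ℝ P) z := by
  set a₂ := derivLast (derivLast a) with ha₂
  have ha₂s : ContDiff ℝ ∞ a₂ := contDiff_derivLast (contDiff_derivLast ha)
  have ha₂c : HasCompactSupport a₂ := hasCompactSupport_derivLast (hasCompactSupport_derivLast hc)
  have hps := contDiff_derivParam ha
  have hpc := hasCompactSupport_derivParam hc
  obtain ⟨C₂, hC₂⟩ := exists_norm_fourierLast_decay ha₂s ha₂c
  obtain ⟨C₁, hC₁⟩ := exists_norm_fourierLast_decay hps hpc
  set c : ℂ := -(κ / (2 * Real.pi) ^ 2) * I with hcdef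
  have hpi : (Real.pi : ℂ) ≠ 0 := by simp [Real.pi_ne_zero]
  let F' : ℝ × P → ℝ → (ℝ × P →L[ℝ] V) := fun z ξ =>
    (ContinuousLinearMap.fst ℝ ℝ P).smulRight
        (c • (cexp (↑(κ * z.1 * ξ ^ 2) * I) • fourierLast a₂ z.2 ξ)) +
      (cexp (↑(κ * z.1 * ξ ^ 2) * I) • fourierLast (derivParam a) z.2 ξ) ∘L
        ContinuousLinearMap.snd ℝ ℝ P
  have hF'int : ∫ ξ, F' z ξ = (ContinuousLinearMap.fst ℝ ℝ P).smulRight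
          (c • schrodinger κ a₂ z) +
        schrodinger κ (derivParam a) z ∘L ContinuousLinearMap.snd ℝ ℝ P := by
    have i₁ := (integrable_schrodinger ha₂s ha₂c κ z.1 z.2).smul c
    have i₂ := integrable_schrodinger hps hpc κ z.1 z.2
    let L₁ : V →L[ℝ] (ℝ × P →L[ℝ] V) :=
      ContinuousLinearMap.smulRightL ℝ (ℝ × P) V (ContinuousLinearMap.fst ℝ ℝ P)
    let L₂ : (P →L[ℝ] V) →L[ℝ] (ℝ × P →L[ℝ] V) :=
      (ContinuousLinearMap.compL ℝ (ℝ × P) P V).flip (ContinuousLinearMap.snd ℝ ℝ P)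
    have e₁ := L₁.integral_comp_comm i₁
    have e₂ := L₂.integral_comp_comm i₂
    have : (∫ ξ, F' z ξ) = ∫ ξ, (L₁ ((c • fun ξ : ℝ => cexp (↑(κ * z.1 * ξ ^ 2) * I) •
        fourierLast a₂ z.2 ξ) ξ) + L₂ (cexp (↑(κ * z.1 * ξ ^ 2) * I) •
          fourierLast (derivParam a) z.2 ξ)) := rfl
    rw [this, integral_add (L₁.integrable_comp i₁) (L₂.integrable_comp i₂), e₁, e₂]
    simp only [Pi.smul_apply]
    rw [integral_smul]
    rfl
  rw [← hF'int]
  have hfc := fun p => continuous_fourierLast ha hc p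
  have hfc₂ := fun p => continuous_fourierLast ha₂s ha₂c p
  have hfcp := fun p => continuous_fourierLast hps hpc p
  refine hasFDerivAt_integral_of_dominated_of_fderiv_le (F' := F')
    (bound := fun ξ => (‖c‖ * C₂ + C₁) * (1 + ξ ^ 2)⁻¹)
    univ_mem (.of_forall fun z => (integrable_schrodinger ha hc κ z.1 z.2).1)
    (integrable_schrodinger ha hc κ z.1 z.2) ?_ (.of_forall fun ξ z _ => ?_)
    (integrable_inv_one_add_sq.const_mul _) (.of_forall fun ξ z _ => ?_)
  · have := hfc₂ z.2
    have := hfcp z.2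
    have h1 : Continuous (F' z) := by
      have k₁ : Continuous fun ξ : ℝ =>
        (c • (cexp (↑(κ * z.1 * ξ ^ 2) * I) • fourierLast a₂ z.2 ξ)) := by fun_prop
      have k₂ : Continuous fun ξ : ℝ =>
        (cexp (↑(κ * z.1 * ξ ^ 2) * I) • fourierLast (derivParam a) z.2 ξ) := by fun_prop
      exact ((ContinuousLinearMap.smulRightL ℝ (ℝ × P) V
        (ContinuousLinearMap.fst ℝ ℝ P)).continuous.comp k₁).add (k₂.clm_comp continuous_const)
    exact h1.aestronglyMeasurable
  · refine (norm_add_le _ _).trans ?_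
    rw [add_mul]
    refine add_le_add ?_ ?_
    · rw [ContinuousLinearMap.norm_smulRight_apply, norm_smul, norm_smul,
        Complex.norm_exp_ofReal_mul_I, one_mul, mul_assoc]
      refine (mul_le_of_le_one_left (by positivity) (ContinuousLinearMap.norm_fst_le ..)).trans ?_
      exact mul_le_mul_of_nonneg_left (hC₂ _ _) (norm_nonneg _)
    · refine (ContinuousLinearMap.opNorm_comp_le _ _).trans ?_
      refine (mul_le_of_le_one_right (by positivity) (ContinuousLinearMap.norm_snd_le ..)).trans ?_
      rw [norm_smul, Complex.norm_exp_ofReal_mul_I, one_mul]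
      exact hC₁ _ _
  · have hexp : HasFDerivAt (fun z : ℝ × P => cexp (↑(κ * z.1 * ξ ^ 2) * I))
        ((ContinuousLinearMap.fst ℝ ℝ P).smulRight
          (cexp (↑(κ * z.1 * ξ ^ 2) * I) * (κ * ξ ^ 2 * I))) z := by
      have h1 : HasDerivAt (fun h : ℝ => cexp (↑(κ * h * ξ ^ 2) * I))
          (cexp (↑(κ * z.1 * ξ ^ 2) * I) * (κ * ξ ^ 2 * I)) z.1 := by
        have h0 : HasDerivAt (fun h : ℝ => κ * h * ξ ^ 2) (κ * ξ ^ 2) z.1 := by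
          simpa using ((hasDerivAt_id z.1).const_mul κ).mul_const (ξ ^ 2)
        have h00 := h0.ofReal_comp.mul_const I
        simpa using h00.cexp
      have := h1.hasFDerivAt.comp z (hasFDerivAt_fst (𝕜 := ℝ) (p := z))
      refine this.congr_fderiv ?_
      ext <;> simp
    have h2 := (hasFDerivAt_fourierLast ha hc z.2 ξ).comp z (hasFDerivAt_snd (𝕜 := ℝ) (p := z))
    have h3 := hexp.smul h2
    refine h3.congr_fderiv ?_
    have e : fourierLast a₂ z.2 ξ = ((2 * Real.pi * I * ξ) * (2 * Real.pi * I * ξ) : ℂ) •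
        fourierLast a z.2 ξ := by
      rw [ha₂, fourierLast_derivLast (contDiff_derivLast ha) (hasCompactSupport_derivLast hc),
        fourierLast_derivLast ha hc, smul_smul]
    have hcc : (c * (cexp (↑(κ * z.1 * ξ ^ 2) * I) *
        ((2 * Real.pi * I * ξ) * (2 * Real.pi * I * ξ))) : ℂ)
        = cexp (↑(κ * z.1 * ξ ^ 2) * I) * (κ * ξ ^ 2 * I) := by
      rw [hcdef]
      generalize cexp (↑(κ * z.1 * ξ ^ 2) * I) = E
      field_simp
      linear_combination (-(κ : ℂ) * E * ξ ^ 2) * I_sq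
    ext v
    · rw [← hcc]
      simp [F', e, smul_smul, mul_assoc]
    · simp [F', e, smul_smul]

/-- The induction ranges over all target spaces because the parameter derivative of `a` takes values
in `P →L[ℝ] V`. -/
theorem contDiff_schrodinger_nat (n : ℕ) : ∀ {V : Type} [NormedAddCommGroup V] [NormedSpace ℂ V]
    [CompleteSpace V] {a : P × ℝ → V}, ContDiff ℝ ∞ a → HasCompactSupport a → ∀ κ : ℝ,
    ContDiff ℝ n (schrodinger κ a) := by
  induction n with
  | zero =>
    intro V _ _ _ a ha hc κ
    exact contDiff_zero.2 (continuous_iff_continuousAt.2 fun z =>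
      (hasFDerivAt_schrodinger ha hc κ z).continuousAt)
  | succ n ih =>
    intro V _ _ _ a ha hc κ
    have h := hasFDerivAt_schrodinger ha hc κ
    refine contDiff_succ_iff_hasFDerivAt (n := n) |>.2 ⟨_, ?_, h⟩
    refine ContDiff.add ?_ ?_
    · exact (ContinuousLinearMap.smulRightL ℝ (ℝ × P) V
        (ContinuousLinearMap.fst ℝ ℝ P)).contDiff.comp
        (((ih (contDiff_derivLast (contDiff_derivLast ha))
        (hasCompactSupport_derivLast (hasCompactSupport_derivLast hc)) κ)).const_smul _)
    · exact (ih (contDiff_derivParam ha) (hasCompactSupport_derivParam hc) κ).clm_comp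
        contDiff_const

theorem contDiff_schrodinger [CompleteSpace V] {a : P × ℝ → V} (ha : ContDiff ℝ ∞ a)
    (hc : HasCompactSupport a) (κ : ℝ) : ContDiff ℝ ∞ (schrodinger κ a) :=
  contDiff_infty.2 fun n => contDiff_schrodinger_nat n ha hc κ

theorem schrodinger_eq_zero {a : P × ℝ → V} {p : P} (h : ∀ s, a (p, s) = 0) (κ t : ℝ) :
    schrodinger κ a (t, p) = 0 := by
  simp [schrodinger, fourierLast_eq, h]

end Schrodinger

end OscInt

namespace OscInt

open MeasureTheory Filter Complex FourierTransform

/-! ### Imaginary Gaussian integrals as propagators. -/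

section Gaussian

/-- The constant in the Fourier transform of an imaginary Gaussian. -/
noncomputable def gaussConst (w : ℝ) : ℂ := (-(w : ℂ) * I / Real.pi) ^ (1 / 2 : ℂ)

theorem gaussConst_ne_zero {w : ℝ} (hw : w ≠ 0) : gaussConst w ≠ 0 := by
  have : (-(w : ℂ) * I / Real.pi) ≠ 0 := by simp [hw, Real.pi_ne_zero]
  simp [gaussConst, Complex.cpow_eq_zero_iff, hw, Real.pi_ne_zero]

/-- The Fourier transform is moved from `f` onto the Gaussian, whose transform is explicit when it
decays. -/
theorem integral_fourier_mul_gaussian {f : ℝ → ℂ} (hf : Integrable f) {d : ℂ} (hd : 0 < d.re) :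
    ∫ ξ : ℝ, cexp (-(Real.pi ^ 2 / d) * ξ ^ 2) * 𝓕 f ξ =
      (d / Real.pi) ^ (1 / 2 : ℂ) * ∫ s : ℝ, cexp (-d * s ^ 2) * f s := by
  have hpi : (Real.pi : ℂ) ≠ 0 := by simp [Real.pi_ne_zero]
  have hd0 : d ≠ 0 := by rintro rfl; simp at hd
  set b : ℂ := Real.pi / d with hb
  have hbre : 0 < b.re := by
    rw [hb, Complex.div_re]
    simp only [ofReal_re, ofReal_im, zero_mul, zero_div, add_zero]
    have := Complex.normSq_pos.2 hd0
    have := Real.pi_pos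
    positivity
  have hg : Integrable fun ξ : ℝ => cexp (-Real.pi * b * ξ ^ 2) := by
    have := integrable_cexp_quadratic (b := Real.pi * b) (by
      rw [Complex.re_ofReal_mul]; exact mul_pos Real.pi_pos hbre) 0 0
    simpa using this
  have key := VectorFourier.integral_fourierIntegral_smul_eq_flip (L := innerₗ ℝ)
    (μ := volume) (ν := volume) Real.continuous_fourierChar continuous_inner hf hg
  have e1 : VectorFourier.fourierIntegral Real.fourierChar volume (innerₗ ℝ) f = 𝓕 f := rfl
  have e2 : VectorFourier.fourierIntegral Real.fourierChar volume (innerₗ ℝ).flip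
      (fun ξ : ℝ => cexp (-Real.pi * b * ξ ^ 2)) = 𝓕 fun ξ : ℝ => cexp (-Real.pi * b * ξ ^ 2) := by
    rw [flip_innerₗ]; rfl
  rw [e1, e2, fourier_gaussian_pi hbre] at key
  -- Principal powers commute with inversion away from the negative axis; here `b` has positive real
  -- part.
  have c1 : 1 / b ^ (1 / 2 : ℂ) = (d / Real.pi) ^ (1 / 2 : ℂ) := by
    rw [one_div, ← inv_cpow, hb, inv_div]
    rw [Ne, arg_eq_pi_iff, not_and_or, not_lt]
    exact Or.inl hbre.le
  have c2 : -(Real.pi : ℂ) / b = -d := by rw [hb]; field_simp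
  have c3 : ∀ ξ : ℝ, cexp (-(Real.pi ^ 2 / d) * ξ ^ 2) * 𝓕 f ξ =
      𝓕 f ξ • cexp (-Real.pi * b * ξ ^ 2) := fun ξ => by
    rw [smul_eq_mul, mul_comm, hb]; congr 2; ring
  rw [integral_congr_ae (.of_forall c3), key, ← integral_const_mul]
  simp only [smul_eq_mul, c1, c2]
  congr 1; ext s; ring

/-- A Gaussian with `Re c ≥ 0` is bounded by `1`, so `‖g‖` dominates all the way to the imaginary
axis. -/
theorem tendsto_integral_cexp_mul {g : ℝ → ℂ} (hg : Integrable g) {c : ℝ → ℂ} {c₀ : ℂ}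
    (hc : Tendsto c (𝓝[>] 0) (𝓝 c₀)) (hre : ∀ᶠ ε in 𝓝[>] 0, 0 ≤ (c ε).re) :
    Tendsto (fun ε => ∫ s : ℝ, cexp (-(c ε) * s ^ 2) * g s) (𝓝[>] 0)
      (𝓝 (∫ s : ℝ, cexp (-c₀ * s ^ 2) * g s)) := by
  refine tendsto_integral_filter_of_dominated_convergence (fun s => ‖g s‖) ?_ ?_ hg.norm ?_
  · exact .of_forall fun ε => AEStronglyMeasurable.mul (by fun_prop) hg.1
  · filter_upwards [hre] with ε hε
    refine .of_forall fun s => ?_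
    rw [norm_mul]
    refine mul_le_of_le_one_left (norm_nonneg _) ?_
    rw [Complex.norm_exp, Real.exp_le_one_iff]
    have : (-(c ε) * (s : ℂ) ^ 2).re = -((c ε).re * s ^ 2) := by
      rw [← ofReal_pow, Complex.re_mul_ofReal, neg_re]; ring
    rw [this]
    have : 0 ≤ (c ε).re * s ^ 2 := by positivity
    linarith
  · refine .of_forall fun s => ?_
    exact (((hc.neg.mul_const _).cexp).mul_const _)

/-- The purely imaginary exponent is the limit of `ε - iw/h` as `ε ↓ 0`. Integrability of both `f`
and its transform lets both sides of the decaying identity converge. -/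
theorem integral_cexp_imaginary_mul {f : ℝ → ℂ} (hf : Integrable f) (hf' : Integrable (𝓕 f))
    {w h : ℝ} (hw : w ≠ 0) (hh : 0 < h) :
    gaussConst w * (((h ^ (-(1 / 2 : ℝ)) : ℝ) : ℂ) *
        ∫ s : ℝ, cexp (I * ((w * s ^ 2 / h : ℝ) : ℂ)) * f s) =
      ∫ ξ : ℝ, cexp (↑(-(Real.pi ^ 2 / w) * h * ξ ^ 2) * I) * 𝓕 f ξ := by
  have hpi : (Real.pi : ℂ) ≠ 0 := by simp [Real.pi_ne_zero]
  have hwc : (w : ℂ) ≠ 0 := by simp [hw]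
  have hhc : (h : ℂ) ≠ 0 := by simp [hh.ne']
  let d : ℝ → ℂ := fun ε => ε - w / h * I
  have hd : Tendsto d (𝓝[>] 0) (𝓝 (-(w / h * I))) := by
    have : ContinuousAt d 0 := by fun_prop
    have h2 := this.tendsto
    simp only [d, ofReal_zero, zero_sub] at h2
    exact h2.mono_left nhdsWithin_le_nhds
  have hdre : ∀ ε, (d ε).re = ε := fun ε => by
    simp only [d, sub_re, ofReal_re]
    rw [← ofReal_div, Complex.re_ofReal_mul]; simp
  have hd0 : -(w / h * I : ℂ) ≠ 0 := by simp [hw, hh.ne']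
  have h1 := tendsto_integral_cexp_mul hf hd (by
    filter_upwards [self_mem_nhdsWithin] with ε hε
    rw [hdre]; exact le_of_lt hε)
  have h2 := tendsto_integral_cexp_mul (c := fun ε => Real.pi ^ 2 / d ε) hf'
    (tendsto_const_nhds.div hd hd0) (by
    filter_upwards [self_mem_nhdsWithin] with ε hε
    have hε' : (0 : ℝ) < ε := hε
    rw [← ofReal_pow, Complex.div_re]
    simp only [ofReal_re, ofReal_im, zero_mul, zero_div, add_zero, hdre]
    have := Complex.normSq_nonneg (d ε)
    positivity)
  have h3 : Tendsto (fun ε => (d ε / Real.pi) ^ (1 / 2 : ℂ)) (𝓝[>] 0)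
      (𝓝 ((-(w / h * I) / Real.pi) ^ (1 / 2 : ℂ))) := by
    -- The limit is imaginary and nonzero, hence off the branch cut of the square root.
    have : ContinuousAt (fun z : ℂ => z ^ (1 / 2 : ℂ)) (-(w / h * I) / Real.pi) := by
      apply continuousAt_cpow_const
      right
      have : (-(w / h * I) / Real.pi : ℂ) = ((-(w / h) / Real.pi : ℝ) : ℂ) * I := by
        push_cast; ring
      rw [this, Complex.im_ofReal_mul]
      simp [hw, hh.ne', Real.pi_ne_zero]
    exact this.tendsto.comp (hd.div_const _)
  have heq : (fun ε => ∫ s : ℝ, cexp (-(Real.pi ^ 2 / d ε) * s ^ 2) * 𝓕 f s) =ᶠ[𝓝[>] 0]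
      fun ε => (d ε / Real.pi) ^ (1 / 2 : ℂ) * ∫ s : ℝ, cexp (-(d ε) * s ^ 2) * f s := by
    filter_upwards [self_mem_nhdsWithin] with ε hε
    exact integral_fourier_mul_gaussian hf (by rw [hdre]; exact hε)
  have h4 := tendsto_nhds_unique (h2.congr' heq) (h3.mul h1)
  have e1 : ((-(w / h * I) / Real.pi : ℂ)) ^ (1 / 2 : ℂ) =
      gaussConst w * ((h ^ (-(1 / 2 : ℝ)) : ℝ) : ℂ) := by
    have : (-(w / h * I) / Real.pi : ℂ) = ((h⁻¹ : ℝ) : ℂ) * (-(w : ℂ) * I / Real.pi) := by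
      push_cast; field_simp
    have hne : (-(w : ℂ) * I / Real.pi) ≠ 0 := by simp [hw, Real.pi_ne_zero]
    rw [this, gaussConst, Complex.cpow_def_of_ne_zero (mul_ne_zero (by simp [hh.ne']) hne),
      Complex.cpow_def_of_ne_zero hne, Complex.log_ofReal_mul (inv_pos.2 hh) hne, add_mul,
      Complex.exp_add, mul_comm, Real.rpow_def_of_pos hh]
    congr 1
    rw [Real.log_inv]
    push_cast
    congr 1
    ring
  rw [e1] at h4
  rw [← mul_assoc]
  have i1 : ∀ s : ℝ, cexp (I * ((w * s ^ 2 / h : ℝ) : ℂ)) * f s =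
      cexp (-(-(w / h * I)) * s ^ 2) * f s := fun s => by
    congr 2; push_cast; field_simp
  have i2 : ∀ ξ : ℝ, cexp (↑(-(Real.pi ^ 2 / w) * h * ξ ^ 2) * I) * 𝓕 f ξ =
      cexp (-(Real.pi ^ 2 / -(w / h * I)) * ξ ^ 2) * 𝓕 f ξ := fun ξ => by
    congr 2; push_cast; field_simp [I_ne_zero]; simp
  simp only [i1, i2]
  exact h4.symm

variable {P : Type} [NormedAddCommGroup P] [NormedSpace ℝ P]

/-- The normalized imaginary Gaussian transform of `a` in the last variable; smooth in the
parameters and in the semiclassical parameter `h ∈ ℝ`. -/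
noncomputable def gaussTransform (w : ℝ) (a : P × ℝ → ℂ) (z : ℝ × P) : ℂ :=
  (gaussConst w)⁻¹ * schrodinger (-(Real.pi ^ 2 / w)) a z

theorem contDiff_gaussTransform {a : P × ℝ → ℂ} (ha : ContDiff ℝ ∞ a) (hc : HasCompactSupport a)
    (w : ℝ) : ContDiff ℝ ∞ (gaussTransform w a) :=
  contDiff_const.mul (contDiff_schrodinger ha hc _)

theorem gaussTransform_eq {a : P × ℝ → ℂ} (ha : ContDiff ℝ ∞ a) (hc : HasCompactSupport a)
    {w h : ℝ} (hw : w ≠ 0) (hh : 0 < h) (p : P) :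
    gaussTransform w a (h, p) = ((h ^ (-(1 / 2 : ℝ)) : ℝ) : ℂ) *
        ∫ s : ℝ, cexp (I * ((w * s ^ 2 / h : ℝ) : ℂ)) * a (p, s) := by
  have h0 := integrable_schrodinger ha hc 0 0 p
  have := integral_cexp_imaginary_mul (integrable_slice ha.continuous hc p)
    (by simpa [fourierLast] using h0) hw hh
  rw [gaussTransform, schrodinger, inv_mul_eq_iff_eq_mul₀ (gaussConst_ne_zero hw), this]
  rfl

/-- At `h = 0` the oscillating factor disappears and Fourier inversion at `s = 0` remains. This is
the leading term of stationary phase; it shows that a cutoff equal to `1` at the origin has a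
nonzero transform at `h = 0`. -/
theorem gaussTransform_zero {a : P × ℝ → ℂ} (ha : ContDiff ℝ ∞ a) (hc : HasCompactSupport a)
    (w : ℝ) (p : P) : gaussTransform w a (0, p) = (gaussConst w)⁻¹ * a (p, 0) := by
  have h0 := integrable_schrodinger ha hc 0 0 p
  have hcont : Continuous fun s => a (p, s) := by
    have := ha.continuous
    fun_prop
  have h1 : Integrable (𝓕 (fun s => a (p, s))) := by simpa [fourierLast] using h0
  have := hcont.fourierInv_fourier_eq (integrable_slice ha.continuous hc p) h1
  have h2 := congrFun this 0
  rw [Real.fourierInv_eq'] at h2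
  rw [gaussTransform, schrodinger]
  congr 1
  simp only [inner_zero_right, mul_zero, ofReal_zero, zero_mul, Complex.exp_zero, one_smul] at h2 ⊢
  exact h2

theorem gaussTransform_eq_zero {a : P × ℝ → ℂ} {p : P} (h : ∀ s, a (p, s) = 0) (w t : ℝ) :
    gaussTransform w a (t, p) = 0 := by
  rw [gaussTransform, schrodinger_eq_zero h, mul_zero]

end Gaussian

end OscInt

/-! ### Equivalence of oscillatory integrals and fibrewise changes of variables. -/

namespace OscInt

open MeasureTheory Filter Complex

instance instIsAddHaarMeasureVolumeProd {E F : Type} [NormedAddCommGroup E] [NormedSpace ℝ E]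
    [FiniteDimensional ℝ E] [MeasureSpace E] [BorelSpace E]
    [(volume : Measure E).IsAddHaarMeasure] [NormedAddCommGroup F] [NormedSpace ℝ F]
    [FiniteDimensional ℝ F] [MeasureSpace F] [BorelSpace F]
    [(volume : Measure F).IsAddHaarMeasure] : (volume : Measure (E × F)).IsAddHaarMeasure :=
  inferInstanceAs ((volume : Measure E).prod (volume : Measure F)).IsAddHaarMeasure

/-- A smooth map with invertible derivative is locally a diffeomorphism. -/
theorem exists_localDiffeo {X Y : Type} [NormedAddCommGroup X] [NormedSpace ℝ X] [CompleteSpace X]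
    [NormedAddCommGroup Y] [NormedSpace ℝ Y] {g : X → Y} {x₀ : X}
    (hg : ∀ᶠ x in 𝓝 x₀, ContDiffAt ℝ ∞ g x) {L : X ≃L[ℝ] Y}
    (hL : HasFDerivAt g (L : X →L[ℝ] Y) x₀) {U : Set X} (hU : U ∈ 𝓝 x₀) :
    ∃ e : OpenPartialHomeomorph X Y, x₀ ∈ e.source ∧ e.source ⊆ U ∧ (∀ x, e x = g x) ∧
      (∀ x ∈ e.source, ContDiffAt ℝ ∞ g x ∧ ∃ L : X ≃L[ℝ] Y, HasFDerivAt g (L : X →L[ℝ] Y) x) ∧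
      ∀ y ∈ e.target, ContDiffAt ℝ ∞ e.symm y := by
  have hg₀ : ContDiffAt ℝ ∞ g x₀ := hg.self_of_nhds
  have hinv : ∀ᶠ x in 𝓝 x₀, fderiv ℝ g x ∈
      Set.range ((↑) : (X ≃L[ℝ] Y) → (X →L[ℝ] Y)) := by
    have hc : ContinuousAt (fderiv ℝ g) x₀ :=
      (hg₀.fderiv_right (m := 0) (by simp)).continuousAt
    refine hc.eventually_mem ?_
    rw [hL.fderiv]
    exact ContinuousLinearEquiv.nhds L
  obtain ⟨W, hW, hWo, hxW⟩ := mem_nhds_iff.1 (hg.and (hinv.and hU))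
  let e₀ := hg₀.toOpenPartialHomeomorph g hL (by simp)
  have key : ∀ x ∈ (e₀.restrOpen W hWo).source,
      ContDiffAt ℝ ∞ g x ∧ ∃ L : X ≃L[ℝ] Y, HasFDerivAt g (L : X →L[ℝ] Y) x := by
    rintro x ⟨-, hx⟩
    obtain ⟨h1, ⟨L', hL'⟩, -⟩ := hW hx
    exact ⟨h1, L', hL' ▸ (h1.differentiableAt (by simp)).hasFDerivAt⟩
  refine ⟨e₀.restrOpen W hWo, ⟨hg₀.mem_toOpenPartialHomeomorph_source hL (by simp), hxW⟩,
    fun x hx => (hW hx.2).2.2, fun x => rfl, key, fun y hy => ?_⟩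
  have hs := (e₀.restrOpen W hWo).map_target hy
  obtain ⟨h1, L', h2⟩ := key _ hs
  exact OpenPartialHomeomorph.contDiffAt_symm _ hy h2 h1

/-- Needed for smoothness of the Jacobian factor absorbed into the amplitude. -/
theorem contDiff_det {E : Type} [NormedAddCommGroup E] [NormedSpace ℝ E] [FiniteDimensional ℝ E] :
    ContDiff ℝ ∞ (fun T : E →L[ℝ] E => T.det) := by
  let b := Module.finBasis ℝ E
  have : (fun T : E →L[ℝ] E => T.det) = fun T : E →L[ℝ] E =>
      ∑ σ : Equiv.Perm (Fin (Module.finrank ℝ E)), (Equiv.Perm.sign σ : ℤ) •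
        ∏ i, b.coord (σ i) (T (b i)) := by
    ext T
    rw [ContinuousLinearMap.det, ← LinearMap.det_toMatrix b, Matrix.det_apply]
    simp [LinearMap.toMatrix_apply, Units.smul_def]
  rw [this]
  refine ContDiff.sum fun σ _ => ContDiff.const_smul _ (contDiff_prod fun i _ => ?_)
  have h1 : ContDiff ℝ ∞ (LinearMap.toContinuousLinearMap (b.coord (σ i))) :=
    ContinuousLinearMap.contDiff _
  exact h1.comp (contDiff_id.clm_apply contDiff_const)

variable {B : Type} [NormedAddCommGroup B] [NormedSpace ℝ B] [FiniteDimensional ℝ B]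
variable {E : Type} [NormedAddCommGroup E] [NormedSpace ℝ E] [FiniteDimensional ℝ E]
  [MeasureSpace E] [BorelSpace E] [(volume : Measure E).IsAddHaarMeasure]
variable {E' : Type} [NormedAddCommGroup E'] [NormedSpace ℝ E'] [FiniteDimensional ℝ E']
  [MeasureSpace E'] [BorelSpace E'] [(volume : Measure E').IsAddHaarMeasure]
variable {E'' : Type} [NormedAddCommGroup E''] [NormedSpace ℝ E''] [FiniteDimensional ℝ E'']
  [MeasureSpace E''] [BorelSpace E''] [(volume : Measure E'').IsAddHaarMeasure]

/-- Near `z₀`, every oscillatory integral with phase `θ` and normalization `N` can be written,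
over the base points in `Pos`, as one with phase `θ'` and normalization `N'`, with an amplitude
supported in a prescribed neighbourhood of `z₀'`. -/
def OscLE (Pos : Set B) (N : B → ℝ) (θ : B × E → ℝ) (z₀ : B × E)
    (N' : B → ℝ) (θ' : B × E' → ℝ) (z₀' : B × E') : Prop :=
  ∀ U' ∈ 𝓝 z₀', ∃ U ∈ 𝓝 z₀, ∀ a : B × E → ℂ, ContDiff ℝ ∞ a → HasCompactSupport a →
    tsupport a ⊆ U → ∃ b : B × E' → ℂ, ContDiff ℝ ∞ b ∧ HasCompactSupport b ∧ tsupport b ⊆ U' ∧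
      ∀ β ∈ Pos, (N β : ℂ) * ∫ e, cexp (I * (θ (β, e) : ℂ)) * a (β, e) =
        (N' β : ℂ) * ∫ e, cexp (I * (θ' (β, e) : ℂ)) * b (β, e)

/-- Two phases define the same oscillatory integrals near the given points. -/
def OscEquiv (Pos : Set B) (N : B → ℝ) (θ : B × E → ℝ) (z₀ : B × E)
    (N' : B → ℝ) (θ' : B × E' → ℝ) (z₀' : B × E') : Prop :=
  OscLE Pos N θ z₀ N' θ' z₀' ∧ OscLE Pos N' θ' z₀' N θ z₀

variable {Pos : Set B} {N N' N'' : B → ℝ} {θ : B × E → ℝ} {θ' : B × E' → ℝ} {θ'' : B × E'' → ℝ}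
  {z₀ : B × E} {z₀' : B × E'} {z₀'' : B × E''}

/-- The prescribed target neighbourhood in `OscLE` is what makes the steps composable: the new
amplitude can be kept where the next step applies. -/
theorem OscLE.trans (h : OscLE Pos N θ z₀ N' θ' z₀') (h' : OscLE Pos N' θ' z₀' N'' θ'' z₀'') :
    OscLE Pos N θ z₀ N'' θ'' z₀'' := by
  intro U'' hU''
  obtain ⟨U', hU', H'⟩ := h' U'' hU''
  obtain ⟨U, hU, H⟩ := h U' hU'
  refine ⟨U, hU, fun a ha hc hs => ?_⟩
  obtain ⟨b, hb, hbc, hbs, e⟩ := H a ha hc hs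
  obtain ⟨b', hb', hbc', hbs', e'⟩ := H' b hb hbc hbs
  exact ⟨b', hb', hbc', hbs', fun β hβ => (e β hβ).trans (e' β hβ)⟩

theorem OscEquiv.trans (h : OscEquiv Pos N θ z₀ N' θ' z₀')
    (h' : OscEquiv Pos N' θ' z₀' N'' θ'' z₀'') : OscEquiv Pos N θ z₀ N'' θ'' z₀'' :=
  ⟨h.1.trans h'.1, h'.2.trans h.2⟩

theorem OscEquiv.symm (h : OscEquiv Pos N θ z₀ N' θ' z₀') : OscEquiv Pos N' θ' z₀' N θ z₀ :=
  ⟨h.2, h.1⟩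

/-- Only the germ of the phase over `Pos` matters. Phases such as `φ/x` are meaningless at `x = 0`,
and no continuity in the base is asked of them. -/
theorem OscLE.of_eventuallyEq {θ₁ : B × E → ℝ} (hN : ∀ β ∈ Pos, N β = N' β)
    (h : ∀ᶠ z in 𝓝 z₀, z.1 ∈ Pos → θ z = θ₁ z) : OscLE Pos N θ z₀ N' θ₁ z₀ := by
  intro U' hU'
  refine ⟨U' ∩ {z | z.1 ∈ Pos → θ z = θ₁ z}, inter_mem hU' h, fun a ha hc hs =>
    ⟨a, ha, hc, hs.trans Set.inter_subset_left, fun β hβ => ?_⟩⟩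
  rw [hN β hβ]
  congr 2; ext e
  by_cases hz : (β, e) ∈ tsupport a
  · rw [(hs hz).2 hβ]
  · rw [image_eq_zero_of_notMem_tsupport hz, mul_zero, mul_zero]

theorem OscEquiv.of_eventuallyEq {θ₁ : B × E → ℝ} (hN : ∀ β ∈ Pos, N β = N' β)
    (h : ∀ᶠ z in 𝓝 z₀, z.1 ∈ Pos → θ z = θ₁ z) : OscEquiv Pos N θ z₀ N' θ₁ z₀ :=
  ⟨.of_eventuallyEq hN h,
    .of_eventuallyEq (fun β hβ => (hN β hβ).symm) (h.mono fun _ hz hp => (hz hp).symm)⟩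

theorem OscEquiv.congr_left {θ₁ : B × E → ℝ} {M : B → ℝ} (hM : ∀ β ∈ Pos, M β = N β)
    (hθ : ∀ᶠ z in 𝓝 z₀, z.1 ∈ Pos → θ₁ z = θ z) (h : OscEquiv Pos N θ z₀ N' θ' z₀') :
    OscEquiv Pos M θ₁ z₀ N' θ' z₀' :=
  (OscEquiv.of_eventuallyEq hM hθ).trans h

/-- Substitution in the integral over each fibre; the new amplitude is the pull-back times the fibre
Jacobian. -/
theorem OscLE.of_fibreDiffeo {θ₁ : B × E → ℝ} {Ξ : B × E → B × E}
    (hΞ : ∀ᶠ z in 𝓝 z₀, ContDiffAt ℝ ∞ Ξ z) (hfst : ∀ᶠ z in 𝓝 z₀, (Ξ z).1 = z.1)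
    {L : (B × E) ≃L[ℝ] (B × E)} (hL : HasFDerivAt Ξ (L : B × E →L[ℝ] B × E) z₀)
    (hθ : ∀ᶠ z in 𝓝 z₀, z.1 ∈ Pos → θ₁ z = θ (Ξ z)) :
    OscLE Pos N θ (Ξ z₀) N θ₁ z₀ := by
  intro U' hU'
  obtain ⟨e, hz₀, hsub, he, hsm, hsymm⟩ := exists_localDiffeo hΞ hL (inter_mem hU' (hfst.and hθ))
  have hefst : ∀ z ∈ e.source, (Ξ z).1 = z.1 := fun z hz => (hsub hz).2.1
  refine ⟨e.target, e.open_target.mem_nhds (he z₀ ▸ e.map_source hz₀), fun a ha hc hs => ?_⟩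
  let D : B × E → (E →L[ℝ] E) := fun z =>
    (ContinuousLinearMap.snd ℝ B E) ∘L (fderiv ℝ Ξ z) ∘L (ContinuousLinearMap.inr ℝ B E)
  -- As `Ξ` preserves the base, a vertical vector killed by the fibre derivative is killed by the
  -- whole derivative, which is injective.
  have hdet : ∀ z ∈ e.source, (D z).det ≠ 0 := by
    intro z hz h0
    rw [ContinuousLinearMap.det, LinearMap.det_eq_zero_iff_ker_ne_bot] at h0
    apply h0
    rw [LinearMap.ker_eq_bot']
    intro v hv
    obtain ⟨-, L', hL'⟩ := hsm z hz
    have h1 : (fderiv ℝ Ξ z (0, v)).2 = 0 := hv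
    have h2 : (fderiv ℝ Ξ z (0, v)).1 = 0 := by
      have h3 : (fun z => (Ξ z).1) =ᶠ[𝓝 z] Prod.fst := by
        filter_upwards [e.open_source.mem_nhds hz] with y hy using hefst y hy
      have h4 := hL'.fst
      have h5 := (hasFDerivAt_fst (𝕜 := ℝ) (p := z)).congr_of_eventuallyEq h3
      have h6 := DFunLike.congr_fun (h4.unique h5) (0, v)
      rw [hL'.fderiv]
      simpa using h6
    have h3 : L' (0, v) = 0 := by
      have : fderiv ℝ Ξ z (0, v) = 0 := Prod.ext h2 h1
      rwa [hL'.fderiv] at this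
    have := L'.map_eq_zero_iff.1 h3
    exact (Prod.mk_eq_zero.1 this).2
  classical
  -- Extension by zero is smooth because the support is a compact subset of the open source; the
  -- absolute value is smooth because the determinant does not vanish there.
  let b : B × E → ℂ := fun z => if z ∈ e.source then (|(D z).det| : ℝ) • a (Ξ z) else 0
  have hK : IsCompact (e.symm '' tsupport a) :=
    hc.isCompact.image_of_continuousOn (e.continuousOn_symm.mono hs)
  have hKsub : e.symm '' tsupport a ⊆ e.source := by
    rintro _ ⟨y, hy, rfl⟩; exact e.map_target (hs hy)
  have hsupp : Function.support b ⊆ e.symm '' tsupport a := by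
    intro z hz
    have hzs : z ∈ e.source := by
      by_contra h; exact hz (if_neg h)
    refine ⟨Ξ z, ?_, ?_⟩
    · by_contra h
      refine hz ?_
      simp only [b, if_pos hzs, image_eq_zero_of_notMem_tsupport h, smul_zero]
    · rw [← he, e.left_inv hzs]
  have htsupp : tsupport b ⊆ e.symm '' tsupport a := closure_minimal hsupp hK.isClosed
  refine ⟨b, ?_, HasCompactSupport.of_support_subset_isCompact hK hsupp,
    htsupp.trans (hKsub.trans fun z hz => (hsub hz).1), fun β hβ => ?_⟩
  · rw [contDiff_iff_contDiffAt]
    intro z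
    by_cases hz : z ∈ e.source
    · have hev : b =ᶠ[𝓝 z] fun z => (|(D z).det| : ℝ) • a (Ξ z) := by
        filter_upwards [e.open_source.mem_nhds hz] with y hy using if_pos hy
      refine ContDiffAt.congr_of_eventuallyEq ?_ hev
      have h1 := (hsm z hz).1
      have hD : ContDiffAt ℝ ∞ D z :=
        contDiffAt_const.clm_comp ((h1.fderiv_right (m := ∞) (by simp)).clm_comp contDiffAt_const)
      have hdet' : ContDiffAt ℝ ∞ (fun z => (D z).det) z :=
        (contDiff_det.contDiffAt (x := D z)).comp z hD
      have habs : ContDiffAt ℝ ∞ (fun z => |(D z).det|) z :=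
        ContDiffAt.comp (f := fun z => (D z).det) (g := fun x => |x|) z
          (contDiffAt_abs (n := ⊤) (hdet z hz)) hdet'
      exact habs.smul (ha.contDiffAt.comp z h1)
    · have hz' : z ∉ e.symm '' tsupport a := fun h => hz (hKsub h)
      have hev : b =ᶠ[𝓝 z] fun _ => 0 := by
        filter_upwards [hK.isClosed.isOpen_compl.mem_nhds hz'] with y hy
        by_contra h
        exact hy (hsupp h)
      exact contDiffAt_const.congr_of_eventuallyEq hev
  · congr 1
    let s : Set E := {v | (β, v) ∈ e.source}
    let t : Set E := {v | (β, v) ∈ e.target}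
    let Θ : E → E := fun v => (Ξ (β, v)).2
    have hΞΘ : ∀ v ∈ s, Ξ (β, v) = (β, Θ v) := fun v hv => Prod.ext (hefst _ hv) rfl
    have hso : IsOpen s := e.open_source.preimage (by fun_prop)
    have hto : IsOpen t := e.open_target.preimage (by fun_prop)
    have him : Θ '' s = t := by
      ext v
      constructor
      · rintro ⟨u, hu, rfl⟩
        change (β, Θ u) ∈ e.target
        rw [← hΞΘ u hu, ← he]
        exact e.map_source hu
      · intro hv
        have hw := e.map_target hv
        have hr := e.right_inv hv
        rw [he] at hr
        have hf : (e.symm (β, v)).1 = β := by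
          rw [← hefst _ hw, hr]
        have hpair : e.symm (β, v) = (β, (e.symm (β, v)).2) := Prod.ext hf rfl
        refine ⟨(e.symm (β, v)).2, ?_, ?_⟩
        · change (β, (e.symm (β, v)).2) ∈ e.source
          rw [← hpair]; exact hw
        · change (Ξ (β, (e.symm (β, v)).2)).2 = v
          rw [← hpair, hr]
    have hinj : Set.InjOn Θ s := by
      intro u hu v hv huv
      have : e (β, u) = e (β, v) := by rw [he, he, hΞΘ u hu, hΞΘ v hv, huv]
      have := e.injOn hu hv this
      exact (Prod.mk.inj this).2
    have hder : ∀ v ∈ s, HasFDerivWithinAt Θ (D (β, v)) s v := by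
      intro v hv
      have h1 : HasFDerivAt Ξ (fderiv ℝ Ξ (β, v)) (β, v) :=
        ((hsm _ hv).1.differentiableAt (by simp)).hasFDerivAt
      exact (h1.comp v (hasFDerivAt_prodMk_right β v)).snd.hasFDerivWithinAt
    have hL : ∫ v, cexp (I * (θ (β, v) : ℂ)) * a (β, v) =
        ∫ v in t, cexp (I * (θ (β, v) : ℂ)) * a (β, v) := by
      refine (setIntegral_eq_integral_of_forall_compl_eq_zero fun v hv => ?_).symm
      rw [image_eq_zero_of_notMem_tsupport fun h => hv (hs h), mul_zero]
    have hR : ∫ v, cexp (I * (θ₁ (β, v) : ℂ)) * b (β, v) =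
        ∫ v in s, cexp (I * (θ₁ (β, v) : ℂ)) * b (β, v) := by
      refine (setIntegral_eq_integral_of_forall_compl_eq_zero fun v hv => ?_).symm
      have hv' : (β, v) ∉ e.source := hv
      simp only [b]
      rw [if_neg hv', mul_zero]
    rw [hL, hR, ← him, integral_image_eq_integral_abs_det_fderiv_smul volume hso.measurableSet
      hder hinj]
    refine setIntegral_congr_fun hso.measurableSet fun v hv => ?_
    have hv' : (β, v) ∈ e.source := hv
    simp only [b, if_pos hv']
    rw [(hsub hv').2.2 hβ, hΞΘ v hv, Complex.real_smul, Complex.real_smul]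
    ring

/-- The reverse comparison is the forward one for the local inverse of `Ξ`. -/
theorem OscEquiv.of_fibreDiffeo {θ₁ : B × E → ℝ} {Ξ : B × E → B × E}
    (hΞ : ∀ᶠ z in 𝓝 z₀, ContDiffAt ℝ ∞ Ξ z) (hfst : ∀ᶠ z in 𝓝 z₀, (Ξ z).1 = z.1)
    {L : (B × E) ≃L[ℝ] (B × E)} (hL : HasFDerivAt Ξ (L : B × E →L[ℝ] B × E) z₀)
    (hθ : ∀ᶠ z in 𝓝 z₀, z.1 ∈ Pos → θ₁ z = θ (Ξ z)) :
    OscEquiv Pos N θ (Ξ z₀) N θ₁ z₀ := by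
  refine ⟨.of_fibreDiffeo hΞ hfst hL hθ, ?_⟩
  obtain ⟨e, hz₀, hsub, he, hsm, hsymm⟩ := exists_localDiffeo hΞ hL (hfst.and hθ)
  have ht : Ξ z₀ ∈ e.target := he z₀ ▸ e.map_source hz₀
  have hz : e.symm (Ξ z₀) = z₀ := by rw [← he, e.left_inv hz₀]
  have hev : ∀ᶠ y in 𝓝 (Ξ z₀), y ∈ e.target := e.open_target.mem_nhds ht
  have hr : ∀ y ∈ e.target, Ξ (e.symm y) = y := fun y hy => by rw [← he, e.right_inv hy]
  have := OscLE.of_fibreDiffeo (Pos := Pos) (N := N) (z₀ := Ξ z₀) (θ := θ₁) (θ₁ := θ) (Ξ := e.symm)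
    (hev.mono hsymm) (hev.mono fun y hy => by
      rw [← (hsub (e.map_target hy)).1, hr y hy])
    (L := L.symm) (e.hasFDerivAt_symm ht (by
      rw [hz]
      exact hL.congr_of_eventuallyEq (.of_forall he)))
    (hev.mono fun y hy hp => by
      have h1 := (hsub (e.map_target hy))
      rw [h1.2 (by rw [← h1.1, hr y hy]; exact hp), hr y hy])
  rwa [hz] at this

/-- By uniqueness of Haar measure the push-forward of the volume is a constant multiple of the
volume; the constant goes into the amplitude. -/
theorem OscLE.of_linearEquiv (L : E ≃L[ℝ] E') (hθ : ∀ᶠ z in 𝓝 z₀, z.1 ∈ Pos →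
    θ z = θ' (z.1, L z.2)) : OscLE Pos N θ z₀ N θ' (z₀.1, L z₀.2) := by
  let Λ : (B × E) ≃L[ℝ] (B × E') := (ContinuousLinearEquiv.refl ℝ B).prodCongr L
  have hmap : (volume : Measure E).map L = ((volume : Measure E).map L).addHaarScalarFactor
    (volume : Measure E') • (volume : Measure E') :=
    Measure.isAddLeftInvariant_eq_smul _ _
  set c := ((volume : Measure E).map L).addHaarScalarFactor (volume : Measure E')
  intro U' hU'
  refine ⟨Λ ⁻¹' U' ∩ {z | z.1 ∈ Pos → θ z = θ' (z.1, L z.2)},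
    inter_mem (Λ.continuous.continuousAt.preimage_mem_nhds hU') hθ, fun a ha hc hs => ?_⟩
  refine ⟨fun z => (c : ℝ) • a (Λ.symm z), (ha.comp Λ.symm.contDiff).const_smul _,
    (hc.comp_homeomorph Λ.symm.toHomeomorph).smul_left (f := fun _ => (c : ℝ)), ?_, fun β hβ => ?_⟩
  · intro z hz
    have h1 : z ∈ tsupport (a ∘ Λ.symm.toHomeomorph) :=
      tsupport_smul_subset_right (fun _ => (c : ℝ)) (a ∘ Λ.symm.toHomeomorph) hz
    rw [tsupport_comp_eq_preimage] at h1
    have := (hs h1).1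
    simpa using this
  · congr 1
    have h1 : ∀ v, cexp (I * (θ (β, v) : ℂ)) * a (β, v) =
        (fun u => cexp (I * (θ' (β, u) : ℂ)) * a (β, L.symm u)) (L v) := fun v => by
      by_cases hz : (β, v) ∈ tsupport a
      · rw [(hs hz).2 hβ]; simp
      · simp [image_eq_zero_of_notMem_tsupport hz]
    have h2 := L.toHomeomorph.measurableEmbedding.integral_map (μ := volume)
      (fun u => cexp (I * (θ' (β, u) : ℂ)) * a (β, L.symm u))
    rw [integral_congr_ae (.of_forall h1)]
    refine h2.symm.trans ?_
    have h4 : ((L.toHomeomorph : E → E')) = L := rfl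
    rw [h4, hmap, integral_smul_nnreal_measure, NNReal.smul_def, ← integral_smul]
    congr 1; ext u
    simp only [Complex.real_smul]
    have h3 : Λ.symm (β, u) = (β, L.symm u) := rfl
    rw [h3]; ring

theorem OscEquiv.of_linearEquiv (L : E ≃L[ℝ] E') (hθ : ∀ᶠ z in 𝓝 z₀, z.1 ∈ Pos →
    θ z = θ' (z.1, L z.2)) : OscEquiv Pos N θ z₀ N θ' (z₀.1, L z₀.2) := by
  refine ⟨.of_linearEquiv L hθ, ?_⟩
  have := OscLE.of_linearEquiv (Pos := Pos) (N := N) (z₀ := (z₀.1, L z₀.2)) (θ := θ') (θ' := θ)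
    L.symm (by
      let Λ : (B × E) ≃L[ℝ] (B × E') := (ContinuousLinearEquiv.refl ℝ B).prodCongr L
      have h1 : Tendsto Λ.symm (𝓝 (z₀.1, L z₀.2)) (𝓝 z₀) := by
        have h2 := Λ.symm.continuous.tendsto (z₀.1, L z₀.2)
        have h3 : Λ.symm (z₀.1, L z₀.2) = z₀ := Λ.symm_apply_apply z₀
        rwa [h3] at h2
      filter_upwards [h1.eventually hθ] with z hz hp
      have := hz hp
      have h3 : Λ.symm z = (z.1, L.symm z.2) := rfl
      rw [h3] at this
      simpa using this.symm)
  simpa using this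

end OscInt

/-! ### Adding and removing quadratic phase variables. -/

namespace OscInt

open MeasureTheory Filter Complex

variable {B : Type} [NormedAddCommGroup B] [NormedSpace ℝ B] [FiniteDimensional ℝ B]
variable {E : Type} [NormedAddCommGroup E] [NormedSpace ℝ E] [FiniteDimensional ℝ E]
  [MeasureSpace E] [BorelSpace E] [(volume : Measure E).IsAddHaarMeasure]
variable {Pos : Set B} {N N' : B → ℝ} {θ : B × E → ℝ} {z₀ : B × E}

theorem norm_cexp_I_mul_ofReal (t : ℝ) : ‖cexp (I * t)‖ = 1 := by
  rw [mul_comm, Complex.norm_exp_ofReal_mul_I]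

/-- Adding a phase variable with a quadratic term, at scale `h`. -/
theorem OscEquiv.addSquare {h : B → ℝ} (hh : ContDiff ℝ ∞ h) (h0 : h z₀.1 = 0)
    (hpos : ∀ β ∈ Pos, 0 < h β) (hθ : ∀ β ∈ Pos, Measurable fun e => θ (β, e)) {w : ℝ}
    (hw : w ≠ 0) :
    OscEquiv Pos (fun β => N β * h β ^ (-(1 / 2 : ℝ)))
      (fun z : B × (E × ℝ) => θ (z.1, z.2.1) + w * z.2.2 ^ 2 / h z.1) (z₀.1, (z₀.2, 0))
      N θ z₀ := by
  constructor
  · intro U' hU'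
    -- Integrating `s` out projects the support, so no restriction on `s` is needed.
    refine ⟨(fun z : B × (E × ℝ) => (z.1, z.2.1)) ⁻¹' U', ?_, fun a ha hc hs => ?_⟩
    · exact ContinuousAt.preimage_mem_nhds (by fun_prop) hU'
    let Λ : ((B × E) × ℝ) ≃L[ℝ] (B × (E × ℝ)) := ContinuousLinearEquiv.prodAssoc ℝ B E ℝ
    have ha' : ContDiff ℝ ∞ (a ∘ Λ) := ha.comp Λ.contDiff
    have hc' : HasCompactSupport (a ∘ Λ) := hc.comp_homeomorph Λ.toHomeomorph
    have hK : IsCompact ((fun z : B × (E × ℝ) => (z.1, z.2.1)) '' tsupport a) :=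
      hc.isCompact.image (by fun_prop)
    -- Smooth also where `h ≤ 0`, since the transform is smooth for all real times; over `Pos` it is
    -- the normalized `s`-integral.
    let b : B × E → ℂ := fun p => gaussTransform w (a ∘ Λ) (h p.1, p)
    have hsupp : Function.support b ⊆ (fun z : B × (E × ℝ) => (z.1, z.2.1)) '' tsupport a := by
      intro p hp
      by_contra hcon
      refine hp (gaussTransform_eq_zero (fun s => ?_) _ _)
      have : a (p.1, (p.2, s)) = 0 :=
        image_eq_zero_of_notMem_tsupport fun hmem => hcon ⟨(p.1, (p.2, s)), hmem, rfl⟩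
      exact this
    refine ⟨b, ?_, HasCompactSupport.of_support_subset_isCompact hK hsupp, ?_, fun β hβ => ?_⟩
    · have := contDiff_gaussTransform ha' hc' w
      exact this.comp ((hh.comp contDiff_fst).prodMk contDiff_id)
    · refine (closure_minimal hsupp hK.isClosed).trans ?_
      rintro _ ⟨z, hz, rfl⟩
      exact hs hz
    · have hb : ∀ e, b (β, e) = ((h β ^ (-(1 / 2 : ℝ)) : ℝ) : ℂ) *
          ∫ s : ℝ, cexp (I * ((w * s ^ 2 / h β : ℝ) : ℂ)) * a (β, (e, s)) := fun e =>
        gaussTransform_eq ha' hc' hw (hpos β hβ) (β, e)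
      have hInt : Integrable (fun v : E × ℝ =>
          cexp (I * ((θ (β, v.1) + w * v.2 ^ 2 / h β : ℝ) : ℂ)) * a (β, v))
          ((volume : Measure E).prod volume) := by
        have hslice :
            Integrable (fun v : E × ℝ => a (β, v)) ((volume : Measure E).prod volume) := by
          refine Continuous.integrable_of_hasCompactSupport
            (ha.continuous.comp (by fun_prop)) ?_
          refine HasCompactSupport.intro (hc.isCompact.image continuous_snd) fun v hv => ?_
          exact image_eq_zero_of_notMem_tsupport fun hmem => hv ⟨_, hmem, rfl⟩
        refine hslice.bdd_smul 1 (Measurable.aestronglyMeasurable ?_)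
          (.of_forall fun v => (norm_cexp_I_mul_ofReal _).le)
        have h1 : Measurable fun v : E × ℝ => θ (β, v.1) := (hθ β hβ).comp measurable_fst
        have h2 : Measurable fun v : E × ℝ => w * v.2 ^ 2 / h β := by fun_prop
        have h3 := h1.add h2
        exact Complex.measurable_exp.comp ((Complex.measurable_ofReal.comp h3).const_mul I)
      rw [Measure.volume_eq_prod, integral_prod _ hInt]
      rw [ofReal_mul, mul_assoc, ← integral_const_mul]
      congr 1
      refine integral_congr_ae (.of_forall fun e => ?_)
      simp only [hb]
      rw [mul_left_comm]
      congr 1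
      rw [← integral_const_mul]
      refine integral_congr_ae (.of_forall fun s => ?_)
      simp only
      rw [ofReal_add, mul_add, Complex.exp_add, mul_assoc]
  · intro U' hU'
    have hU2 : (fun p : (B × E) × ℝ => (p.1.1, (p.1.2, p.2))) ⁻¹' U' ∈ 𝓝 (z₀, (0 : ℝ)) :=
      ContinuousAt.preimage_mem_nhds (by fun_prop) hU'
    obtain ⟨U, hU, V, hV, hUV⟩ := mem_nhds_prod_iff.1 hU2
    obtain ⟨ρ, hρs, hρc, hρ, -, hρ1⟩ :=
      exists_contDiff_tsupport_subset (n := ⊤) (x := (0 : ℝ)) hV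
    have hr : ContDiff ℝ ∞ (fun z : (Fin 0 → ℝ) × ℝ => (ρ z.2 : ℂ)) :=
      Complex.ofRealCLM.contDiff.comp ((hρ.of_le le_rfl).comp contDiff_snd)
    have hrc : HasCompactSupport (fun z : (Fin 0 → ℝ) × ℝ => (ρ z.2 : ℂ)) := by
      refine HasCompactSupport.intro (K := Set.univ ×ˢ tsupport ρ)
        ((Set.toFinite (Set.univ : Set (Fin 0 → ℝ))).isCompact.prod hρc) fun z hz => ?_
      have : z.2 ∉ tsupport ρ := fun hm => hz ⟨trivial, hm⟩
      rw [image_eq_zero_of_notMem_tsupport this, ofReal_zero]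
    -- The factor produced by integrating the cutoff `ρ` against the Gaussian at scale `t`. The
    -- zero-dimensional parameter space is a dummy. Dividing the given amplitude by `c (h β)`
    -- compensates for the factor, and `c 0 ≠ 0` allows this near `z₀`.
    let c : ℝ → ℂ := fun t => gaussTransform w (fun z : (Fin 0 → ℝ) × ℝ => (ρ z.2 : ℂ)) (t, 0)
    have hcs : ContDiff ℝ ∞ c :=
      (contDiff_gaussTransform hr hrc w).comp (contDiff_id.prodMk contDiff_const)
    have hc0 : c 0 ≠ 0 := by
      simp only [c]
      rw [gaussTransform_zero hr hrc, hρ1]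
      simp [gaussConst_ne_zero hw]
    have hcont : ContinuousAt (fun z : B × E => c (h z.1)) z₀ := by
      have h1 := hcs.continuous
      have h2 := hh.continuous
      fun_prop
    have hne : ∀ᶠ z : B × E in 𝓝 z₀, c (h z.1) ≠ 0 :=
      hcont.eventually_ne (by rw [h0]; exact hc0)
    refine ⟨U ∩ {z | c (h z.1) ≠ 0}, inter_mem hU hne, fun a ha hac has => ?_⟩
    let a₁ : B × E → ℂ := fun z => a z / c (h z.1)
    have ha₁ : ContDiff ℝ ∞ a₁ := by
      rw [contDiff_iff_contDiffAt]
      intro z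
      by_cases hz : z ∈ tsupport a
      · have h1 : ContDiffAt ℝ ∞ (fun z : B × E => c (h z.1)) z :=
          (hcs.comp (hh.comp contDiff_fst)).contDiffAt
        exact ha.contDiffAt.mul (h1.inv (has hz).2)
      · have hev : a₁ =ᶠ[𝓝 z] fun _ => 0 := by
          filter_upwards [(isClosed_tsupport a).isOpen_compl.mem_nhds hz] with y hy
          simp only [a₁]
          rw [image_eq_zero_of_notMem_tsupport hy, zero_div]
        exact contDiffAt_const.congr_of_eventuallyEq hev
    have hK : IsCompact ((fun p : (B × E) × ℝ => (p.1.1, (p.1.2, p.2))) ''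
        (tsupport a ×ˢ tsupport ρ)) := (hac.isCompact.prod hρc).image (by fun_prop)
    let b : B × (E × ℝ) → ℂ := fun z => a₁ (z.1, z.2.1) * (ρ z.2.2 : ℂ)
    have hsupp : Function.support b ⊆ (fun p : (B × E) × ℝ => (p.1.1, (p.1.2, p.2))) ''
        (tsupport a ×ˢ tsupport ρ) := by
      intro z hz
      refine ⟨((z.1, z.2.1), z.2.2), ⟨?_, ?_⟩, rfl⟩
      · by_contra hcon
        refine hz ?_
        simp only [b, a₁]
        rw [image_eq_zero_of_notMem_tsupport hcon, zero_div, zero_mul]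
      · by_contra hcon
        refine hz ?_
        simp only [b]
        rw [image_eq_zero_of_notMem_tsupport hcon, ofReal_zero, mul_zero]
    refine ⟨b, ?_, HasCompactSupport.of_support_subset_isCompact hK hsupp, ?_, fun β hβ => ?_⟩
    · refine (ha₁.comp (by fun_prop)).mul (Complex.ofRealCLM.contDiff.comp
        ((hρ.of_le le_rfl).comp (by fun_prop)))
    · refine (closure_minimal hsupp hK.isClosed).trans ?_
      rintro _ ⟨p, ⟨hp1, hp2⟩, rfl⟩
      exact hUV ⟨(has hp1).1, hρs hp2⟩
    · have hcβ : c (h β) = ((h β ^ (-(1 / 2 : ℝ)) : ℝ) : ℂ) *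
          ∫ s : ℝ, cexp (I * ((w * s ^ 2 / h β : ℝ) : ℂ)) * (ρ s : ℂ) :=
        gaussTransform_eq hr hrc hw (hpos β hβ) 0
      have e1 : ∀ v : E × ℝ, cexp (I * ((θ (β, v.1) + w * v.2 ^ 2 / h β : ℝ) : ℂ)) * b (β, v) =
          (cexp (I * (θ (β, v.1) : ℂ)) * a₁ (β, v.1)) *
            (cexp (I * ((w * v.2 ^ 2 / h β : ℝ) : ℂ)) * (ρ v.2 : ℂ)) := fun v => by
        simp only [b]
        push_cast
        rw [mul_add, Complex.exp_add]
        ring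
      rw [integral_congr_ae (.of_forall e1), Measure.volume_eq_prod,
        integral_prod_mul (fun e => cexp (I * (θ (β, e) : ℂ)) * a₁ (β, e))
          (fun s : ℝ => cexp (I * ((w * s ^ 2 / h β : ℝ) : ℂ)) * (ρ s : ℂ))]
      rw [ofReal_mul, mul_assoc (N β : ℂ), mul_left_comm ((h β ^ (-(1 / 2 : ℝ)) : ℝ) : ℂ), ← hcβ,
        ← integral_mul_const]
      congr 2
      ext e
      by_cases hz : (β, e) ∈ tsupport a
      · have : c (h β) ≠ 0 := (has hz).2
        simp only [a₁]
        field_simp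
      · simp only [a₁]
        rw [image_eq_zero_of_notMem_tsupport hz]
        simp

/-- Adding finitely many phase variables with quadratic terms, at scale `h`. -/
theorem OscEquiv.addSquares {h : B → ℝ} (hh : ContDiff ℝ ∞ h) (h0 : h z₀.1 = 0)
    (hpos : ∀ β ∈ Pos, 0 < h β) (hθ : ∀ β ∈ Pos, Measurable fun e => θ (β, e)) (d : ℕ)
    (w : Fin d → ℝ) (hw : ∀ i, w i ≠ 0) :
    OscEquiv Pos (fun β => N β * h β ^ (-(d / 2 : ℝ)))
      (fun z : B × (E × (Fin d → ℝ)) => θ (z.1, z.2.1) + (∑ i, w i * z.2.2 i ^ 2) / h z.1)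
      (z₀.1, (z₀.2, 0)) N θ z₀ := by
  induction d with
  | zero =>
    have := OscEquiv.of_linearEquiv (Pos := Pos) (N := N)
      (θ := fun z : B × (E × (Fin 0 → ℝ)) => θ (z.1, z.2.1)) (z₀ := (z₀.1, (z₀.2, 0))) (θ' := θ)
      (ContinuousLinearEquiv.prodUnique ℝ E (Fin 0 → ℝ)) (.of_forall fun z _ => rfl)
    refine OscEquiv.trans (OscEquiv.of_eventuallyEq ?_ (.of_forall fun z _ => ?_)) this
    · simp
    · simp
  | succ d ih =>
    -- The induction supplies all variables but the first, which is then added alone.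
    have h1 := ih (fun i => w i.succ) (fun i => hw _)
    have h2 := OscEquiv.addSquare (Pos := Pos) (N := fun β => N β * h β ^ (-(d / 2 : ℝ)))
      (θ := fun z : B × (E × (Fin d → ℝ)) =>
        θ (z.1, z.2.1) + (∑ i, w i.succ * z.2.2 i ^ 2) / h z.1)
      (z₀ := (z₀.1, (z₀.2, 0))) hh h0 hpos (fun β hβ => by
        have := hθ β hβ
        have h3 : Measurable fun e : E × (Fin d → ℝ) => θ (β, e.1) := this.comp measurable_fst
        have h4 : Measurable fun e : E × (Fin d → ℝ) =>
          (∑ i, w i.succ * e.2 i ^ 2) / h β := by fun_prop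
        exact h3.add h4) (hw 0)
    let L : ((E × (Fin d → ℝ)) × ℝ) ≃L[ℝ] (E × (Fin (d + 1) → ℝ)) :=
      (ContinuousLinearEquiv.prodAssoc ℝ E (Fin d → ℝ) ℝ).trans
        ((ContinuousLinearEquiv.refl ℝ E).prodCongr
          ((ContinuousLinearEquiv.prodComm ℝ (Fin d → ℝ) ℝ).trans
            (Fin.consEquivL ℝ (fun _ : Fin (d + 1) => ℝ))))
    have hL : ∀ v, L v = (v.1.1, Fin.cons v.2 v.1.2) := fun v => rfl
    have h3 := OscEquiv.of_linearEquiv (Pos := Pos) (N := fun β => N β * h β ^ (-(d / 2 : ℝ)) *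
        h β ^ (-(1 / 2 : ℝ)))
      (θ := fun z : B × ((E × (Fin d → ℝ)) × ℝ) => θ (z.1, z.2.1.1) +
        (∑ i, w i.succ * z.2.1.2 i ^ 2) / h z.1 + w 0 * z.2.2 ^ 2 / h z.1)
      (θ' := fun z : B × (E × (Fin (d + 1) → ℝ)) => θ (z.1, z.2.1) +
        (∑ i, w i * z.2.2 i ^ 2) / h z.1) (z₀ := (z₀.1, ((z₀.2, 0), 0))) L
      (.of_forall fun z _ => by
        simp only [hL, Fin.sum_univ_succ, Fin.cons_zero, Fin.cons_succ]
        ring)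
    have hpt : L ((z₀.2, 0), 0) = (z₀.2, 0) := by
      rw [hL]; ext1
      · rfl
      · funext i; refine Fin.cases ?_ (fun j => ?_) i <;> simp
    simp only [hpt] at h3
    refine OscEquiv.trans (OscEquiv.of_eventuallyEq ?_ (.of_forall fun z _ => rfl))
      (h3.symm.trans (h2.trans h1))
    intro β hβ
    rw [mul_assoc, ← Real.rpow_add (hpos β hβ)]
    congr 2
    push_cast; ring

end OscInt

namespace OscInt

open MeasureTheory Filter

/-! ### Integrals over the unit interval and Hadamard's lemma. -/

section Hadamard

variable {X : Type} [NormedAddCommGroup X] [NormedSpace ℝ X] [FiniteDimensional ℝ X]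

theorem hasFDerivAt_integral_unitInterval {V : Type} [NormedAddCommGroup V] [NormedSpace ℝ V]
    {g : X × ℝ → V} (hg : ContDiff ℝ ∞ g) (x : X) :
    HasFDerivAt (fun x => ∫ t in (0 : ℝ)..1, g (x, t))
      (∫ t in (0 : ℝ)..1, fderiv ℝ g (x, t) ∘L ContinuousLinearMap.inl ℝ X ℝ) x := by
  have hd : Continuous fun z : X × ℝ => fderiv ℝ g z ∘L ContinuousLinearMap.inl ℝ X ℝ :=
    (hg.continuous_fderiv (by simp)).clm_comp continuous_const
  obtain ⟨C, hC⟩ := ((isCompact_closedBall x 1).prod (isCompact_Icc (a := (0 : ℝ)) (b := 1))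
    ).exists_bound_of_continuousOn hd.continuousOn
  have hg' := hg.continuous
  refine intervalIntegral.hasFDerivAt_integral_of_dominated_of_fderiv_le
    (s := Metric.closedBall x 1)
    (F' := fun x t => fderiv ℝ g (x, t) ∘L ContinuousLinearMap.inl ℝ X ℝ)
    (bound := fun _ => C) (Metric.closedBall_mem_nhds x one_pos) ?_ ?_ ?_ ?_ ?_ ?_
  · exact .of_forall fun y => Continuous.aestronglyMeasurable (by fun_prop)
  · exact Continuous.intervalIntegrable (by fun_prop) _ _
  · exact Continuous.aestronglyMeasurable (hd.comp (by fun_prop))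
  · refine .of_forall fun t ht y hy => hC (y, t) ⟨hy, ?_⟩
    rw [Set.uIoc_of_le zero_le_one] at ht
    exact ⟨ht.1.le, ht.2⟩
  · exact intervalIntegrable_const
  · refine .of_forall fun t _ y _ => ?_
    have h1 : HasFDerivAt g (fderiv ℝ g (y, t)) (y, t) :=
      (hg.differentiable (by simp)).differentiableAt.hasFDerivAt
    exact h1.comp y (hasFDerivAt_prodMk_left y t)

theorem contDiff_integral_unitInterval_nat (n : ℕ) : ∀ {V : Type} [NormedAddCommGroup V]
    [NormedSpace ℝ V] {g : X × ℝ → V}, ContDiff ℝ ∞ g →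
    ContDiff ℝ n fun x => ∫ t in (0 : ℝ)..1, g (x, t) := by
  induction n with
  | zero =>
    intro V _ _ g hg
    exact contDiff_zero.2 (continuous_iff_continuousAt.2 fun x =>
      (hasFDerivAt_integral_unitInterval hg x).continuousAt)
  | succ n ih =>
    intro V _ _ g hg
    refine contDiff_succ_iff_hasFDerivAt (n := n) |>.2
      ⟨_, ?_, hasFDerivAt_integral_unitInterval hg⟩
    exact ih (g := fun z => fderiv ℝ g z ∘L ContinuousLinearMap.inl ℝ X ℝ)
      ((hg.fderiv_right (m := ∞) (by simp)).clm_comp contDiff_const)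

theorem contDiff_integral_unitInterval {V : Type} [NormedAddCommGroup V] [NormedSpace ℝ V]
    {g : X × ℝ → V} (hg : ContDiff ℝ ∞ g) :
    ContDiff ℝ ∞ fun x => ∫ t in (0 : ℝ)..1, g (x, t) :=
  contDiff_infty.2 fun n => contDiff_integral_unitInterval_nat n hg

variable {P F : Type} [NormedAddCommGroup P] [NormedSpace ℝ P] [FiniteDimensional ℝ P]
  [NormedAddCommGroup F] [NormedSpace ℝ F] [FiniteDimensional ℝ F]

/-- Hadamard's lemma with parameters. -/
theorem exists_hadamard {V : Type} [NormedAddCommGroup V] [NormedSpace ℝ V] [CompleteSpace V]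
    {g : P × F → V} (hg : ContDiff ℝ ∞ g) :
    ∃ G : P × F → (F →L[ℝ] V), ContDiff ℝ ∞ G ∧ (∀ p σ, g (p, σ) = g (p, 0) + G (p, σ) σ) ∧
      ∀ p, G (p, 0) = fderiv ℝ (fun σ => g (p, σ)) 0 := by
  let D : P × F → (F →L[ℝ] V) := fun z => fderiv ℝ g z ∘L ContinuousLinearMap.inr ℝ P F
  have hD : ContDiff ℝ ∞ D := (hg.fderiv_right (m := ∞) (by simp)).clm_comp contDiff_const
  have hd : ∀ p σ, HasFDerivAt (fun σ => g (p, σ)) (D (p, σ)) σ := fun p σ => by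
    have h1 : HasFDerivAt g (fderiv ℝ g (p, σ)) (p, σ) :=
      (hg.differentiable (by simp)).differentiableAt.hasFDerivAt
    exact h1.comp σ (hasFDerivAt_prodMk_right p σ)
  let m : (P × F) × ℝ → P × F := fun z => (z.1.1, z.2 • z.1.2)
  have hm : ContDiff ℝ ∞ m := by fun_prop
  -- The average of the `σ`-differential along the segment from `0` to `σ`.
  refine ⟨fun z => ∫ t in (0 : ℝ)..1, D (m (z, t)),
    contDiff_integral_unitInterval (hD.comp hm), fun p σ => ?_, fun p => ?_⟩
  · have hcont : Continuous fun t : ℝ => D (m ((p, σ), t)) :=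
      (hD.comp hm).continuous.comp (by fun_prop)
    have hder : ∀ t : ℝ, HasDerivAt (fun t : ℝ => g (p, t • σ)) (D (p, t • σ) σ) t := fun t => by
      have h2 : HasDerivAt (fun t : ℝ => t • σ) σ t := by
        simpa using (hasDerivAt_id t).smul_const σ
      have h3 : HasFDerivAt (fun σ => g (p, σ)) (D (p, t • σ)) ((fun t : ℝ => t • σ) t) :=
        hd p (t • σ)
      exact HasFDerivAt.comp_hasDerivAt (f := fun t : ℝ => t • σ) t h3 h2
    have := intervalIntegral.integral_eq_sub_of_hasDerivAt (a := 0) (b := 1)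
      (fun t _ => hder t) (Continuous.intervalIntegrable
        ((hcont.clm_apply continuous_const : Continuous fun t => D (m ((p, σ), t)) σ)) _ _)
    simp only [one_smul, zero_smul] at this
    rw [ContinuousLinearMap.intervalIntegral_apply (hcont.intervalIntegrable _ _)]
    simp only [m]
    rw [this]; abel
  · simp [m, (hd p 0).fderiv]

end Hadamard

end OscInt

namespace OscInt

open MeasureTheory Filter

/-! ### The Morse lemma with parameters. -/

section Morse

variable {P F : Type} [NormedAddCommGroup P] [NormedSpace ℝ P] [FiniteDimensional ℝ P]
  [NormedAddCommGroup F] [NormedSpace ℝ F] [FiniteDimensional ℝ F]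

theorem finrank_continuousDual : Module.finrank ℝ (F →L[ℝ] ℝ) = Module.finrank ℝ F := by
  rw [← LinearEquiv.finrank_eq (LinearMap.toContinuousLinearMap (𝕜 := ℝ) (E := F) (F' := ℝ))]
  exact Subspace.dual_finrank_eq

theorem exists_continuousLinearEquiv_of_injective {F' : Type} [NormedAddCommGroup F']
    [NormedSpace ℝ F'] [FiniteDimensional ℝ F'] (A : F →L[ℝ] F')
    (hdim : Module.finrank ℝ F = Module.finrank ℝ F') (hA : ∀ u, A u = 0 → u = 0) :
    ∃ A' : F ≃L[ℝ] F', (A' : F →L[ℝ] F') = A := by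
  have hinj : Function.Injective (A : F →ₗ[ℝ] F') :=
    (injective_iff_map_eq_zero (A : F →ₗ[ℝ] F')).2 hA
  refine ⟨(LinearEquiv.ofInjectiveOfFinrankEq _ hinj hdim).toContinuousLinearEquiv, ?_⟩
  ext u; rfl

/-- A second-order Taylor formula with parameters around a family of critical points. -/
theorem exists_symmetric_remainder {f : P × F → ℝ} (hf : ContDiff ℝ ∞ f) {s : P → F}
    (hs : ContDiff ℝ ∞ s) {p₀ : P}
    (hcrit : ∀ᶠ p in 𝓝 p₀, fderiv ℝ (fun σ => f (p, σ)) (s p) = 0) :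
    ∃ Q : P × F → (F →L[ℝ] F →L[ℝ] ℝ), ContDiff ℝ ∞ Q ∧ (∀ z u v, Q z u v = Q z v u) ∧
      ∀ᶠ p in 𝓝 p₀, ∀ σ, f (p, s p + σ) = f (p, s p) + Q (p, σ) σ σ := by
  let g : P × F → ℝ := fun z => f (z.1, s z.1 + z.2)
  have hg : ContDiff ℝ ∞ g :=
    hf.comp (contDiff_fst.prodMk ((hs.comp contDiff_fst).add contDiff_snd))
  obtain ⟨G, hG, hG1, hG2⟩ := exists_hadamard hg
  obtain ⟨K, hK, hK1, -⟩ := exists_hadamard hG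
  -- Hadamard's lemma applied twice gives a bilinear remainder `K`, not necessarily symmetric;
  -- symmetrizing leaves its values on the diagonal unchanged.
  refine ⟨fun z => (1 / 2 : ℝ) • (K z + (K z).flip), ?_, fun z u v => ?_, ?_⟩
  · refine ContDiff.const_smul (1 / 2 : ℝ) (hK.add ?_)
    exact contDiff_clm_apply_iff.2 fun u => contDiff_clm_apply_iff.2 fun v =>
      (hK.clm_apply contDiff_const).clm_apply contDiff_const
  · simp [add_comm]
  · filter_upwards [hcrit] with p hp σ
    have h0 : G (p, 0) = 0 := by
      rw [hG2]
      have h1 : (fun σ => g (p, σ)) = fun σ => (fun σ => f (p, σ)) (s p + σ) := rfl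
      rw [h1]
      exact (fderiv_comp_add_left (f := fun σ => f (p, σ)) (s p)).trans (by rw [add_zero, hp])
    have h2 := hG1 p σ
    rw [hK1 p σ, h0, zero_add] at h2
    simp only [g, add_zero] at h2
    rw [h2]
    simp only [smul_apply, add_apply, ContinuousLinearMap.flip_apply,
      smul_eq_mul]
    ring

/-- The second derivative at `0` of a function of the form `c + Q(σ)(σ, σ)` is `2 Q(0)`. -/
theorem snd_fderiv_of_eq_quadratic {γ : F → ℝ} (hγ : ContDiff ℝ ∞ γ)
    {Q : F → (F →L[ℝ] F →L[ℝ] ℝ)} (hQ : ContDiff ℝ ∞ Q) (hsymm : ∀ z u v, Q z u v = Q z v u)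
    {c : ℝ} (h : ∀ σ, γ σ = c + Q σ σ σ) (u v : F) :
    fderiv ℝ (fderiv ℝ γ) 0 u v = 2 * Q 0 u v := by
  have hQd : ∀ σ, HasFDerivAt Q (fderiv ℝ Q σ) σ := fun σ =>
    (hQ.differentiable (by simp)).differentiableAt.hasFDerivAt
  have h1 : ∀ σ, fderiv ℝ γ σ v = fderiv ℝ Q σ v σ σ + 2 * Q σ σ v := by
    intro σ
    have hd : HasFDerivAt (fun σ => c + Q σ σ σ) _ σ :=
      (((hQd σ).clm_apply (hasFDerivAt_id σ)).clm_apply (hasFDerivAt_id σ)).const_add c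
    have he : γ = fun σ => c + Q σ σ σ := funext h
    rw [he, hd.fderiv]
    simp
    rw [hsymm σ v σ]; ring
  have h2 : HasDerivAt (fun t : ℝ => fderiv ℝ γ (t • u) v) (fderiv ℝ (fderiv ℝ γ) 0 u v) 0 := by
    have hd : HasFDerivAt (fderiv ℝ γ) (fderiv ℝ (fderiv ℝ γ) 0) ((fun t : ℝ => t • u) 0) := by
      simp only [zero_smul]
      exact ((hγ.fderiv_right (m := ∞) (by simp)).differentiable
        (by simp)).differentiableAt.hasFDerivAt
    have hl : HasDerivAt (fun t : ℝ => t • u) u 0 := by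
      simpa using (hasDerivAt_id (0 : ℝ)).smul_const u
    have h3 := HasFDerivAt.comp_hasDerivAt (f := fun t : ℝ => t • u) (0 : ℝ) hd hl
    have := (ContinuousLinearMap.apply ℝ ℝ v).hasFDerivAt.comp_hasDerivAt (0 : ℝ) h3
    exact this
  have hX : ContDiff ℝ ∞ fun t : ℝ => fderiv ℝ Q (t • u) v u u :=
    ((((hQ.fderiv_right (m := ∞) (by simp)).comp (by fun_prop)).clm_apply
      contDiff_const).clm_apply contDiff_const).clm_apply contDiff_const
  have hY : ContDiff ℝ ∞ fun t : ℝ => Q (t • u) u v :=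
    ((hQ.comp (by fun_prop)).clm_apply contDiff_const).clm_apply contDiff_const
  -- Along the line `σ = t u` the term with the derivative of `Q` carries `t²` and contributes
  -- nothing at `t = 0`.
  have h3 : HasDerivAt (fun t : ℝ => t ^ 2 * fderiv ℝ Q (t • u) v u u + t * (2 * Q (t • u) u v))
      (2 * Q 0 u v) 0 := by
    have hX' := ((hX.differentiable (by simp)).differentiableAt (x := 0)).hasDerivAt
    have hY' := ((hY.differentiable (by simp)).differentiableAt (x := 0)).hasDerivAt
    have := ((hasDerivAt_pow 2 (0 : ℝ)).mul hX').add ((hasDerivAt_id (0 : ℝ)).mul (hY'.const_mul 2))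
    exact this.congr_deriv (by simp)
  have h4 : (fun t : ℝ => fderiv ℝ γ (t • u) v) =
      fun t : ℝ => t ^ 2 * fderiv ℝ Q (t • u) v u u + t * (2 * Q (t • u) u v) := by
    funext t
    rw [h1]
    simp only [map_smul, smul_apply, smul_eq_mul]
    ring
  rw [h4] at h2
  exact h2.unique h3

/-- A family of symmetric forms near a nondegenerate one is congruent to it, smoothly. -/
theorem exists_congruence (A : F ≃L[ℝ] (F →L[ℝ] ℝ)) (hA : ∀ u v, A u v = A v u) :
    ∃ R : (F →L[ℝ] F →L[ℝ] ℝ) → (F →L[ℝ] F),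
      (∀ᶠ q in 𝓝 (A : F →L[ℝ] F →L[ℝ] ℝ), ContDiffAt ℝ ∞ R q) ∧
      R (A : F →L[ℝ] F →L[ℝ] ℝ) = 1 ∧
      ∀ᶠ q in 𝓝 (A : F →L[ℝ] F →L[ℝ] ℝ), (∀ u v, q u v = q v u) →
        ∀ u, A (R q u) (R q u) = q u u := by
  let sq : (F →L[ℝ] F) → (F →L[ℝ] F) := fun R => R ∘L R
  have hsq : ContDiff ℝ ∞ sq := contDiff_id.clm_comp contDiff_id
  let D : (F →L[ℝ] F) ≃L[ℝ] (F →L[ℝ] F) :=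
    ContinuousLinearEquiv.smulLeft (Units.mk0 (2 : ℝ) two_ne_zero)
  -- Squaring has derivative `2 · id` at the identity, so there is a smooth square root nearby. `R
  -- q` is the root of `A⁻¹ q`.
  have hD : HasFDerivAt sq (D : (F →L[ℝ] F) →L[ℝ] (F →L[ℝ] F)) 1 := by
    have h1 : HasFDerivAt sq _ (1 : F →L[ℝ] F) :=
      (hasFDerivAt_id (1 : F →L[ℝ] F)).clm_comp (hasFDerivAt_id (1 : F →L[ℝ] F))
    refine h1.congr_fderiv ?_
    ext T u
    simp [D, ContinuousLinearMap.one_def, two_smul, Units.smul_def]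
  obtain ⟨e, h1s, -, he, hsm, hsymm⟩ := exists_localDiffeo
    (.of_forall fun R => hsq.contDiffAt) hD univ_mem
  have hsq1 : sq 1 = 1 := by ext; simp [sq]
  let T : (F →L[ℝ] F →L[ℝ] ℝ) → (F →L[ℝ] F) := fun q => (A.symm : (F →L[ℝ] ℝ) →L[ℝ] F) ∘L q
  have hT : ContDiff ℝ ∞ T := contDiff_const.clm_comp contDiff_id
  have hTA : T (A : F →L[ℝ] F →L[ℝ] ℝ) = 1 := by ext u; simp [T]
  -- The adjoint with respect to the form `A`.
  let adj : (F →L[ℝ] F) → (F →L[ℝ] F) := fun R =>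
    (A.symm : (F →L[ℝ] ℝ) →L[ℝ] F) ∘L (((ContinuousLinearMap.compL ℝ F F ℝ).flip R) ∘L
      (A : F →L[ℝ] F →L[ℝ] ℝ))
  have hadj : Continuous adj := by
    refine continuous_const.clm_comp (Continuous.clm_comp ?_ continuous_const)
    exact (ContinuousLinearMap.compL ℝ F F ℝ).flip.continuous
  have hadj_apply : ∀ R u v, A (adj R u) v = A u (R v) := fun R u v => by
    simp [adj]
  have hadj1 : adj 1 = 1 := by
    ext u
    apply A.injective
    ext v
    rw [hadj_apply]; simp
  have ht : (1 : F →L[ℝ] F) ∈ e.target := by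
    have := e.map_source h1s
    rwa [he, hsq1] at this
  have hs1 : e.symm 1 = 1 := by
    have := e.left_inv h1s
    rwa [he, hsq1] at this
  have hTc : Tendsto T (𝓝 (A : F →L[ℝ] F →L[ℝ] ℝ)) (𝓝 1) := by
    have := hT.continuous.tendsto (A : F →L[ℝ] F →L[ℝ] ℝ)
    rwa [hTA] at this
  have hmem : ∀ᶠ q in 𝓝 (A : F →L[ℝ] F →L[ℝ] ℝ), T q ∈ e.target :=
    hTc.eventually (e.open_target.mem_nhds ht)
  have hRc : Tendsto (fun q => e.symm (T q)) (𝓝 (A : F →L[ℝ] F →L[ℝ] ℝ)) (𝓝 1) := by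
    have h1 : Tendsto e.symm (𝓝 1) (𝓝 (e.symm 1)) := (hsymm 1 ht).continuousAt
    rw [hs1] at h1
    exact h1.comp hTc
  have hadjs : ∀ᶠ q in 𝓝 (A : F →L[ℝ] F →L[ℝ] ℝ), adj (e.symm (T q)) ∈ e.source := by
    have h1 : Tendsto adj (𝓝 1) (𝓝 1) := by
      have := hadj.tendsto 1
      rwa [hadj1] at this
    exact (h1.comp hRc).eventually (e.open_source.mem_nhds h1s)
  refine ⟨fun q => e.symm (T q), ?_, ?_, ?_⟩
  · filter_upwards [hmem] with q hq
    exact (hsymm _ hq).comp q hT.contDiffAt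
  · simp only [hTA, hs1]
  · filter_upwards [hmem, hadjs] with q hq hqs hqsymm u
    set R := e.symm (T q) with hR
    have hRs : R ∈ e.source := e.map_target hq
    have hRR : sq R = T q := by rw [← he, hR, e.right_inv hq]
    have hRR' : ∀ u, R (R u) = T q u := fun u => by rw [← hRR]; rfl
    have hAT : ∀ u v, A (T q u) v = q u v := fun u v => by simp [T]
    -- For symmetric `q` the operator `A⁻¹ q` is self-adjoint for `A`, so `adj R` is another square
    -- root near the identity; roots there are unique. Hence `A(Ru, Ru) = A(R²u, u) = q(u, u)`.
    have hadjR : adj R = R := by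
      refine e.injOn hqs hRs ?_
      rw [he, he, hRR]
      ext u
      apply A.injective
      ext v
      change A (adj R (adj R u)) v = _
      rw [hadj_apply, hadj_apply, hRR', hA, hAT, hqsymm, hAT]
    have : A (R u) (R u) = A (adj R (R u)) u := by rw [hadj_apply]
    rw [this, hadjR, hRR',
      hAT]

/-- The Morse lemma with parameters. -/
theorem exists_morse_coordinates {f : P × F → ℝ} (hf : ContDiff ℝ ∞ f) {s : P → F}
    (hs : ContDiff ℝ ∞ s) {p₀ : P}
    (hcrit : ∀ᶠ p in 𝓝 p₀, fderiv ℝ (fun σ => f (p, σ)) (s p) = 0)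
    (hnd : ∀ u, fderiv ℝ (fderiv ℝ fun σ => f (p₀, σ)) (s p₀) u = 0 → u = 0) :
    ∃ (A : F ≃L[ℝ] (F →L[ℝ] ℝ)) (Z : P × F → F), (∀ u v, A u v = A v u) ∧
      (∀ᶠ z in 𝓝 (p₀, s p₀), ContDiffAt ℝ ∞ Z z) ∧ Z (p₀, s p₀) = 0 ∧
      (∀ v, fderiv ℝ Z (p₀, s p₀) (0, v) = v) ∧
      ∀ᶠ z in 𝓝 (p₀, s p₀), f z = f (z.1, s z.1) + A (Z z) (Z z) := by
  obtain ⟨Q, hQ, hQs, hQf⟩ := exists_symmetric_remainder hf hs hcrit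
  have hsnd : ∀ u v, fderiv ℝ (fderiv ℝ fun σ => f (p₀, σ)) (s p₀) u v = 2 * Q (p₀, 0) u v := by
    intro u v
    have h1 := snd_fderiv_of_eq_quadratic (γ := fun σ => f (p₀, s p₀ + σ))
      (Q := fun σ => Q (p₀, σ)) (hf.comp (by fun_prop)) (hQ.comp (by fun_prop))
      (fun z => hQs (p₀, z)) (hQf.self_of_nhds) u v
    rw [← h1]
    have h2 : fderiv ℝ (fun σ => f (p₀, s p₀ + σ)) =
        fun σ => fderiv ℝ (fun σ => f (p₀, σ)) (s p₀ + σ) := by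
      ext1 σ
      exact fderiv_comp_add_left (f := fun σ => f (p₀, σ)) (s p₀)
    rw [h2, fderiv_comp_add_left (f := fderiv ℝ fun σ => f (p₀, σ)) (s p₀), add_zero]
  obtain ⟨A, hA⟩ := exists_continuousLinearEquiv_of_injective (Q (p₀, 0))
    finrank_continuousDual.symm (fun u hu => hnd u (by ext v; rw [hsnd, hu]; simp))
  have hAs : ∀ u v, A u v = A v u := fun u v => by
    have h1 : ∀ u, A u = Q (p₀, 0) u := fun u => by rw [← hA]; rfl
    rw [h1, h1, hQs]
  obtain ⟨R, hR, hR1, hRq⟩ := exists_congruence A hAs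
  rw [hA] at hR hR1 hRq
  let m : P × F → P × F := fun z => (z.1, z.2 - s z.1)
  have hm : ContDiff ℝ ∞ m := contDiff_fst.prodMk (contDiff_snd.sub (hs.comp contDiff_fst))
  have hm0 : m (p₀, s p₀) = (p₀, 0) := by simp [m]
  have hQm : Tendsto (fun z => Q (m z)) (𝓝 (p₀, s p₀)) (𝓝 (Q (p₀, 0))) := by
    have : Tendsto (fun z => Q (m z)) (𝓝 (p₀, s p₀)) (𝓝 (Q (m (p₀, s p₀)))) :=
      (hQ.comp hm).continuous.tendsto (p₀, s p₀)
    rwa [hm0] at this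
  let Rm : P × F → (F →L[ℝ] F) := fun z => R (Q (m z))
  have hRm : ∀ᶠ z in 𝓝 (p₀, s p₀), ContDiffAt ℝ ∞ Rm z := by
    filter_upwards [hQm.eventually hR] with z hz
    exact hz.comp z (hQ.comp hm).contDiffAt
  -- With `τ = σ - s p`, the Morse coordinate is `R(Q(p, τ)) τ`. Here `A` is half the Hessian at the
  -- base point, and `R = 1` there, whence the identity derivative in `σ`.
  refine ⟨A, fun z => Rm z (m z).2, hAs, ?_, ?_, fun v => ?_, ?_⟩
  · filter_upwards [hRm] with z hz
    exact hz.clm_apply (contDiff_snd.comp hm).contDiffAt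
  · simp [hm0]
  · have h1 : HasFDerivAt Rm _ (p₀, s p₀) :=
      (hRm.self_of_nhds.differentiableAt (by simp)).hasFDerivAt
    have h2 : HasFDerivAt (fun z => (m z).2) (ContinuousLinearMap.snd ℝ P F -
        fderiv ℝ s p₀ ∘L ContinuousLinearMap.fst ℝ P F) (p₀, s p₀) := by
      have h3 : HasFDerivAt s (fderiv ℝ s p₀) ((p₀, s p₀) : P × F).1 :=
        (hs.differentiable (by simp)).differentiableAt.hasFDerivAt
      exact hasFDerivAt_snd.sub (h3.comp _ hasFDerivAt_fst)
    rw [(h1.clm_apply h2).fderiv]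
    have h4 : Rm (p₀, s p₀) = 1 := by simp only [Rm, hm0, hR1]
    simp [h4, hm0]
  · have hQf' : ∀ᶠ z in 𝓝 (p₀, s p₀), ∀ σ, f (z.1, s z.1 + σ) =
        f (z.1, s z.1) + Q (z.1, σ) σ σ :=
      (continuous_fst.tendsto ((p₀, s p₀) : P × F)).eventually hQf
    filter_upwards [hQf', hQm.eventually hRq] with z hz1 hz2
    have h1 := hz1 (z.2 - s z.1)
    rw [add_sub_cancel] at h1
    have h2 : f z = f (z.1, z.2) := rfl
    rw [h2, h1]
    congr 1
    exact (hz2 (hQs _) (m z).2).symm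

end Morse

end OscInt

namespace OscInt

open MeasureTheory Filter

/-! ### Elimination of nondegenerate phase variables. -/

section Elim

variable {F : Type} [NormedAddCommGroup F] [NormedSpace ℝ F] [FiniteDimensional ℝ F]

/-- Sylvester's law of inertia for a nondegenerate symmetric continuous bilinear form. -/
theorem exists_diagonalization (A : F ≃L[ℝ] (F →L[ℝ] ℝ)) (hA : ∀ u v, A u v = A v u) :
    ∃ (w : Fin (Module.finrank ℝ F) → ℝ) (L : F ≃L[ℝ] (Fin (Module.finrank ℝ F) → ℝ)),
      (∀ i, w i ≠ 0) ∧ ∀ u, A u u = ∑ i, w i * L u i ^ 2 := by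
  let b : LinearMap.BilinForm ℝ F :=
    LinearMap.mk₂ ℝ (fun u v => A u v) (by simp) (by simp) (by simp) (by simp)
  have hb : QuadraticMap.associated (R := ℝ) (LinearMap.BilinMap.toQuadraticMap b) = b :=
    QuadraticMap.associated_left_inverse ℝ hA
  obtain ⟨w, hw, ⟨L⟩⟩ := QuadraticForm.equivalent_one_neg_one_weighted_sum_squared
    (LinearMap.BilinMap.toQuadraticMap b) (by
      rw [hb]
      intro u hu
      exact A.map_eq_zero_iff.1 (by ext v; exact hu v))
  refine ⟨w, L.toLinearEquiv.toContinuousLinearEquiv, fun i => ?_, fun u => ?_⟩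
  · rcases hw i with h | h <;> rw [h] <;> norm_num
  · have := L.map_app u
    rw [QuadraticMap.weightedSumSquares_apply] at this
    have h1 : LinearMap.BilinMap.toQuadraticMap b u = A u u := rfl
    rw [h1] at this
    rw [← this]
    refine Finset.sum_congr rfl fun i _ => ?_
    rw [smul_eq_mul, sq]
    rfl

variable {B : Type} [NormedAddCommGroup B] [NormedSpace ℝ B] [FiniteDimensional ℝ B]
variable {E : Type} [NormedAddCommGroup E] [NormedSpace ℝ E] [FiniteDimensional ℝ E]
  [MeasureSpace E] [BorelSpace E] [(volume : Measure E).IsAddHaarMeasure]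
variable [MeasureSpace F] [BorelSpace F] [(volume : Measure F).IsAddHaarMeasure]
variable {Pos : Set B} {N : B → ℝ} {Ψ : B × E → ℝ} {z₀ : B × E}

/-- Elimination of phase variables with respect to which the critical points are nondegenerate,
at scale `h`. -/
theorem OscEquiv.eliminate {h : B → ℝ} (hh : ContDiff ℝ ∞ h) (h0 : h z₀.1 = 0)
    (hpos : ∀ β ∈ Pos, 0 < h β) (hΨ : ∀ β ∈ Pos, Measurable fun e => Ψ (β, e))
    {f : (B × E) × F → ℝ} (hf : ContDiff ℝ ∞ f) {s : B × E → F} (hs : ContDiff ℝ ∞ s)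
    (hcrit : ∀ᶠ p in 𝓝 z₀, fderiv ℝ (fun σ => f (p, σ)) (s p) = 0)
    (hnd : ∀ u, fderiv ℝ (fderiv ℝ fun σ => f (z₀, σ)) (s z₀) u = 0 → u = 0) :
    OscEquiv Pos (fun β => N β * h β ^ (-(Module.finrank ℝ F / 2 : ℝ)))
      (fun z : B × (E × F) => Ψ (z.1, z.2.1) + f ((z.1, z.2.1), z.2.2) / h z.1)
      (z₀.1, (z₀.2, s z₀)) N (fun z => Ψ z + f (z, s z) / h z.1) z₀ := by
  obtain ⟨A, Z, hAs, hZ, hZ0, hZd, hZf⟩ := exists_morse_coordinates hf hs hcrit hnd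
  obtain ⟨w, L, hw, hL⟩ := exists_diagonalization A hAs
  let ass : B × (E × F) → (B × E) × F := fun z => ((z.1, z.2.1), z.2.2)
  have hass : ContDiff ℝ ∞ ass := by fun_prop
  let y₀ : B × (E × F) := (z₀.1, (z₀.2, s z₀))
  have hass0 : ass y₀ = (z₀, s z₀) := rfl
  have htend : Tendsto ass (𝓝 y₀) (𝓝 (z₀, s z₀)) := hass.continuous.tendsto y₀
  -- Passing to Morse coordinates in the last variable makes the phase the critical value plus a
  -- constant quadratic form; diagonalizing the form reduces to `OscEquiv.addSquares`.
  let Ξ : B × (E × F) → B × (E × F) := fun z => (z.1, (z.2.1, Z (ass z)))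
  have hΞ0 : Ξ y₀ = (z₀.1, (z₀.2, 0)) := by
    simp only [Ξ, hass0, hZ0]; rfl
  have hΞs : ∀ᶠ z in 𝓝 y₀, ContDiffAt ℝ ∞ Ξ z := by
    filter_upwards [htend.eventually hZ] with z hz
    exact contDiffAt_fst.prodMk ((by fun_prop : ContDiff ℝ ∞ fun z : B × (E × F) =>
      z.2.1).contDiffAt.prodMk (hz.comp z hass.contDiffAt))
  have hΞd := (hΞs.self_of_nhds.differentiableAt (by simp)).hasFDerivAt
  have hinj : ∀ v, fderiv ℝ Ξ y₀ v = 0 → v = 0 := by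
    intro v hv
    have hZd' : HasFDerivAt Z (fderiv ℝ Z (z₀, s z₀)) (ass y₀) :=
      (hZ.self_of_nhds.differentiableAt (by simp)).hasFDerivAt
    let assL : B × (E × F) →L[ℝ] (B × E) × F :=
      (ContinuousLinearEquiv.prodAssoc ℝ B E F).symm
    have hassd : HasFDerivAt ass assL y₀ := assL.hasFDerivAt
    have hd : HasFDerivAt Ξ ((ContinuousLinearMap.fst ℝ B (E × F)).prod
        ((ContinuousLinearMap.fst ℝ E F ∘L ContinuousLinearMap.snd ℝ B (E × F)).prod
          (fderiv ℝ Z (z₀, s z₀) ∘L assL))) y₀ :=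
      hasFDerivAt_fst.prodMk ((hasFDerivAt_fst.comp y₀ hasFDerivAt_snd).prodMk
        (hZd'.comp y₀ hassd))
    rw [hd.fderiv] at hv
    obtain ⟨v₁, v₂, v₃⟩ := v
    have e1 : v₁ = 0 := congrArg Prod.fst hv
    have e2 : v₂ = 0 := congrArg (fun z => z.2.1) hv
    have e3 : fderiv ℝ Z (z₀, s z₀) ((v₁, v₂), v₃) = 0 := congrArg (fun z => z.2.2) hv
    have e4 : (((v₁, v₂), v₃) : (B × E) × F) = (0, v₃) := by rw [e1, e2]; rfl
    rw [e4, hZd] at e3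
    rw [e1, e2, e3]; rfl
  obtain ⟨L', hL'⟩ := exists_continuousLinearEquiv_of_injective (fderiv ℝ Ξ y₀) rfl hinj
  rw [← hL'] at hΞd
  let M : B → ℝ := fun β => N β * h β ^ (-(Module.finrank ℝ F / 2 : ℝ))
  have step1 := OscEquiv.of_fibreDiffeo (Pos := Pos) (N := M) (z₀ := y₀)
    (θ := fun z : B × (E × F) => Ψ (z.1, z.2.1) +
      (f ((z.1, z.2.1), s (z.1, z.2.1)) + A z.2.2 z.2.2) / h z.1)
    (θ₁ := fun z : B × (E × F) => Ψ (z.1, z.2.1) + f ((z.1, z.2.1), z.2.2) / h z.1)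
    hΞs (.of_forall fun z => rfl) hΞd (by
      filter_upwards [htend.eventually hZf] with z hz _
      simp only [Ξ]
      rw [← hz])
  rw [hΞ0] at step1
  let Λ : (E × F) ≃L[ℝ] (E × (Fin (Module.finrank ℝ F) → ℝ)) :=
    (ContinuousLinearEquiv.refl ℝ E).prodCongr L
  have step2 := OscEquiv.of_linearEquiv (Pos := Pos) (N := M) (z₀ := (z₀.1, (z₀.2, (0 : F))))
    (θ := fun z : B × (E × F) => Ψ (z.1, z.2.1) +
      (f ((z.1, z.2.1), s (z.1, z.2.1)) + A z.2.2 z.2.2) / h z.1)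
    (θ' := fun z : B × (E × (Fin (Module.finrank ℝ F) → ℝ)) =>
      (Ψ (z.1, z.2.1) + f ((z.1, z.2.1), s (z.1, z.2.1)) / h z.1) +
        (∑ i, w i * z.2.2 i ^ 2) / h z.1) Λ (.of_forall fun z _ => by
      have e1 : (Λ z.2).1 = z.2.1 := rfl
      have e2 : (Λ z.2).2 = L z.2.2 := rfl
      simp only [e1, e2, hL]
      ring)
  have e3 : Λ (z₀.2, (0 : F)) = (z₀.2, 0) := by
    have : Λ (z₀.2, (0 : F)) = (z₀.2, L 0) := rfl
    rw [this, map_zero]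
  simp only [e3] at step2
  have step3 := OscEquiv.addSquares (Pos := Pos) (N := N) (z₀ := z₀)
    (θ := fun z => Ψ z + f (z, s z) / h z.1) hh h0 hpos (fun β hβ => by
      refine (hΨ β hβ).add ?_
      have h1 := hf.continuous
      have h2 := hs.continuous
      have h3 : Continuous fun e => f ((β, e), s (β, e)) := by fun_prop
      exact h3.measurable.div_const (h β)) _ w hw
  exact step1.symm.trans (step2.trans step3)

end Elim

end OscInt

namespace OscInt

open MeasureTheory Filter

/-! ### Critical points depending on parameters. -/

section Calculus

variable {P F : Type} [NormedAddCommGroup P] [NormedSpace ℝ P] [FiniteDimensional ℝ P]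
  [NormedAddCommGroup F] [NormedSpace ℝ F] [FiniteDimensional ℝ F]

/-- A function that is smooth on a neighbourhood of a point agrees near this point with a function
that is smooth everywhere. -/
theorem exists_contDiff_eventuallyEq {V : Type} [NormedAddCommGroup V] [NormedSpace ℝ V]
    {f : P → V} {p₀ : P} (hf : ∀ᶠ p in 𝓝 p₀, ContDiffAt ℝ ∞ f p) :
    ∃ g : P → V, ContDiff ℝ ∞ g ∧ g =ᶠ[𝓝 p₀] f := by
  obtain ⟨W, hW, hWo, hpW⟩ := mem_nhds_iff.1 hf
  obtain ⟨r, hr, hrW⟩ := Metric.isOpen_iff.1 hWo p₀ hpW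
  let ρ : ContDiffBump p₀ := ⟨r / 4, r / 2, by positivity, by linarith⟩
  refine ⟨fun p => ρ p • f p, ?_, ?_⟩
  · rw [contDiff_iff_contDiffAt]
    intro p
    by_cases hp : p ∈ tsupport ρ
    · rw [ρ.tsupport_eq] at hp
      have : p ∈ W := hrW (Metric.closedBall_subset_ball (by simp [ρ]; linarith) hp)
      exact ρ.contDiff.contDiffAt.smul (hW this)
    · have : (fun p => ρ p • f p) =ᶠ[𝓝 p] fun _ => 0 := by
        filter_upwards [(isClosed_tsupport ρ).isOpen_compl.mem_nhds hp] with y hy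
        rw [image_eq_zero_of_notMem_tsupport hy, zero_smul]
      exact contDiffAt_const.congr_of_eventuallyEq this
  · filter_upwards [ρ.eventuallyEq_one] with p hp
    rw [hp]; simp

/-- Nondegenerate critical points depend smoothly on parameters. -/
theorem exists_smooth_crit {f : P × F → ℝ} (hf : ContDiff ℝ ∞ f) {p₀ : P} {s₀ : F}
    (hcrit : fderiv ℝ (fun σ => f (p₀, σ)) s₀ = 0)
    (hnd : ∀ u, fderiv ℝ (fderiv ℝ fun σ => f (p₀, σ)) s₀ u = 0 → u = 0) :
    ∃ s : P → F, ContDiff ℝ ∞ s ∧ s p₀ = s₀ ∧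
      ∀ᶠ p in 𝓝 p₀, fderiv ℝ (fun σ => f (p, σ)) (s p) = 0 := by
  let D : P × F → (F →L[ℝ] ℝ) := fun z => fderiv ℝ f z ∘L ContinuousLinearMap.inr ℝ P F
  have hD : ContDiff ℝ ∞ D := (hf.fderiv_right (m := ∞) (by simp)).clm_comp contDiff_const
  have hd : ∀ p σ, fderiv ℝ (fun σ => f (p, σ)) σ = D (p, σ) := fun p σ => by
    have h1 : HasFDerivAt f (fderiv ℝ f (p, σ)) (p, σ) :=
      (hf.differentiable (by simp)).differentiableAt.hasFDerivAt
    exact (h1.comp σ (hasFDerivAt_prodMk_right p σ)).fderiv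
  have hDd : HasFDerivAt D (fderiv ℝ D (p₀, s₀)) (p₀, s₀) :=
    (hD.differentiable (by simp)).differentiableAt.hasFDerivAt
  have hDs : ∀ u, fderiv ℝ (fderiv ℝ fun σ => f (p₀, σ)) s₀ u = fderiv ℝ D (p₀, s₀) (0, u) := by
    intro u
    have h1 : (fderiv ℝ fun σ => f (p₀, σ)) = fun σ => D (p₀, σ) := funext fun σ => hd p₀ σ
    rw [h1]
    have h2 : HasFDerivAt (fun σ => D (p₀, σ)) _ s₀ :=
      hDd.comp s₀ (hasFDerivAt_prodMk_right p₀ s₀)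
    rw [h2.fderiv]
    rfl
  -- The inverse function theorem for `(p, σ) ↦ (p, d_σ f)`; critical points are the preimages of
  -- `(p, 0)`.
  let g : P × F → P × (F →L[ℝ] ℝ) := fun z => (z.1, D z)
  have hg : ContDiff ℝ ∞ g := contDiff_fst.prodMk hD
  have hgd : HasFDerivAt g ((ContinuousLinearMap.fst ℝ P F).prod (fderiv ℝ D (p₀, s₀)))
    (p₀, s₀) := hasFDerivAt_fst.prodMk hDd
  obtain ⟨L, hL⟩ := exists_continuousLinearEquiv_of_injective
    ((ContinuousLinearMap.fst ℝ P F).prod (fderiv ℝ D (p₀, s₀)))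
    (by rw [Module.finrank_prod, Module.finrank_prod, finrank_continuousDual]) (by
      rintro ⟨v₁, v₂⟩ hv
      have e1 : v₁ = 0 := congrArg Prod.fst hv
      have e2 : fderiv ℝ D (p₀, s₀) (v₁, v₂) = 0 := congrArg Prod.snd hv
      rw [e1, ← hDs] at e2
      rw [e1, hnd _ e2]; rfl)
  rw [← hL] at hgd
  obtain ⟨e, he0, -, he, -, hsymm⟩ := exists_localDiffeo
    (.of_forall fun z => hg.contDiffAt) hgd univ_mem
  have hg0 : g (p₀, s₀) = (p₀, 0) := by
    simp only [g]; rw [← hd, hcrit]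
  have ht : ((p₀, 0) : P × (F →L[ℝ] ℝ)) ∈ e.target := by
    rw [← hg0, ← he]; exact e.map_source he0
  have hs0 : e.symm (p₀, 0) = (p₀, s₀) := by rw [← hg0, ← he, e.left_inv he0]
  have hev : ∀ᶠ p in 𝓝 p₀, ((p, 0) : P × (F →L[ℝ] ℝ)) ∈ e.target :=
    ContinuousAt.eventually_mem (f := fun p : P => ((p, 0) : P × (F →L[ℝ] ℝ))) (by fun_prop)
      (e.open_target.mem_nhds ht)
  obtain ⟨s, hs, hse⟩ := exists_contDiff_eventuallyEq (f := fun p : P => (e.symm (p, 0)).2)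
    (p₀ := p₀) (by
      filter_upwards [hev] with p hp
      exact contDiffAt_snd.comp p (ContDiffAt.comp (g := e.symm)
        (f := fun p : P => ((p, 0) : P × (F →L[ℝ] ℝ))) p (hsymm _ hp) (by fun_prop)))
  refine ⟨s, hs, by rw [hse.self_of_nhds]; simp only [hs0], ?_⟩
  filter_upwards [hev, hse] with p hp hsp
  have hr := e.right_inv hp
  rw [he] at hr
  have h1 : (e.symm (p, 0)).1 = p := congrArg Prod.fst hr
  have h2 : D (e.symm (p, 0)) = 0 := congrArg Prod.snd hr
  rw [hd, hsp]
  have h3 : (p, (e.symm (p, 0)).2) = e.symm (p, 0) := Prod.ext h1.symm rfl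
  rw [h3, h2]

/-- The value at a critical point has the partial differential of the function. -/
theorem hasFDerivAt_critValue {f : P × F → ℝ} (hf : ContDiff ℝ ∞ f) {s : P → F}
    (hs : ContDiff ℝ ∞ s) {p : P} (hcrit : fderiv ℝ (fun σ => f (p, σ)) (s p) = 0) :
    HasFDerivAt (fun p => f (p, s p))
      (fderiv ℝ f (p, s p) ∘L ContinuousLinearMap.inl ℝ P F) p := by
  have h1 : HasFDerivAt f (fderiv ℝ f (p, s p)) (p, s p) :=
    (hf.differentiable (by simp)).differentiableAt.hasFDerivAt
  have hsd : HasFDerivAt s (fderiv ℝ s p) p :=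
    (hs.differentiable (by simp)).differentiableAt.hasFDerivAt
  have h2 := HasFDerivAt.comp (g := f) (f := fun p => (p, s p)) p h1 ((hasFDerivAt_id p).prodMk hsd)
  refine h2.congr_fderiv ?_
  ext u
  -- The envelope principle: motion of the critical point does not contribute to first order.
  have h3 : fderiv ℝ f (p, s p) (0, fderiv ℝ s p u) = 0 := by
    have := (h1.comp (s p) (hasFDerivAt_prodMk_right p (s p))).fderiv
    have h4 := DFunLike.congr_fun (this.symm.trans hcrit) (fderiv ℝ s p u)
    exact h4
  have h5 : ((u, fderiv ℝ s p u) : P × F) = (u, 0) + (0, fderiv ℝ s p u) := by simp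
  change fderiv ℝ f (p, s p) (u, fderiv ℝ s p u) = fderiv ℝ f (p, s p) (u, 0)
  rw [h5, map_add, h3, add_zero]

end Calculus

section Dot

/-- The Euclidean inner product of coordinate vectors. -/
def dot {n : ℕ} (a b : Fin n → ℝ) : ℝ := ∑ j, a j * b j

variable {n : ℕ}

theorem dot_comm (a b : Fin n → ℝ) : dot a b = dot b a := by
  simp [dot, mul_comm]

theorem add_dot (a b c : Fin n → ℝ) : dot (a + b) c = dot a c + dot b c := by
  simp [dot, add_mul, Finset.sum_add_distrib]

theorem sub_dot (a b c : Fin n → ℝ) : dot (a - b) c = dot a c - dot b c := by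
  simp [dot, sub_mul, Finset.sum_sub_distrib]

theorem smul_dot (t : ℝ) (a b : Fin n → ℝ) : dot (t • a) b = t * dot a b := by
  simp [dot, mul_assoc, Finset.mul_sum]

theorem zero_dot (a : Fin n → ℝ) : dot 0 a = 0 := by simp [dot]

theorem dot_single (a : Fin n → ℝ) (j : Fin n) : dot a (Pi.single j 1) = a j := by
  simp [dot, Pi.single_apply]

theorem dot_self_eq_zero {a : Fin n → ℝ} : dot a a = 0 ↔ a = 0 := by
  rw [dot, Finset.sum_eq_zero_iff_of_nonneg (fun i _ => mul_self_nonneg _)]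
  simp [funext_iff]

theorem eq_zero_of_dot {a : Fin n → ℝ} (h : ∀ b, dot a b = 0) : a = 0 :=
  dot_self_eq_zero.1 (h a)

@[fun_prop]
theorem contDiff_dot {X : Type} [NormedAddCommGroup X] [NormedSpace ℝ X] {a b : X → Fin n → ℝ}
    (ha : ContDiff ℝ ∞ a) (hb : ContDiff ℝ ∞ b) : ContDiff ℝ ∞ fun x => dot (a x) (b x) := by
  unfold dot
  fun_prop

theorem hasFDerivAt_dot {X : Type} [NormedAddCommGroup X] [NormedSpace ℝ X] {a b : X → Fin n → ℝ}
    {a' b' : X →L[ℝ] Fin n → ℝ} {x : X} (ha : HasFDerivAt a a' x) (hb : HasFDerivAt b b' x) :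
    ∃ T : X →L[ℝ] ℝ, HasFDerivAt (fun x => dot (a x) (b x)) T x ∧
      ∀ u, T u = dot (a x) (b' u) + dot (a' u) (b x) := by
  have ha' := hasFDerivAt_pi'.1 ha
  have hb' := hasFDerivAt_pi'.1 hb
  refine ⟨_, HasFDerivAt.fun_sum fun j _ => (ha' j).mul (hb' j), fun u => ?_⟩
  simp [dot, ← Finset.sum_add_distrib, mul_comm]

/-- The gradient of a functional on `ℝⁿ`. -/
def gradient (ℓ : (Fin n → ℝ) →L[ℝ] ℝ) : Fin n → ℝ := fun j => ℓ (Pi.single j 1)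

theorem dot_gradient (ℓ : (Fin n → ℝ) →L[ℝ] ℝ) (u : Fin n → ℝ) : dot u (gradient ℓ) = ℓ u := by
  have h : u = ∑ j, u j • (Pi.single j 1 : Fin n → ℝ) := by
    ext i; simp [Finset.sum_apply, Pi.single_apply]
  conv_rhs => rw [h]
  simp [dot, gradient]

theorem contDiff_gradient {X : Type} [NormedAddCommGroup X] [NormedSpace ℝ X]
    {ℓ : X → ((Fin n → ℝ) →L[ℝ] ℝ)} (h : ContDiff ℝ ∞ ℓ) :
    ContDiff ℝ ∞ fun x => gradient (ℓ x) :=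
  contDiff_pi.2 fun _ => h.clm_apply contDiff_const

end Dot

/-! ### Fourier inversion as stationary phase. -/

section Fourier

variable {n : ℕ}
variable {B : Type} [NormedAddCommGroup B] [NormedSpace ℝ B] [FiniteDimensional ℝ B]
variable {E : Type} [NormedAddCommGroup E] [NormedSpace ℝ E] [FiniteDimensional ℝ E]
  [MeasureSpace E] [BorelSpace E] [(volume : Measure E).IsAddHaarMeasure]
variable {Pos : Set B} {N : B → ℝ} {Ψ : B × E → ℝ} {z₀ : B × E}

theorem fderiv_fourierPhase {g : (Fin n → ℝ) → ℝ} (hg : ContDiff ℝ ∞ g) (y : Fin n → ℝ)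
    (σ τ : (Fin n → ℝ) × (Fin n → ℝ)) :
    fderiv ℝ (fun σ : (Fin n → ℝ) × (Fin n → ℝ) => dot (y - σ.1) σ.2 + g σ.1) σ τ =
      dot (y - σ.1) τ.2 - dot τ.1 σ.2 + fderiv ℝ g σ.1 τ.1 := by
  obtain ⟨T, hT, hT'⟩ := hasFDerivAt_dot (a := fun σ : (Fin n → ℝ) × (Fin n → ℝ) => y - σ.1)
    (b := fun σ => σ.2) (x := σ) ((hasFDerivAt_fst (p := σ)).const_sub y) hasFDerivAt_snd
  have h1 : HasFDerivAt g (fderiv ℝ g σ.1) σ.1 :=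
    (hg.differentiable (by simp)).differentiableAt.hasFDerivAt
  have h2 := hT.add (h1.comp σ hasFDerivAt_fst)
  have h3 : fderiv ℝ (fun σ : (Fin n → ℝ) × (Fin n → ℝ) => dot (y - σ.1) σ.2 + g σ.1) σ = _ :=
    h2.fderiv
  rw [h3, add_apply, hT']
  simp [sub_eq_add_neg, dot]

/-- Fourier inversion as an elimination of phase variables. -/
theorem OscEquiv.fourier {h : B → ℝ} (hh : ContDiff ℝ ∞ h) (h0 : h z₀.1 = 0)
    (hpos : ∀ β ∈ Pos, 0 < h β) (hΨ : ∀ β ∈ Pos, Measurable fun e => Ψ (β, e))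
    {y : B × E → Fin n → ℝ} (hy : ContDiff ℝ ∞ y)
    {g : (B × E) × (Fin n → ℝ) → ℝ} (hg : ContDiff ℝ ∞ g) :
    OscEquiv Pos (fun β => N β * h β ^ (-(n : ℝ)))
      (fun z : B × (E × ((Fin n → ℝ) × (Fin n → ℝ))) => Ψ (z.1, z.2.1) +
        (dot (y (z.1, z.2.1) - z.2.2.1) z.2.2.2 + g ((z.1, z.2.1), z.2.2.1)) / h z.1)
      (z₀.1, (z₀.2, (y z₀, gradient (fderiv ℝ (fun ζ => g (z₀, ζ)) (y z₀)))))
      N (fun z => Ψ z + g (z, y z) / h z.1) z₀ := by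
  let f : (B × E) × ((Fin n → ℝ) × (Fin n → ℝ)) → ℝ := fun z =>
    dot (y z.1 - z.2.1) z.2.2 + g (z.1, z.2.1)
  have hf : ContDiff ℝ ∞ f :=
    (contDiff_dot (by fun_prop) (by fun_prop)).add (hg.comp (by fun_prop))
  have hgs : ∀ p, ContDiff ℝ ∞ fun ζ => g (p, ζ) := fun p => hg.comp (by fun_prop)
  have hfd : ∀ p σ τ, fderiv ℝ (fun σ => f (p, σ)) σ τ =
      dot (y p - σ.1) τ.2 - dot τ.1 σ.2 + fderiv ℝ (fun ζ => g (p, ζ)) σ.1 τ.1 :=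
    fun p σ τ => fderiv_fourierPhase (hgs p) (y p) σ τ
  let s : B × E → (Fin n → ℝ) × (Fin n → ℝ) := fun p =>
    (y p, gradient (fderiv ℝ (fun ζ => g (p, ζ)) (y p)))
  have hs : ContDiff ℝ ∞ s := by
    refine hy.prodMk (contDiff_gradient ?_)
    have h1 : (fun p => fderiv ℝ (fun ζ => g (p, ζ)) (y p)) = fun p =>
        fderiv ℝ g (p, y p) ∘L ContinuousLinearMap.inr ℝ (B × E) (Fin n → ℝ) := by
      funext p
      have h1 : HasFDerivAt g (fderiv ℝ g (p, y p)) (p, y p) :=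
        (hg.differentiable (by simp)).differentiableAt.hasFDerivAt
      exact (h1.comp (y p) (hasFDerivAt_prodMk_right p (y p))).fderiv
    rw [h1]
    exact ((hg.fderiv_right (m := ∞) (by simp)).comp (contDiff_id.prodMk hy)).clm_comp
      contDiff_const
  -- In the variables `(ζ, μ)` the phase `(y - ζ)·μ + g(ζ)` is critical exactly where `ζ = y` and `μ
  -- = ∇g(y)`; its value there is `g(y)`.
  have hcrit : ∀ p, fderiv ℝ (fun σ => f (p, σ)) (s p) = 0 := by
    intro p
    refine ContinuousLinearMap.ext fun τ => ?_
    rw [hfd]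
    simp [s, dot_gradient, zero_dot]
  have key := OscEquiv.eliminate (Pos := Pos) (N := N) (Ψ := Ψ) (z₀ := z₀) hh h0 hpos hΨ hf hs
    (.of_forall hcrit) (by
      intro u hu
      have hfs : ContDiff ℝ ∞ fun σ => f (z₀, σ) := hf.comp (by fun_prop)
      have hsnd : ∀ τ, fderiv ℝ (fderiv ℝ fun σ => f (z₀, σ)) (s z₀) u τ =
          fderiv ℝ (fun σ => fderiv ℝ (fun σ => f (z₀, σ)) σ τ) (s z₀) u := by
        intro τ
        have h1 : HasFDerivAt (fderiv ℝ fun σ => f (z₀, σ))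
            (fderiv ℝ (fderiv ℝ fun σ => f (z₀, σ)) (s z₀)) (s z₀) :=
          ((hfs.fderiv_right (m := ∞) (by simp)).differentiable
            (by simp)).differentiableAt.hasFDerivAt
        have h2 := h1.clm_apply (hasFDerivAt_const τ (s z₀))
        rw [h2.fderiv]
        simp
      -- The Hessian has off-diagonal blocks `-1` and zero `μμ`-block, so it is nondegenerate
      -- whatever `g` is: variations of `μ` give `u.1 = 0`, then those of `ζ` give `u.2 = 0`.
      have hu1 : u.1 = 0 := by
        refine eq_zero_of_dot fun b => ?_
        have h1 := hsnd (0, b)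
        rw [hu] at h1
        have h2 : (fun σ => fderiv ℝ (fun σ => f (z₀, σ)) σ (0, b)) =
            fun σ => dot (y z₀ - σ.1) b := by
          funext σ; rw [hfd]; simp [zero_dot]
        rw [h2] at h1
        obtain ⟨T, hT, hT'⟩ := hasFDerivAt_dot
          (a := fun σ : (Fin n → ℝ) × (Fin n → ℝ) => y z₀ - σ.1)
          (b := fun _ => b) (x := s z₀) ((hasFDerivAt_fst (p := s z₀)).const_sub (y z₀))
          (hasFDerivAt_const b _)
        rw [hT.fderiv, hT'] at h1
        simpa [dot] using h1
      have hu2 : u.2 = 0 := by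
        refine eq_zero_of_dot fun b => ?_
        have h1 := hsnd (b, 0)
        rw [hu] at h1
        have h2 : (fun σ => fderiv ℝ (fun σ => f (z₀, σ)) σ (b, 0)) =
            fun σ => - dot b σ.2 + fderiv ℝ (fun ζ => g (z₀, ζ)) σ.1 b := by
          funext σ; rw [hfd]; simp [dot]
        rw [h2] at h1
        obtain ⟨T, hT, hT'⟩ := hasFDerivAt_dot
          (a := fun _ : (Fin n → ℝ) × (Fin n → ℝ) => b)
          (b := fun σ => σ.2) (x := s z₀) (hasFDerivAt_const b _) hasFDerivAt_snd
        have h3 : HasFDerivAt (fun ζ => fderiv ℝ (fun ζ => g (z₀, ζ)) ζ b)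
            (fderiv ℝ (fun ζ => fderiv ℝ (fun ζ => g (z₀, ζ)) ζ b) (s z₀).1) (s z₀).1 :=
          ((((hgs z₀).fderiv_right (m := ∞) (by simp)).clm_apply contDiff_const).differentiable
            (by simp)).differentiableAt.hasFDerivAt
        have h4 := hT.neg.add (h3.comp (s z₀) hasFDerivAt_fst)
        have h5 : fderiv ℝ (fun σ : (Fin n → ℝ) × (Fin n → ℝ) => - dot b σ.2 +
          fderiv ℝ (fun ζ => g (z₀, ζ)) σ.1 b) (s z₀) = _ := h4.fderiv
        rw [h5, add_apply, neg_apply, hT'] at h1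
        simp [hu1, zero_dot] at h1
        rw [dot_comm, h1]
      exact Prod.ext hu1 hu2)
  have hv : ∀ z, f (z, s z) = g (z, y z) := fun z => by simp [f, s, zero_dot]
  simp only [hv] at key
  refine key.congr_left (fun β _ => ?_) (.of_forall fun z _ => rfl)
  congr 2
  simp

end Fourier

end OscInt

namespace OscInt

open MeasureTheory Filter

/-! ### Hessians shifted by a multiple of a partial square. -/

section Pencil

variable {n k : ℕ}

/-- If the `Vec k` directions are not in the kernel of a symmetric form `b`, then the pencil
`t |u.1|² + b(u, u)` is degenerate only for finitely many `t`. -/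
theorem finite_degenerate_pencil
    (b : ((Fin n → ℝ) × (Fin k → ℝ)) →L[ℝ] ((Fin n → ℝ) × (Fin k → ℝ)) →L[ℝ] ℝ)
    (hsymm : ∀ u v, b u v = b v u) (hb : ∀ w, (∀ v, b v (0, w) = 0) → w = 0) :
    {t : ℝ | ∃ u, u ≠ 0 ∧ ∀ v, t * dot u.1 v.1 + b u v = 0}.Finite := by
  set T := {t : ℝ | ∃ u, u ≠ 0 ∧ ∀ v, t * dot u.1 v.1 + b u v = 0}
  choose u hu0 hu using fun t : T => t.2
  -- A kernel vector with vanishing first component would lie in the kernel of `b` itself, contrary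
  -- to `hb`.
  have h1 : ∀ t, dot (u t).1 (u t).1 ≠ 0 := by
    intro t h
    rw [dot_self_eq_zero] at h
    refine hu0 t (Prod.ext h (hb _ fun v => ?_))
    have h2 := hu t v
    rw [h, zero_dot, mul_zero, zero_add, hsymm] at h2
    rwa [← h]
  -- As for eigenvectors of distinct eigenvalues: subtracting the two kernel relations gives
  -- orthogonality. Nonzero orthogonal vectors in `ℝⁿ` are independent, hence finite in number.
  have h2 : ∀ t t', t ≠ t' → dot (u t).1 (u t').1 = 0 := by
    intro t t' htt
    have e1 := hu t (u t')
    have e2 := hu t' (u t)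
    rw [hsymm, dot_comm] at e2
    have e3 : ((t : ℝ) - t') * dot (u t).1 (u t').1 = 0 := by linarith
    exact (mul_eq_zero.1 e3).resolve_left (sub_ne_zero.2 fun h => htt (Subtype.ext h))
  have hli : LinearIndependent ℝ fun t => (u t).1 := by
    rw [linearIndependent_iff']
    intro s c hc t ht
    have hd : ∀ (s : Finset T), dot (∑ i ∈ s, c i • (u i).1) (u t).1 =
        ∑ i ∈ s, c i * dot (u i).1 (u t).1 := by
      intro s
      classical
      induction s using Finset.induction_on with
      | empty => simp [zero_dot]
      | insert a s ha ih => rw [Finset.sum_insert ha, Finset.sum_insert ha, add_dot, smul_dot, ih]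
    have h3 := hd s
    rw [hc, zero_dot, Finset.sum_eq_single t (fun i _ hi => by rw [h2 i t hi, mul_zero])
      (fun h => absurd ht h)] at h3
    exact (mul_eq_zero.1 h3.symm).resolve_right (h1 t)
  exact Set.finite_coe_iff.1 hli.finite

/-- Independence of the differentials of the `∂g/∂w_j` means that no nonzero `(0, w)` lies in the
kernel of the Hessian, which is the hypothesis on the pencil. -/
theorem finite_degenerate_hessian {g : (Fin n → ℝ) × (Fin k → ℝ) → ℝ} (hg : ContDiff ℝ ∞ g)
    {z₀ : (Fin n → ℝ) × (Fin k → ℝ)}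
    (hli : LinearIndependent ℝ fun j : Fin k =>
      fderiv ℝ (fun z => fderiv ℝ g z (0, Pi.single j 1)) z₀) :
    {t : ℝ | ∃ u, u ≠ 0 ∧ ∀ v, t * dot u.1 v.1 + fderiv ℝ (fderiv ℝ g) z₀ u v = 0}.Finite := by
  have hd : HasFDerivAt (fderiv ℝ g) (fderiv ℝ (fderiv ℝ g) z₀) z₀ :=
    ((hg.fderiv_right (m := ∞) (by simp)).differentiable (by simp)).differentiableAt.hasFDerivAt
  refine finite_degenerate_pencil _ (fun u v => ?_) fun w hw => ?_
  · exact (hg.contDiffAt (x := z₀)).isSymmSndFDerivAt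
      (by rw [minSmoothness_of_isRCLikeNormedField]; exact WithTop.coe_le_coe.2 le_top) u v
  · have h1 : ∀ j, fderiv ℝ (fun z => fderiv ℝ g z (0, Pi.single j 1)) z₀ =
        (ContinuousLinearMap.apply ℝ ℝ (0, Pi.single j 1)) ∘L fderiv ℝ (fderiv ℝ g) z₀ :=
      fun j => HasFDerivAt.fderiv (HasFDerivAt.comp (g := ContinuousLinearMap.apply ℝ ℝ
        ((0, Pi.single j 1) : (Fin n → ℝ) × (Fin k → ℝ))) z₀
        (ContinuousLinearMap.hasFDerivAt _) hd)
    have h2 := Fintype.linearIndependent_iff.1 hli w (by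
      refine ContinuousLinearMap.ext fun v => ?_
      have h3 : ((0, w) : (Fin n → ℝ) × (Fin k → ℝ)) =
          ∑ j, w j • ((0, Pi.single j 1) : (Fin n → ℝ) × (Fin k → ℝ)) := by
        ext i
        · simp [Prod.fst_sum]
        · simp [Prod.snd_sum, Finset.sum_apply, Pi.single_apply]
      have h4 := hw v
      rw [h3, map_sum] at h4
      simp only [map_smul, smul_eq_mul] at h4
      simpa [h1] using h4)
    exact funext h2

theorem fderiv_shiftedPhase {g : (Fin n → ℝ) × (Fin k → ℝ) → ℝ} (hg : ContDiff ℝ ∞ g)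
    (t : ℝ) (μ : Fin n → ℝ) (σ u : (Fin n → ℝ) × (Fin k → ℝ)) :
    fderiv ℝ (fun σ : (Fin n → ℝ) × (Fin k → ℝ) => -dot σ.1 μ + t / 2 * dot σ.1 σ.1 + g σ) σ u =
      t * dot σ.1 u.1 - dot u.1 μ + fderiv ℝ g σ u := by
  obtain ⟨T, hT, hT'⟩ := hasFDerivAt_dot (a := fun σ : (Fin n → ℝ) × (Fin k → ℝ) => σ.1)
    (b := fun _ => μ) (x := σ) hasFDerivAt_fst (hasFDerivAt_const μ _)
  obtain ⟨T₂, hT₂, hT₂'⟩ := hasFDerivAt_dot (a := fun σ : (Fin n → ℝ) × (Fin k → ℝ) => σ.1)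
    (b := fun σ => σ.1) (x := σ) hasFDerivAt_fst hasFDerivAt_fst
  have h := (hT.neg.add (hT₂.const_mul (t / 2))).add
    (hg.differentiable (by simp)).differentiableAt.hasFDerivAt
  have h' : fderiv ℝ (fun σ : (Fin n → ℝ) × (Fin k → ℝ) =>
    -dot σ.1 μ + t / 2 * dot σ.1 σ.1 + g σ) σ = _ := h.fderiv
  rw [h']
  simp only [add_apply, neg_apply, smul_apply, hT', hT₂', smul_eq_mul]
  simp [dot_comm u.1 σ.1, dot_comm σ.1 0, zero_dot]
  ring

theorem fderiv_fderiv_shiftedPhase {g : (Fin n → ℝ) × (Fin k → ℝ) → ℝ} (hg : ContDiff ℝ ∞ g)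
    (t : ℝ) (μ : Fin n → ℝ) (σ u v : (Fin n → ℝ) × (Fin k → ℝ)) :
    fderiv ℝ (fderiv ℝ fun σ : (Fin n → ℝ) × (Fin k → ℝ) =>
      -dot σ.1 μ + t / 2 * dot σ.1 σ.1 + g σ) σ u v =
      t * dot u.1 v.1 + fderiv ℝ (fderiv ℝ g) σ u v := by
  have hf : ContDiff ℝ ∞ fun σ : (Fin n → ℝ) × (Fin k → ℝ) =>
      -dot σ.1 μ + t / 2 * dot σ.1 σ.1 + g σ := by fun_prop
  have hd : ∀ {f : (Fin n → ℝ) × (Fin k → ℝ) → ℝ}, ContDiff ℝ ∞ f → HasFDerivAt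
      (fun σ => fderiv ℝ f σ v)
      ((ContinuousLinearMap.apply ℝ ℝ v) ∘L fderiv ℝ (fderiv ℝ f) σ) σ := fun {f} hf =>
    (ContinuousLinearMap.apply ℝ ℝ v).hasFDerivAt.comp σ ((hf.fderiv_right (m := ∞)
      (by simp)).differentiable (by simp)).differentiableAt.hasFDerivAt
  have h1 := hd hf
  simp only [fderiv_shiftedPhase hg] at h1
  obtain ⟨T, hT, hT'⟩ := hasFDerivAt_dot (a := fun σ : (Fin n → ℝ) × (Fin k → ℝ) => σ.1)
    (b := fun _ => v.1) (x := σ) hasFDerivAt_fst (hasFDerivAt_const v.1 _)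
  have h2 := DFunLike.congr_fun
    (h1.unique (((hT.const_mul t).sub_const (dot v.1 μ)).add (hd hg))) u
  simp only [add_apply, smul_apply, hT', smul_eq_mul,
    ContinuousLinearMap.comp_apply, ContinuousLinearMap.apply_apply] at h2
  rw [h2]
  simp [dot_comm σ.1 0, zero_dot]

end Pencil

/-! ### Uniqueness of sections of a projection. -/

section Section

variable {X Y V : Type} [NormedAddCommGroup X] [NormedSpace ℝ X] [FiniteDimensional ℝ X]
  [NormedAddCommGroup Y] [NormedSpace ℝ Y] [FiniteDimensional ℝ Y]
  [NormedAddCommGroup V] [NormedSpace ℝ V] [FiniteDimensional ℝ V]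

/-- Two sections of a linear projection with values in the zero set of a submersion agree, if the
projection restricts to a local diffeomorphism on the zero set; this is implied by the existence of
a differentiable section and the dimensions. -/
theorem eventually_eq_of_sections {F : X → V} {c : X} (hF : ∀ᶠ z in 𝓝 c, ContDiffAt ℝ ∞ F z)
    (hsurj : Function.Surjective (fderiv ℝ F c)) (pr : X →L[ℝ] Y)
    (hdim : Module.finrank ℝ X = Module.finrank ℝ V + Module.finrank ℝ Y)
    {s : Set Y} {ν₀ : Y} (hs : UniqueDiffWithinAt ℝ s ν₀) (hν₀ : ν₀ ∈ s) {Γ₁ Γ₂ : Y → X}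
    (h₁ : DifferentiableAt ℝ Γ₁ ν₀) (h₂ : ContinuousAt Γ₂ ν₀) (h₁0 : Γ₁ ν₀ = c) (h₂0 : Γ₂ ν₀ = c)
    (hF₁ : ∀ᶠ ν in 𝓝[s] ν₀, F (Γ₁ ν) = 0) (hF₂ : ∀ᶠ ν in 𝓝[s] ν₀, F (Γ₂ ν) = 0)
    (hpr₁ : ∀ᶠ ν in 𝓝 ν₀, pr (Γ₁ ν) = ν) (hpr₂ : ∀ᶠ ν in 𝓝 ν₀, pr (Γ₂ ν) = ν) :
    ∀ᶠ ν in 𝓝[s] ν₀, Γ₁ ν = Γ₂ ν := by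
  have hFd : HasFDerivAt F (fderiv ℝ F c) c :=
    (hF.self_of_nhds.differentiableAt (by simp)).hasFDerivAt
  have hΓd := h₁.hasFDerivAt
  have e1 : pr ∘L fderiv ℝ Γ₁ ν₀ = ContinuousLinearMap.id ℝ Y :=
    (pr.hasFDerivAt.comp ν₀ hΓd).unique ((hasFDerivAt_id ν₀).congr_of_eventuallyEq hpr₁)
  have e2 : fderiv ℝ F c ∘L fderiv ℝ Γ₁ ν₀ = 0 := by
    have h3 : HasFDerivAt (F ∘ Γ₁) (fderiv ℝ F c ∘L fderiv ℝ Γ₁ ν₀) ν₀ :=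
      HasFDerivAt.comp ν₀ (h₁0 ▸ hFd) hΓd
    -- `F ∘ Γ₁` vanishes only on `s`, in the application a half space; unique differentiability
    -- still kills its full derivative.
    refine hs.eq h3.hasFDerivWithinAt ?_
    exact (hasFDerivWithinAt_const (0 : V) ν₀ s).congr_of_eventuallyEq hF₁
      (hF₁.self_of_nhdsWithin hν₀)
  -- By dimension, the section's derivative spans the whole tangent space of the zero set. Hence
  -- `pr` is injective on that space and `(F, pr)` is a local diffeomorphism, which maps both
  -- sections to `(0, ν)`.
  have hker : LinearMap.range (fderiv ℝ Γ₁ ν₀ : Y →ₗ[ℝ] X) =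
      LinearMap.ker (fderiv ℝ F c : X →ₗ[ℝ] V) := by
    apply Submodule.eq_of_le_of_finrank_eq
    · rintro _ ⟨y, rfl⟩
      exact DFunLike.congr_fun e2 y
    · have hinj : Function.Injective (fderiv ℝ Γ₁ ν₀ : Y →ₗ[ℝ] X) :=
        Function.LeftInverse.injective (g := pr) fun y => DFunLike.congr_fun e1 y
      rw [LinearMap.finrank_range_of_inj hinj]
      have h4 := LinearMap.finrank_range_add_finrank_ker (fderiv ℝ F c : X →ₗ[ℝ] V)
      rw [LinearMap.range_eq_top.2 hsurj, finrank_top] at h4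
      omega
  obtain ⟨A, hA⟩ := exists_continuousLinearEquiv_of_injective ((fderiv ℝ F c).prod pr)
    (by rw [hdim, Module.finrank_prod]) (by
      intro u hu
      have hu1 : fderiv ℝ F c u = 0 := congrArg Prod.fst hu
      have hu2 : pr u = 0 := congrArg Prod.snd hu
      have : u ∈ LinearMap.range (fderiv ℝ Γ₁ ν₀ : Y →ₗ[ℝ] X) := hker ▸ hu1
      obtain ⟨y, rfl⟩ := this
      have hy : pr (fderiv ℝ Γ₁ ν₀ y) = y := DFunLike.congr_fun e1 y
      have hy0 : y = 0 := hy.symm.trans hu2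
      rw [hy0, map_zero])
  have hG : HasFDerivAt (fun z => (F z, pr z)) (A : X →L[ℝ] V × Y) c := by
    rw [hA]; exact hFd.prodMk pr.hasFDerivAt
  obtain ⟨e, hc, -, he, -, -⟩ := exists_localDiffeo
    (hF.mono fun z hz => hz.prodMk pr.contDiff.contDiffAt) hG univ_mem
  have hsrc := e.open_source.mem_nhds hc
  have t1 : ∀ᶠ ν in 𝓝 ν₀, Γ₁ ν ∈ e.source := h₁.continuousAt.eventually_mem (h₁0 ▸ hsrc)
  have t2 : ∀ᶠ ν in 𝓝 ν₀, Γ₂ ν ∈ e.source := h₂.eventually_mem (h₂0 ▸ hsrc)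
  filter_upwards [hF₁, hF₂, nhdsWithin_le_nhds hpr₁, nhdsWithin_le_nhds hpr₂,
    nhdsWithin_le_nhds t1, nhdsWithin_le_nhds t2] with ν a1 a2 b1 b2 c1 c2
  refine e.injOn c1 c2 ?_
  rw [he, he, a1, a2, b1, b2]

end Section

end OscInt

namespace OscInt

open MeasureTheory Filter FibredLegendre

theorem dot_sub {n : ℕ} (a b c : Fin n → ℝ) : dot a (b - c) = dot a b - dot a c := by
  rw [dot_comm, sub_dot, dot_comm b, dot_comm c]

theorem dot_smul {n : ℕ} (t : ℝ) (a b : Fin n → ℝ) : dot a (t • b) = t * dot a b := by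
  rw [dot_comm, smul_dot, dot_comm]

/-! ### Critical points and shifted momenta. -/

section Lift

variable {k' l m k : ℕ}

theorem contDiff_cornerPhase {φ₁ : Vec l × Vec k → ℝ} {φ₂ : CornerVar l m k k' → ℝ}
    (h₁ : ContDiff ℝ ∞ φ₁) (h₂ : ContDiff ℝ ∞ φ₂) : ContDiff ℝ ∞ (cornerPhase φ₁ φ₂) :=
  (h₁.comp (by fun_prop)).add (contDiff_fst.mul h₂)

theorem fderiv_cornerPhase {φ₁ : Vec l × Vec k → ℝ} {φ₂ : CornerVar l m k k' → ℝ}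
    (h₁ : ContDiff ℝ ∞ φ₁) (h₂ : ContDiff ℝ ∞ φ₂) (z u : CornerVar l m k k') :
    fderiv ℝ (cornerPhase φ₁ φ₂) z u =
      fderiv ℝ φ₁ (z.2.1, z.2.2.2.1) (u.2.1, u.2.2.2.1) + u.1 * φ₂ z + z.1 * fderiv ℝ φ₂ z u := by
  have e1 : HasFDerivAt φ₁ (fderiv ℝ φ₁ (z.2.1, z.2.2.2.1)) (z.2.1, z.2.2.2.1) :=
    (h₁.differentiable (by simp)).differentiableAt.hasFDerivAt
  have e2 : HasFDerivAt φ₂ (fderiv ℝ φ₂ z) z :=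
    (h₂.differentiable (by simp)).differentiableAt.hasFDerivAt
  have hs := hasFDerivAt_snd (𝕜 := ℝ) (p := z)
  have e4 := (HasFDerivAt.comp (g := φ₁) z e1 (hs.fst.prodMk hs.snd.snd.fst)).add
    ((hasFDerivAt_fst (𝕜 := ℝ) (p := z)).mul e2)
  have e5 : fderiv ℝ (cornerPhase φ₁ φ₂) z = _ := e4.fderiv
  rw [e5]
  simp
  ring

theorem fderiv_fibreSlice {φ₂ : CornerVar l m k k' → ℝ} (h₂ : ContDiff ℝ ∞ φ₂) (x : ℝ) (y : Vec l)
    (v : Vec k) (σ u : Vec m × Vec k') :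
    fderiv ℝ (fun σ : Vec m × Vec k' => φ₂ (x, y, σ.1, v, σ.2)) σ u =
      fderiv ℝ φ₂ (x, y, σ.1, v, σ.2) (0, 0, u.1, 0, u.2) := by
  have e2 : HasFDerivAt φ₂ (fderiv ℝ φ₂ (x, y, σ.1, v, σ.2)) (x, y, σ.1, v, σ.2) :=
    (h₂.differentiable (by simp)).differentiableAt.hasFDerivAt
  have e3 := (hasFDerivAt_const (𝕜 := ℝ) x σ).prodMk ((hasFDerivAt_const (𝕜 := ℝ) y σ).prodMk
    ((hasFDerivAt_fst (𝕜 := ℝ) (p := σ)).prodMk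
      ((hasFDerivAt_const (𝕜 := ℝ) v σ).prodMk (hasFDerivAt_snd (𝕜 := ℝ) (p := σ)))))
  have e4 : fderiv ℝ (fun σ : Vec m × Vec k' => φ₂ (x, y, σ.1, v, σ.2)) σ = _ :=
    (HasFDerivAt.comp (g := φ₂) σ e2 e3).fderiv
  rw [e4]; rfl

/-- The linear projection `(x̃, y', y'', τ, η, μ', μ'') ↦ (x̃, μ' + t y', μ'' + t y'')`. -/
noncomputable def momentum (t : ℝ) : CornerPhase l m →L[ℝ] ℝ × Vec l × Vec m :=
  LinearMap.toContinuousLinearMap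
    { toFun := fun c => (c.1.1, c.2.2.2.1 + t • c.1.2.1, c.2.2.2.2 + t • c.1.2.2)
      map_add' := fun c d => by
        refine Prod.ext rfl (Prod.ext ?_ ?_) <;> simp <;> abel
      map_smul' := fun r c => by
        refine Prod.ext rfl (Prod.ext ?_ ?_) <;> simp [smul_comm t r] }

theorem momentum_apply (t : ℝ) (c : CornerPhase l m) :
    momentum t c = (c.1.1, c.2.2.2.1 + t • c.1.2.1, c.2.2.2.2 + t • c.1.2.2) := rfl

/-- The point `z` is critical for the phase, and its image has the momentum `ν`. -/
def IsLift (t : ℝ) (φ₁ : Vec l × Vec k → ℝ) (φ₂ : CornerVar l m k k' → ℝ) (ν : ℝ × Vec l × Vec m)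
    (z : CornerVar l m k k') : Prop :=
  z.1 = ν.1 ∧
  (∀ u : Vec l × Vec k, fderiv ℝ (cornerPhase φ₁ φ₂) z (0, u.1, 0, u.2, 0) =
    dot u.1 (ν.2.1 - t • z.2.1)) ∧
  ∀ u : Vec m × Vec k', fderiv ℝ φ₂ z (0, 0, u.1, 0, u.2) = dot u.1 (ν.2.2 - t • z.2.2.1)

variable {t : ℝ} {φ₁ : Vec l × Vec k → ℝ} {φ₂ : CornerVar l m k k' → ℝ}
  {ν : ℝ × Vec l × Vec m} {z : CornerVar l m k k'}

theorem map_eq_dot {n : ℕ} (ℓ : Vec n →L[ℝ] ℝ) (u : Vec n) :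
    ℓ u = dot u fun j => ℓ (Pi.single j 1) :=
  (dot_gradient ℓ u).symm

/-- The equations of a lift say that `-y·ν + t|y|²/2` plus the phase is critical also in `y`; this
happens when `ν` is the covector plus `t y`. -/
theorem IsLift.of_crit (h : z ∈ cornerCrit φ₁ φ₂) :
    IsLift t φ₁ φ₂ (momentum t (cornerMap φ₁ φ₂ z)) z := by
  obtain ⟨-, hv, hw⟩ := h
  let D := fderiv ℝ (cornerPhase φ₁ φ₂) z
  let D₂ := fderiv ℝ φ₂ z
  refine ⟨rfl, fun u => ?_, fun u => ?_⟩
  · have e1 := map_eq_dot (D ∘L ((0 : Vec l →L[ℝ] ℝ).prod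
      ((ContinuousLinearMap.id ℝ _).prod (0 : Vec l →L[ℝ] Vec m × Vec k × Vec k')))) u.1
    have e2 := map_eq_dot (D ∘L ((0 : Vec k →L[ℝ] ℝ).prod ((0 : Vec k →L[ℝ] Vec l).prod
      ((0 : Vec k →L[ℝ] Vec m).prod ((ContinuousLinearMap.id ℝ _).prod
        (0 : Vec k →L[ℝ] Vec k')))))) u.2
    change D (0, u.1, 0, 0, 0) = dot u.1 (fun j => D (0, Pi.single j 1, 0, 0, 0)) at e1
    change D (0, 0, 0, u.2, 0) = dot u.2 (fun j => D (0, 0, 0, Pi.single j 1, 0)) at e2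
    have e3 : (fun j => D (0, 0, 0, Pi.single j 1, 0)) = 0 := funext hv
    rw [e3, dot_comm, zero_dot] at e2
    have e4 : ((0, u.1, 0, u.2, 0) : CornerVar l m k k') =
      (0, u.1, 0, 0, 0) + (0, 0, 0, u.2, 0) := by simp
    rw [e4, map_add]
    change D _ + D _ = _
    rw [e1, e2, add_zero]
    simp [momentum_apply, cornerMap, D]
  · have e1 := map_eq_dot (D₂ ∘L ((0 : Vec m →L[ℝ] ℝ).prod ((0 : Vec m →L[ℝ] Vec l).prod
      ((ContinuousLinearMap.id ℝ _).prod (0 : Vec m →L[ℝ] Vec k × Vec k'))))) u.1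
    have e2 := map_eq_dot (D₂ ∘L ((0 : Vec k' →L[ℝ] ℝ).prod ((0 : Vec k' →L[ℝ] Vec l).prod
      ((0 : Vec k' →L[ℝ] Vec m).prod ((0 : Vec k' →L[ℝ] Vec k).prod
        (ContinuousLinearMap.id ℝ _)))))) u.2
    change D₂ (0, 0, u.1, 0, 0) = dot u.1 (fun j => D₂ (0, 0, Pi.single j 1, 0, 0)) at e1
    change D₂ (0, 0, 0, 0, u.2) = dot u.2 (fun j => D₂ (0, 0, 0, 0, Pi.single j 1)) at e2
    have e3 : (fun j => D₂ (0, 0, 0, 0, Pi.single j 1)) = 0 := funext hw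
    rw [e3, dot_comm, zero_dot] at e2
    have e4 : ((0, 0, u.1, 0, u.2) : CornerVar l m k k') =
      (0, 0, u.1, 0, 0) + (0, 0, 0, 0, u.2) := by simp
    rw [e4, map_add]
    change D₂ _ + D₂ _ = _
    rw [e1, e2, add_zero]
    simp [momentum_apply, cornerMap, D₂]

theorem IsLift.mem_cornerCrit (h : IsLift t φ₁ φ₂ ν z) (hν : 0 ≤ ν.1) : z ∈ cornerCrit φ₁ φ₂ := by
  refine ⟨h.1 ▸ hν, fun j => ?_, fun j => ?_⟩
  · exact (h.2.1 (0, Pi.single j 1)).trans (zero_dot _)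
  · exact (h.2.2 (0, Pi.single j 1)).trans (zero_dot _)

theorem IsLift.momentum_eq (h : IsLift t φ₁ φ₂ ν z) : momentum t (cornerMap φ₁ φ₂ z) = ν := by
  rw [momentum_apply]
  refine Prod.ext h.1 (Prod.ext (funext fun j => ?_) (funext fun j => ?_))
  · have := h.2.1 (Pi.single j 1, 0)
    rw [dot_comm, dot_single] at this
    simp only [Pi.add_apply, cornerMap]
    rw [this]; simp
  · have := h.2.2 (Pi.single j 1, 0)
    rw [dot_comm, dot_single] at this
    simp only [Pi.add_apply, cornerMap]
    rw [this]; simp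

end Lift

/-! ### Solving the critical equations in two stages, fibre and base. -/

section Sections

variable {k' l m k : ℕ}

/-- The phase in the variables `σ = (y'', w)`, with parameters `(x̃, (y', v), μ'')`. -/
noncomputable def fibrePhase (t : ℝ) (φ₂ : CornerVar l m k k' → ℝ)
    (p : (ℝ × (Vec l × Vec k) × Vec m) × (Vec m × Vec k')) : ℝ :=
  -dot p.2.1 p.1.2.2 + t / 2 * dot p.2.1 p.2.1 + φ₂ (p.1.1, p.1.2.1.1, p.2.1, p.1.2.1.2, p.2.2)

/-- The phase in the variables `σ = (y', v)`, with parameters `(x̃, μ', μ'')`, where `S` is the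
critical value in the remaining variables. -/
noncomputable def basePhase (t : ℝ) (φ₁ : Vec l × Vec k → ℝ) (S : ℝ × (Vec l × Vec k) × Vec m → ℝ)
    (p : (ℝ × Vec l × Vec m) × (Vec l × Vec k)) : ℝ :=
  -dot p.2.1 p.1.2.1 + t / 2 * dot p.2.1 p.2.1 + (φ₁ p.2 + p.1.1 * S (p.1.1, p.2, p.1.2.2))

theorem contDiff_fibrePhase (t : ℝ) {φ₂ : CornerVar l m k k' → ℝ} (h₂ : ContDiff ℝ ∞ φ₂) :
    ContDiff ℝ ∞ (fibrePhase t φ₂) := by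
  unfold fibrePhase
  fun_prop

theorem contDiff_basePhase (t : ℝ) {φ₁ : Vec l × Vec k → ℝ} {S : ℝ × (Vec l × Vec k) × Vec m → ℝ}
    (h₁ : ContDiff ℝ ∞ φ₁) (hS : ContDiff ℝ ∞ S) : ContDiff ℝ ∞ (basePhase t φ₁ S) := by
  unfold basePhase
  fun_prop

/-- The data of smooth solutions `σ₂(x̃, (y', v), μ'')` and `σ₁(x̃, μ', μ'')` of the critical point
equations, near the point `z₀` over `ν₀`. -/
structure CritSections (t : ℝ) (φ₁ : Vec l × Vec k → ℝ) (φ₂ : CornerVar l m k k' → ℝ)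
    (ν₀ : ℝ × Vec l × Vec m) (z₀ : CornerVar l m k k') where
  σ₂ : ℝ × (Vec l × Vec k) × Vec m → Vec m × Vec k'
  σ₁ : ℝ × Vec l × Vec m → Vec l × Vec k
  contDiff₂ : ContDiff ℝ ∞ σ₂
  contDiff₁ : ContDiff ℝ ∞ σ₁
  eq₂ : σ₂ (0, (z₀.2.1, z₀.2.2.2.1), ν₀.2.2) = (z₀.2.2.1, z₀.2.2.2.2)
  eq₁ : σ₁ ν₀ = (z₀.2.1, z₀.2.2.2.1)
  crit₂ : ∀ᶠ p in 𝓝 ((0, (z₀.2.1, z₀.2.2.2.1), ν₀.2.2) : ℝ × (Vec l × Vec k) × Vec m),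
    fderiv ℝ (fun σ => fibrePhase t φ₂ (p, σ)) (σ₂ p) = 0
  crit₁ : ∀ᶠ ν in 𝓝 ν₀,
    fderiv ℝ (fun σ => basePhase t φ₁ (fun p => fibrePhase t φ₂ (p, σ₂ p)) (ν, σ)) (σ₁ ν) = 0

variable {t : ℝ} {φ₁ : Vec l × Vec k → ℝ} {φ₂ : CornerVar l m k k' → ℝ}
  {z₀ : CornerVar l m k k'} {ν₀ : ℝ × Vec l × Vec m}

/-- The quadratic form of `t |y|² / 2 + φ₁` at `σ` is nondegenerate. -/
def NondegenerateShift (t : ℝ) (φ₁ : Vec l × Vec k → ℝ) (σ : Vec l × Vec k) : Prop :=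
  ∀ u, (∀ v, t * dot u.1 v.1 + fderiv ℝ (fderiv ℝ φ₁) σ u v = 0) → u = 0

theorem fderiv_fibrePhase (h₂ : ContDiff ℝ ∞ φ₂) (p : ℝ × (Vec l × Vec k) × Vec m)
    (σ u : Vec m × Vec k') :
    fderiv ℝ (fun σ => fibrePhase t φ₂ (p, σ)) σ u = t * dot σ.1 u.1 - dot u.1 p.2.2 +
      fderiv ℝ φ₂ (p.1, p.2.1.1, σ.1, p.2.1.2, σ.2) (0, 0, u.1, 0, u.2) := by
  rw [← fderiv_fibreSlice h₂]
  exact fderiv_shiftedPhase (g := fun σ : Vec m × Vec k' => φ₂ (p.1, p.2.1.1, σ.1, p.2.1.2, σ.2))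
    (by fun_prop) t p.2.2 σ u

theorem fderiv_fderiv_fibrePhase (h₂ : ContDiff ℝ ∞ φ₂) (p : ℝ × (Vec l × Vec k) × Vec m)
    (σ u v : Vec m × Vec k') :
    fderiv ℝ (fderiv ℝ fun σ => fibrePhase t φ₂ (p, σ)) σ u v = t * dot u.1 v.1 +
      fderiv ℝ (fderiv ℝ fun σ : Vec m × Vec k' => φ₂ (p.1, p.2.1.1, σ.1, p.2.1.2, σ.2)) σ u v :=
  fderiv_fderiv_shiftedPhase
    (g := fun σ : Vec m × Vec k' => φ₂ (p.1, p.2.1.1, σ.1, p.2.1.2, σ.2)) (by fun_prop) t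
    p.2.2 σ u v

/-- At `x̃ = 0` the contribution of the fibre drops out, so nondegeneracy of the base stage involves
`φ₁` alone. -/
theorem basePhase_of_eq_zero {S : ℝ × (Vec l × Vec k) × Vec m → ℝ} {ν : ℝ × Vec l × Vec m}
    (hν : ν.1 = 0) : (fun σ => basePhase t φ₁ S (ν, σ)) =
      fun σ : Vec l × Vec k => -dot σ.1 ν.2.1 + t / 2 * dot σ.1 σ.1 + φ₁ σ := by
  funext σ; simp [basePhase, hν]

/-- First `(y'', w)` is solved for with `(y', v)` as parameters, then `(y', v)` with the fibre
critical value, weighted by `x̃`, put into the phase. The two separate nondegeneracy conditions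
match the two stages. -/
theorem exists_critSections (h₁ : ContDiff ℝ ∞ φ₁) (h₂ : ContDiff ℝ ∞ φ₂) (hz₀ : z₀.1 = 0)
    (hlift : IsLift t φ₁ φ₂ ν₀ z₀) (hnd₁ : NondegenerateShift t φ₁ (z₀.2.1, z₀.2.2.2.1))
    (hnd₂ : NondegenerateShift t (fun σ : Vec m × Vec k' => φ₂ (z₀.1, z₀.2.1, σ.1, z₀.2.2.2.1, σ.2))
      (z₀.2.2.1, z₀.2.2.2.2)) : Nonempty (CritSections t φ₁ φ₂ ν₀ z₀) := by
  obtain ⟨σ₂, hσ₂, e₂, c₂⟩ := exists_smooth_crit (contDiff_fibrePhase t h₂)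
    (p₀ := (0, (z₀.2.1, z₀.2.2.2.1), ν₀.2.2)) (s₀ := (z₀.2.2.1, z₀.2.2.2.2)) (by
      refine ContinuousLinearMap.ext fun u => ?_
      rw [fderiv_fibrePhase h₂]
      have h3 := hlift.2.2 u
      rw [dot_sub, dot_smul, dot_comm u.1 z₀.2.2.1] at h3
      have h4 : ((0, z₀.2.1, z₀.2.2.1, z₀.2.2.2.1, z₀.2.2.2.2) : CornerVar l m k k') = z₀ := by
        rw [← hz₀]
      simp only [h4, h3, zero_apply]
      ring) (by
      intro u hu
      refine hnd₂ u fun v => ?_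
      have := fderiv_fderiv_fibrePhase (t := t) h₂ (0, (z₀.2.1, z₀.2.2.2.1), ν₀.2.2)
        (z₀.2.2.1, z₀.2.2.2.2) u v
      rw [hu] at this
      rw [hz₀]
      exact this.symm)
  have hS : ContDiff ℝ ∞ fun p => fibrePhase t φ₂ (p, σ₂ p) :=
    (contDiff_fibrePhase t h₂).comp (by fun_prop)
  have hν₀ : ν₀.1 = 0 := hlift.1.symm.trans hz₀
  obtain ⟨σ₁, hσ₁, e₁, c₁⟩ := exists_smooth_crit (contDiff_basePhase t h₁ hS)
    (p₀ := ν₀) (s₀ := (z₀.2.1, z₀.2.2.2.1)) (by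
      rw [basePhase_of_eq_zero hν₀]
      refine ContinuousLinearMap.ext fun u => ?_
      rw [fderiv_shiftedPhase h₁]
      have := hlift.2.1 u
      rw [fderiv_cornerPhase h₁ h₂, hz₀] at this
      simp only [zero_mul, add_zero] at this
      rw [this, dot_sub, dot_smul, dot_comm z₀.2.1]
      simp) (by
      intro u hu
      rw [basePhase_of_eq_zero hν₀] at hu
      refine hnd₁ u fun v => ?_
      rw [← fderiv_fderiv_shiftedPhase h₁ t ν₀.2.1, hu]
      rfl)
  exact ⟨⟨σ₂, σ₁, hσ₂, hσ₁, e₂, e₁, c₂, c₁⟩⟩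

namespace CritSections

variable (s : CritSections t φ₁ φ₂ ν₀ z₀)

/-- The critical point over `ν`. -/
def lift (ν : ℝ × Vec l × Vec m) : CornerVar l m k k' :=
  (ν.1, (s.σ₁ ν).1, (s.σ₂ (ν.1, s.σ₁ ν, ν.2.2)).1, (s.σ₁ ν).2, (s.σ₂ (ν.1, s.σ₁ ν, ν.2.2)).2)

theorem contDiff_lift : ContDiff ℝ ∞ s.lift := by
  have h1 := s.contDiff₁
  have h2 := s.contDiff₂
  have h3 : ContDiff ℝ ∞ fun ν : ℝ × Vec l × Vec m => s.σ₂ (ν.1, s.σ₁ ν, ν.2.2) :=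
    h2.comp (by fun_prop)
  unfold lift
  fun_prop

theorem tendsto_params (hν₀ : ν₀.1 = 0) : Tendsto (fun ν : ℝ × Vec l × Vec m =>
    (ν.1, s.σ₁ ν, ν.2.2)) (𝓝 ν₀) (𝓝 (0, (z₀.2.1, z₀.2.2.2.1), ν₀.2.2)) := by
  have h1 := s.contDiff₁.continuous
  have : Continuous fun ν : ℝ × Vec l × Vec m => (ν.1, s.σ₁ ν, ν.2.2) := by fun_prop
  have h2 := this.tendsto ν₀
  simpa only [s.eq₁, hν₀] using h2

theorem lift_eq (hν₀ : ν₀.1 = 0) (hz₀ : z₀.1 = 0) : s.lift ν₀ = z₀ := by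
  simp only [lift, s.eq₁, hν₀, s.eq₂]
  rw [← hz₀]

/-- By the envelope formula the derivative of the fibre critical value in `(y', v)` is the partial
derivative of `φ₂`, so the staged equations are the joint ones. -/
theorem isLift (h₁ : ContDiff ℝ ∞ φ₁) (h₂ : ContDiff ℝ ∞ φ₂) (hν₀ : ν₀.1 = 0) :
    ∀ᶠ ν in 𝓝 ν₀, IsLift t φ₁ φ₂ ν (s.lift ν) := by
  filter_upwards [s.crit₁, (s.tendsto_params hν₀).eventually s.crit₂] with ν hc₁ hc₂
  have hS : ContDiff ℝ ∞ fun p => fibrePhase t φ₂ (p, s.σ₂ p) :=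
    (contDiff_fibrePhase t h₂).comp (contDiff_id.prodMk s.contDiff₂)
  refine ⟨rfl, fun u => ?_, fun u => ?_⟩
  · have e0 := hasFDerivAt_critValue (contDiff_fibrePhase t h₂) s.contDiff₂ hc₂
    have e1 := (hasFDerivAt_const (𝕜 := ℝ) ν.1 (s.σ₁ ν)).prodMk
      ((hasFDerivAt_id (𝕜 := ℝ) (s.σ₁ ν)).prodMk (hasFDerivAt_const (𝕜 := ℝ) ν.2.2 (s.σ₁ ν)))
    have e2 := HasFDerivAt.comp (g := fun p => fibrePhase t φ₂ (p, s.σ₂ p)) (s.σ₁ ν) e0 e1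
    have e3 := DFunLike.congr_fun hc₁ u
    have e4 := fderiv_shiftedPhase (g := fun σ : Vec l × Vec k =>
      φ₁ σ + ν.1 * fibrePhase t φ₂ ((ν.1, σ, ν.2.2), s.σ₂ (ν.1, σ, ν.2.2)))
      (h₁.add (contDiff_const.mul (hS.comp (by fun_prop)))) t ν.2.1 (s.σ₁ ν) u
    have e5 := e4.symm.trans e3
    have e6 := ((h₁.differentiable (by simp)).differentiableAt (x := s.σ₁ ν)).hasFDerivAt.add
      (e2.const_mul ν.1)
    have e7 : fderiv ℝ (fun σ : Vec l × Vec k =>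
      φ₁ σ + ν.1 * fibrePhase t φ₂ ((ν.1, σ, ν.2.2), s.σ₂ (ν.1, σ, ν.2.2))) (s.σ₁ ν) = _ :=
        e6.fderiv
    rw [e7] at e5
    have e8 : fderiv ℝ (fibrePhase t φ₂) ((ν.1, s.σ₁ ν, ν.2.2), s.σ₂ (ν.1, s.σ₁ ν, ν.2.2))
        ((0, u, 0), 0) = fderiv ℝ φ₂ (s.lift ν) (0, u.1, 0, u.2, 0) := by
      have f1 := e1.prodMk (hasFDerivAt_const (𝕜 := ℝ) (s.σ₂ (ν.1, s.σ₁ ν, ν.2.2)) (s.σ₁ ν))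
      have f2 := HasFDerivAt.comp (g := fibrePhase t φ₂) (s.σ₁ ν)
        ((contDiff_fibrePhase t h₂).differentiable (by simp)).differentiableAt.hasFDerivAt f1
      have f3 := (hasFDerivAt_const (𝕜 := ℝ) ν.1 (s.σ₁ ν)).prodMk
        ((hasFDerivAt_fst (𝕜 := ℝ) (p := s.σ₁ ν)).prodMk
          ((hasFDerivAt_const (𝕜 := ℝ) (s.σ₂ (ν.1, s.σ₁ ν, ν.2.2)).1 (s.σ₁ ν)).prodMk
            ((hasFDerivAt_snd (𝕜 := ℝ) (p := s.σ₁ ν)).prodMk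
              (hasFDerivAt_const (𝕜 := ℝ) (s.σ₂ (ν.1, s.σ₁ ν, ν.2.2)).2 (s.σ₁ ν)))))
      have f4 := (HasFDerivAt.comp (g := φ₂) (s.σ₁ ν)
        (h₂.differentiable (by simp)).differentiableAt.hasFDerivAt f3).const_add
        (-dot (s.σ₂ (ν.1, s.σ₁ ν, ν.2.2)).1 ν.2.2 + t / 2 *
          dot (s.σ₂ (ν.1, s.σ₁ ν, ν.2.2)).1 (s.σ₂ (ν.1, s.σ₁ ν, ν.2.2)).1)
      exact DFunLike.congr_fun (f2.unique f4) u
    rw [fderiv_cornerPhase h₁ h₂, dot_sub, dot_smul]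
    rw [← e8]
    simp only [lift, zero_mul, add_zero]
    change t * dot (s.σ₁ ν).1 u.1 - dot u.1 ν.2.1 + (fderiv ℝ φ₁ (s.σ₁ ν) u + ν.1 *
      fderiv ℝ (fibrePhase t φ₂) ((ν.1, s.σ₁ ν, ν.2.2), s.σ₂ (ν.1, s.σ₁ ν, ν.2.2))
        ((0, u, 0), 0)) = 0 at e5
    rw [dot_comm u.1 (s.σ₁ ν).1]
    linarith
  · have e1 := fderiv_fibrePhase (t := t) h₂ (ν.1, s.σ₁ ν, ν.2.2) (s.σ₂ (ν.1, s.σ₁ ν, ν.2.2)) u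
    rw [hc₂] at e1
    change 0 = _ at e1
    rw [dot_sub, dot_smul, dot_comm u.1 (s.lift ν).2.2.1]
    simp only [lift] at *
    linarith

end CritSections

end Sections

end OscInt

namespace OscInt

open MeasureTheory Filter FibredLegendre

/-! ### Passage to the canonical phase. -/

section Canonical

variable {k' l m k : ℕ}

/-- The coordinates `(x'', x̃, y', y'')` of points off the boundary. -/
def cornerInterior (l m : ℕ) : Set (ℝ × ℝ × Vec l × Vec m) := {β | 0 < β.1 ∧ 0 < β.2.1}

/-- The weight `x^{-p} (x'')^{-p'}`, where `x = x̃ x''`. -/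
noncomputable def cornerWeight (p p' : ℝ) (β : ℝ × ℝ × Vec l × Vec m) : ℝ :=
  (β.2.1 * β.1) ^ (-p) * β.1 ^ (-p')

theorem cornerWeight_mul {p p' q q' : ℝ} {β : ℝ × ℝ × Vec l × Vec m}
    (hβ : β ∈ cornerInterior l m) :
    cornerWeight p p' β * (β.2.1 * β.1) ^ (-q) * β.1 ^ (-q') =
      cornerWeight (p + q) (p' + q') β := by
  unfold cornerWeight
  rw [neg_add, neg_add, Real.rpow_add (mul_pos hβ.2 hβ.1), Real.rpow_add hβ.1]
  ring

variable {t : ℝ} {φ₁ : Vec l × Vec k → ℝ} {φ₂ : CornerVar l m k k' → ℝ}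
  {z₀ : CornerVar l m k k'} {ν₀ : ℝ × Vec l × Vec m}

/-- The phase with the additional variables `(z', μ')` and `(z'', μ'')` of Fourier inversions in
`y'` and `y''`, in the order `(((v, w), (z', μ')), (z'', μ''))`. -/
noncomputable def extendedPhase (t : ℝ) (φ₁ : Vec l × Vec k → ℝ) (φ₂ : CornerVar l m k k' → ℝ)
    (z : (ℝ × ℝ × Vec l × Vec m) ×
      (((Vec k × Vec k') × (Vec l × Vec l)) × (Vec m × Vec m))) : ℝ :=
  (dot (z.1.2.2.1 - z.2.1.2.1) z.2.1.2.2 + t / 2 * (dot z.2.1.2.1 z.2.1.2.1 -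
    dot z.1.2.2.1 z.1.2.2.1) + φ₁ (z.2.1.2.1, z.2.1.1.1)) / (z.1.2.1 * z.1.1) +
  (dot (z.1.2.2.2 - z.2.2.1) z.2.2.2 + (t / 2 * (dot z.2.2.1 z.2.2.1 -
    dot z.1.2.2.2 z.1.2.2.2) + φ₂ (z.1.2.1, z.2.1.2.1, z.2.2.1, z.2.1.1.1, z.2.1.1.2))) / z.1.1

theorem fderiv_half_sq {n : ℕ} (t r : ℝ) {g : Vec n → ℝ} (hg : ContDiff ℝ ∞ g) (y u : Vec n) :
    fderiv ℝ (fun ζ => t / 2 * (dot ζ ζ - r) + g ζ) y u = t * dot u y + fderiv ℝ g y u := by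
  obtain ⟨T, hT, hT'⟩ := hasFDerivAt_dot (a := fun ζ : Vec n => ζ) (b := fun ζ => ζ) (x := y)
    (hasFDerivAt_id y) (hasFDerivAt_id y)
  have h : fderiv ℝ (fun ζ => t / 2 * (dot ζ ζ - r) + g ζ) y = _ :=
    (((hT.sub_const r).const_mul (t / 2)).add
      (hg.differentiable (by simp)).differentiableAt.hasFDerivAt).fderiv
  rw [h]
  simp only [add_apply, smul_apply, hT', smul_eq_mul]
  simp [dot_comm y u]
  ring

/-- Identifies the critical value of the Fourier variable with the shifted momentum. -/
theorem gradient_half_sq {n : ℕ} (t r : ℝ) {g : Vec n → ℝ} (hg : ContDiff ℝ ∞ g) {y μ : Vec n}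
    (h : ∀ u, fderiv ℝ g y u = dot u (μ - t • y)) :
    gradient (fderiv ℝ (fun ζ => t / 2 * (dot ζ ζ - r) + g ζ) y) = μ := by
  funext j
  rw [gradient, fderiv_half_sq t r hg, h, dot_sub, dot_smul, dot_comm _ μ, dot_single]
  ring

/-- Fourier inversion in `y'` at scale `x` and in `y''` at scale `x''`. The differences of squares
vanish at `z' = y'`, `z'' = y''`, so they leave the original phase intact but alter the Hessian in
the variables eliminated next. -/
theorem oscEquiv_extendedPhase (h₁ : ContDiff ℝ ∞ φ₁) (h₂ : ContDiff ℝ ∞ φ₂) (hz₀ : z₀.1 = 0)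
    (hlift : IsLift t φ₁ φ₂ ν₀ z₀) :
    OscEquiv (cornerInterior l m) (cornerWeight (k / 2 + l) (k' / 2 + m))
      (extendedPhase t φ₁ φ₂)
      ((0, 0, z₀.2.1, z₀.2.2.1),
        (((z₀.2.2.2.1, z₀.2.2.2.2), (z₀.2.1, ν₀.2.1)), (z₀.2.2.1, ν₀.2.2)))
      (cornerWeight (k / 2) (k' / 2))
      (fun z : (ℝ × ℝ × Vec l × Vec m) × (Vec k × Vec k') => cornerPhase φ₁ φ₂
        (z.1.2.1, z.1.2.2.1, z.1.2.2.2, z.2.1, z.2.2) / (z.1.2.1 * z.1.1))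
      ((0, 0, z₀.2.1, z₀.2.2.1), (z₀.2.2.2.1, z₀.2.2.2.2)) := by
  have hz : ((0, z₀.2.1, z₀.2.2.1, z₀.2.2.2.1, z₀.2.2.2.2) : CornerVar l m k k') = z₀ := by
    rw [← hz₀]
  have hh₁ : ContDiff ℝ ∞ fun β : ℝ × ℝ × Vec l × Vec m => β.2.1 * β.1 := by fun_prop
  have hh₂ : ContDiff ℝ ∞ fun β : ℝ × ℝ × Vec l × Vec m => β.1 := by fun_prop
  have key₁ := OscEquiv.fourier (Pos := cornerInterior l m) (N := cornerWeight (k / 2) (k' / 2))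
    (z₀ := ((0, 0, z₀.2.1, z₀.2.2.1), (z₀.2.2.2.1, z₀.2.2.2.2))) (Ψ := fun _ => 0)
    (E := Vec k × Vec k') hh₁ (by simp) (fun β hβ => mul_pos hβ.2 hβ.1)
    (fun _ _ => measurable_const) (y := fun z => z.1.2.2.1) (by fun_prop)
    (g := fun p => t / 2 * (dot p.2 p.2 - dot p.1.1.2.2.1 p.1.1.2.2.1) +
      cornerPhase φ₁ φ₂ (p.1.1.2.1, p.2, p.1.1.2.2.2, p.1.2.1, p.1.2.2))
    (((contDiff_const.mul ((contDiff_dot (by fun_prop) (by fun_prop)).sub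
      (contDiff_dot (by fun_prop) (by fun_prop))))).add
        ((contDiff_cornerPhase h₁ h₂).comp (by fun_prop)))
  have g₁ : gradient (fderiv ℝ (fun ζ : Vec l => t / 2 * (dot ζ ζ - dot z₀.2.1 z₀.2.1) +
      cornerPhase φ₁ φ₂ (0, ζ, z₀.2.2.1, z₀.2.2.2.1, z₀.2.2.2.2)) z₀.2.1) = ν₀.2.1 := by
    refine gradient_half_sq t _ ((contDiff_cornerPhase h₁ h₂).comp (by fun_prop)) fun u => ?_
    have e1 := (hasFDerivAt_const (𝕜 := ℝ) (0 : ℝ) z₀.2.1).prodMk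
      ((hasFDerivAt_id (𝕜 := ℝ) z₀.2.1).prodMk
        (hasFDerivAt_const (𝕜 := ℝ) (z₀.2.2.1, z₀.2.2.2.1, z₀.2.2.2.2) z₀.2.1))
    have e2 : fderiv ℝ (fun ζ : Vec l => cornerPhase φ₁ φ₂
        (0, ζ, z₀.2.2.1, z₀.2.2.2.1, z₀.2.2.2.2)) z₀.2.1 = _ :=
      (HasFDerivAt.comp (g := cornerPhase φ₁ φ₂) z₀.2.1
        ((contDiff_cornerPhase h₁ h₂).differentiable
          (by simp)).differentiableAt.hasFDerivAt e1).fderiv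
    refine (DFunLike.congr_fun e2 u).trans ?_
    simp only [id, hz]
    exact hlift.2.1 (u, 0)
  rw [g₁] at key₁
  have key₂ := OscEquiv.fourier (Pos := cornerInterior l m)
    (N := fun β => cornerWeight (k / 2) (k' / 2) β * (β.2.1 * β.1) ^ (-(l : ℝ)))
    (z₀ := ((0, 0, z₀.2.1, z₀.2.2.1), ((z₀.2.2.2.1, z₀.2.2.2.2), (z₀.2.1, ν₀.2.1))))
    (Ψ := fun z => (dot (z.1.2.2.1 - z.2.2.1) z.2.2.2 + t / 2 * (dot z.2.2.1 z.2.2.1 -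
      dot z.1.2.2.1 z.1.2.2.1) + φ₁ (z.2.2.1, z.2.1.1)) / (z.1.2.1 * z.1.1))
    (E := (Vec k × Vec k') × (Vec l × Vec l)) hh₂ (by simp) (fun β hβ => hβ.1)
    (fun β _ => (ContDiff.continuous (𝕜 := ℝ) (n := ∞)
      (by simp only [div_eq_mul_inv]; fun_prop)).measurable)
    (y := fun z => z.1.2.2.2) (by fun_prop)
    (g := fun p => t / 2 * (dot p.2 p.2 - dot p.1.1.2.2.2 p.1.1.2.2.2) +
      φ₂ (p.1.1.2.1, p.1.2.2.1, p.2, p.1.2.1.1, p.1.2.1.2)) (by fun_prop)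
  have g₂ : gradient (fderiv ℝ (fun ζ : Vec m => t / 2 * (dot ζ ζ - dot z₀.2.2.1 z₀.2.2.1) +
      φ₂ (0, z₀.2.1, ζ, z₀.2.2.2.1, z₀.2.2.2.2)) z₀.2.2.1) = ν₀.2.2 := by
    refine gradient_half_sq t _ (h₂.comp (by fun_prop)) fun u => ?_
    have e1 := (hasFDerivAt_const (𝕜 := ℝ) (0 : ℝ) z₀.2.2.1).prodMk
      ((hasFDerivAt_const (𝕜 := ℝ) z₀.2.1 z₀.2.2.1).prodMk
        ((hasFDerivAt_id (𝕜 := ℝ) z₀.2.2.1).prodMk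
          (hasFDerivAt_const (𝕜 := ℝ) (z₀.2.2.2.1, z₀.2.2.2.2) z₀.2.2.1)))
    have e2 : fderiv ℝ (fun ζ : Vec m => φ₂
        (0, z₀.2.1, ζ, z₀.2.2.2.1, z₀.2.2.2.2)) z₀.2.2.1 = _ :=
      (HasFDerivAt.comp (g := φ₂) z₀.2.2.1
        (h₂.differentiable (by simp)).differentiableAt.hasFDerivAt e1).fderiv
    refine (DFunLike.congr_fun e2 u).trans ?_
    simp only [id, hz]
    exact hlift.2.2 (u, 0)
  rw [g₂] at key₂
  refine OscEquiv.trans (key₂.congr_left (fun β hβ => ?_) (.of_forall fun z _ => rfl))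
    (OscEquiv.trans (OscEquiv.of_eventuallyEq (fun _ _ => rfl) (.of_forall fun z hz => ?_))
      (key₁.trans (OscEquiv.of_eventuallyEq (fun _ _ => rfl) (.of_forall fun z _ => ?_))))
  · rw [cornerWeight_mul hβ]
  -- Off the boundary `φ/x` splits as `φ₁/x + φ₂/x''`, which exposes the two scales.
  · have hx : z.1.1 ≠ 0 := hz.1.ne'
    have hy : z.1.2.1 ≠ 0 := hz.2.ne'
    simp only [cornerPhase]
    field_simp
    ring
  · simp

/-- The part of the canonical phase that depends on the point `c` of the Legendrian over `ν`. -/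
noncomputable def generatingValue (t : ℝ) (c : CornerPhase l m) (ν : ℝ × Vec l × Vec m) : ℝ :=
  -c.2.1 - dot c.1.2.1 ν.2.1 + t / 2 * dot c.1.2.1 c.1.2.1 +
    ν.1 * (-dot c.1.2.2 ν.2.2 + t / 2 * dot c.1.2.2 c.1.2.2)

/-- The canonical phase in the variables `(μ', μ'')`, determined by a section `Γ` of the
Legendrian. -/
noncomputable def canonicalPhase (t : ℝ) (Γ : ℝ × Vec l × Vec m → CornerPhase l m)
    (z : (ℝ × ℝ × Vec l × Vec m) × (Vec l × Vec m)) : ℝ :=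
  (dot z.1.2.2.1 z.2.1 - t / 2 * dot z.1.2.2.1 z.1.2.2.1 +
    z.1.2.1 * (dot z.1.2.2.2 z.2.2 - t / 2 * dot z.1.2.2.2 z.1.2.2.2) +
    generatingValue t (Γ (z.1.2.1, z.2)) (z.1.2.1, z.2)) / (z.1.2.1 * z.1.1)

/-- The reordering `(((v, w), (z', μ')), (z'', μ'')) ↦ (((μ', μ''), (z', v)), (z'', w))`. -/
noncomputable def reorder (l m k k' : ℕ) :
    (((Vec k × Vec k') × (Vec l × Vec l)) × (Vec m × Vec m)) ≃L[ℝ]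
      (((Vec l × Vec m) × (Vec l × Vec k)) × (Vec m × Vec k')) :=
  LinearEquiv.toContinuousLinearEquiv
    { toFun := fun e => (((e.1.2.2, e.2.2), (e.1.2.1, e.1.1.1)), (e.2.1, e.1.1.2))
      invFun := fun e => (((e.1.2.2, e.2.2), (e.1.2.1, e.1.1.1)), (e.2.1, e.1.1.2))
      map_add' := fun _ _ => rfl
      map_smul' := fun _ _ => rfl
      left_inv := fun _ => rfl
      right_inv := fun _ => rfl }

/-- The extended phase in the variables `(((μ', μ''), (z', v)), (z'', w))`. -/
noncomputable def reorderedPhase (t : ℝ) (φ₁ : Vec l × Vec k → ℝ) (φ₂ : CornerVar l m k k' → ℝ)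
    (z : (ℝ × ℝ × Vec l × Vec m) ×
      (((Vec l × Vec m) × (Vec l × Vec k)) × (Vec m × Vec k'))) : ℝ :=
  ((dot (z.1.2.2.1 - z.2.1.2.1) z.2.1.1.1 + t / 2 * (dot z.2.1.2.1 z.2.1.2.1 -
    dot z.1.2.2.1 z.1.2.2.1) + φ₁ z.2.1.2) / (z.1.2.1 * z.1.1) +
  (dot z.1.2.2.2 z.2.1.1.2 - t / 2 * dot z.1.2.2.2 z.1.2.2.2) / z.1.1) +
    fibrePhase t φ₂ ((z.1.2.1, z.2.1.2, z.2.1.1.2), z.2.2) / z.1.1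

theorem extendedPhase_eq (z : (ℝ × ℝ × Vec l × Vec m) ×
    (((Vec k × Vec k') × (Vec l × Vec l)) × (Vec m × Vec m))) :
    extendedPhase t φ₁ φ₂ z = reorderedPhase t φ₁ φ₂ (z.1, reorder l m k k' z.2) := by
  change _ = ((dot (z.1.2.2.1 - z.2.1.2.1) z.2.1.2.2 + t / 2 * (dot z.2.1.2.1 z.2.1.2.1 -
    dot z.1.2.2.1 z.1.2.2.1) + φ₁ (z.2.1.2.1, z.2.1.1.1)) / (z.1.2.1 * z.1.1) +
    (dot z.1.2.2.2 z.2.2.2 - t / 2 * dot z.1.2.2.2 z.1.2.2.2) / z.1.1) +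
    (-dot z.2.2.1 z.2.2.2 + t / 2 * dot z.2.2.1 z.2.2.1 +
      φ₂ (z.1.2.1, z.2.1.2.1, z.2.2.1, z.2.1.1.1, z.2.1.1.2)) / z.1.1
  simp only [extendedPhase, sub_dot]
  ring

theorem oscEquiv_reorder {N : ℝ × ℝ × Vec l × Vec m → ℝ} :
    OscEquiv (cornerInterior l m) N (extendedPhase t φ₁ φ₂)
      ((0, 0, z₀.2.1, z₀.2.2.1),
        (((z₀.2.2.2.1, z₀.2.2.2.2), (z₀.2.1, ν₀.2.1)), (z₀.2.2.1, ν₀.2.2)))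
      N (reorderedPhase t φ₁ φ₂) ((0, 0, z₀.2.1, z₀.2.2.1),
        ((ν₀.2, (z₀.2.1, z₀.2.2.2.1)), (z₀.2.2.1, z₀.2.2.2.2))) :=
  OscEquiv.of_linearEquiv (reorder l m k k') (.of_forall fun z _ => extendedPhase_eq z)

namespace CritSections

variable (s : CritSections t φ₁ φ₂ ν₀ z₀)

/-- The phase that remains after the elimination of `(z'', w)`. -/
noncomputable def reducedPhase
    (z : (ℝ × ℝ × Vec l × Vec m) × ((Vec l × Vec m) × (Vec l × Vec k))) : ℝ :=
  ((dot z.1.2.2.1 z.2.1.1 - t / 2 * dot z.1.2.2.1 z.1.2.2.1) / (z.1.2.1 * z.1.1) +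
    (dot z.1.2.2.2 z.2.1.2 - t / 2 * dot z.1.2.2.2 z.1.2.2.2) / z.1.1) +
  basePhase t φ₁ (fun p => fibrePhase t φ₂ (p, s.σ₂ p)) ((z.1.2.1, z.2.1), z.2.2) /
    (z.1.2.1 * z.1.1)

theorem contDiff_critValue (h₂ : ContDiff ℝ ∞ φ₂) :
    ContDiff ℝ ∞ fun p => fibrePhase t φ₂ (p, s.σ₂ p) :=
  (contDiff_fibrePhase t h₂).comp (contDiff_id.prodMk s.contDiff₂)

/-- Elimination of `(z', v)` at scale `x`. Since `τ = -φ`, the critical value can be read off from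
the point of the Legendrian, with no further reference to `φ₁`, `φ₂`. -/
theorem oscEquiv_canonicalPhase (h₁ : ContDiff ℝ ∞ φ₁) (h₂ : ContDiff ℝ ∞ φ₂) (hν₀ : ν₀.1 = 0)
    (hnd₁ : NondegenerateShift t φ₁ (z₀.2.1, z₀.2.2.2.1)) :
    OscEquiv (cornerInterior l m)
      (fun β => cornerWeight (l / 2) (m / 2) β * (β.2.1 * β.1) ^
        (-(Module.finrank ℝ (Vec l × Vec k) / 2 : ℝ)))
      s.reducedPhase ((0, 0, z₀.2.1, z₀.2.2.1), (ν₀.2, (z₀.2.1, z₀.2.2.2.1)))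
      (cornerWeight (l / 2) (m / 2)) (canonicalPhase t fun ν => cornerMap φ₁ φ₂ (s.lift ν))
      ((0, 0, z₀.2.1, z₀.2.2.1), ν₀.2) := by
  have hh₁ : ContDiff ℝ ∞ fun β : ℝ × ℝ × Vec l × Vec m => β.2.1 * β.1 := by fun_prop
  have hS := s.contDiff_critValue h₂
  have hν : ((0, ν₀.2) : ℝ × Vec l × Vec m) = ν₀ := by rw [← hν₀]
  have key := OscEquiv.eliminate (Pos := cornerInterior l m)
    (N := cornerWeight (l / 2) (m / 2)) (z₀ := ((0, 0, z₀.2.1, z₀.2.2.1), ν₀.2))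
    (Ψ := fun z : (ℝ × ℝ × Vec l × Vec m) × (Vec l × Vec m) =>
      (dot z.1.2.2.1 z.2.1 - t / 2 * dot z.1.2.2.1 z.1.2.2.1) / (z.1.2.1 * z.1.1) +
      (dot z.1.2.2.2 z.2.2 - t / 2 * dot z.1.2.2.2 z.1.2.2.2) / z.1.1)
    (F := Vec l × Vec k) hh₁ (by simp) (fun β hβ => mul_pos hβ.2 hβ.1)
    (fun β _ => (ContDiff.continuous (𝕜 := ℝ) (n := ∞)
      (by simp only [div_eq_mul_inv]; fun_prop)).measurable)
    (f := fun p => basePhase t φ₁ (fun p => fibrePhase t φ₂ (p, s.σ₂ p))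
      ((p.1.1.2.1, p.1.2), p.2))
    ((contDiff_basePhase t h₁ hS).comp (by fun_prop))
    (s := fun p => s.σ₁ (p.1.2.1, p.2)) (s.contDiff₁.comp (by fun_prop)) (by
      have hc : Tendsto (fun p : (ℝ × ℝ × Vec l × Vec m) × (Vec l × Vec m) =>
          ((p.1.2.1, p.2) : ℝ × Vec l × Vec m)) (𝓝 ((0, 0, z₀.2.1, z₀.2.2.1), ν₀.2)) (𝓝 ν₀) := by
        have : Continuous (fun p : (ℝ × ℝ × Vec l × Vec m) × (Vec l × Vec m) =>
          ((p.1.2.1, p.2) : ℝ × Vec l × Vec m)) := by fun_prop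
        have := this.tendsto ((0, 0, z₀.2.1, z₀.2.2.1), ν₀.2)
        rwa [hν] at this
      exact hc.eventually s.crit₁) (by
      intro u hu
      simp only [hν, s.eq₁] at hu
      rw [basePhase_of_eq_zero hν₀] at hu
      refine hnd₁ u fun v => ?_
      rw [← fderiv_fderiv_shiftedPhase h₁ t ν₀.2.1, hu]
      rfl)
  simp only [hν, s.eq₁] at key
  refine key.trans (OscEquiv.of_eventuallyEq (fun _ _ => rfl) (.of_forall fun z hz => ?_))
  have hx : z.1.1 ≠ 0 := hz.1.ne'
  have hy : z.1.2.1 ≠ 0 := hz.2.ne'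
  simp only [canonicalPhase, generatingValue, basePhase, fibrePhase, cornerMap,
    CritSections.lift, cornerPhase]
  field_simp
  ring

/-- Elimination of `(z'', w)` at scale `x''`, leaving its critical value inside `basePhase`. -/
theorem oscEquiv_reducedPhase (h₁ : ContDiff ℝ ∞ φ₁) (h₂ : ContDiff ℝ ∞ φ₂) (hz₀ : z₀.1 = 0)
    (hnd₂ : NondegenerateShift t
      (fun σ : Vec m × Vec k' => φ₂ (z₀.1, z₀.2.1, σ.1, z₀.2.2.2.1, σ.2))
      (z₀.2.2.1, z₀.2.2.2.2)) {N : ℝ × ℝ × Vec l × Vec m → ℝ} :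
    OscEquiv (cornerInterior l m)
      (fun β => N β * β.1 ^ (-(Module.finrank ℝ (Vec m × Vec k') / 2 : ℝ)))
      (reorderedPhase t φ₁ φ₂) ((0, 0, z₀.2.1, z₀.2.2.1),
        ((ν₀.2, (z₀.2.1, z₀.2.2.2.1)), (z₀.2.2.1, z₀.2.2.2.2))) N
      s.reducedPhase ((0, 0, z₀.2.1, z₀.2.2.1), (ν₀.2, (z₀.2.1, z₀.2.2.2.1))) := by
  have hh₂ : ContDiff ℝ ∞ fun β : ℝ × ℝ × Vec l × Vec m => β.1 := by fun_prop
  have hF := contDiff_fibrePhase t h₂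
  have key := OscEquiv.eliminate (Pos := cornerInterior l m) (N := N)
    (z₀ := ((0, 0, z₀.2.1, z₀.2.2.1), (ν₀.2, (z₀.2.1, z₀.2.2.2.1))))
    (Ψ := fun z : (ℝ × ℝ × Vec l × Vec m) × ((Vec l × Vec m) × (Vec l × Vec k)) =>
      (dot (z.1.2.2.1 - z.2.2.1) z.2.1.1 + t / 2 * (dot z.2.2.1 z.2.2.1 -
        dot z.1.2.2.1 z.1.2.2.1) + φ₁ z.2.2) / (z.1.2.1 * z.1.1) +
      (dot z.1.2.2.2 z.2.1.2 - t / 2 * dot z.1.2.2.2 z.1.2.2.2) / z.1.1)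
    (F := Vec m × Vec k') hh₂ (by simp) (fun β hβ => hβ.1)
    (fun β _ => (ContDiff.continuous (𝕜 := ℝ) (n := ∞)
      (by simp only [div_eq_mul_inv]; fun_prop)).measurable)
    (f := fun p => fibrePhase t φ₂ ((p.1.1.2.1, p.1.2.2, p.1.2.1.2), p.2))
    (hF.comp (by fun_prop))
    (s := fun p => s.σ₂ (p.1.2.1, p.2.2, p.2.1.2)) (s.contDiff₂.comp (by fun_prop)) (by
      have hc : Continuous (fun p : (ℝ × ℝ × Vec l × Vec m) × ((Vec l × Vec m) × (Vec l × Vec k)) =>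
          ((p.1.2.1, p.2.2, p.2.1.2) : ℝ × (Vec l × Vec k) × Vec m)) := by fun_prop
      exact (hc.tendsto
        ((0, 0, z₀.2.1, z₀.2.2.1), (ν₀.2, (z₀.2.1, z₀.2.2.2.1)))).eventually s.crit₂) (by
      intro u hu
      simp only [s.eq₂] at hu
      refine hnd₂ u fun v => ?_
      have := fderiv_fderiv_fibrePhase (t := t) h₂ (0, (z₀.2.1, z₀.2.2.2.1), ν₀.2.2)
        (z₀.2.2.1, z₀.2.2.2.2) u v
      rw [hu] at this
      rw [hz₀]
      exact this.symm)
  simp only [s.eq₂] at key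
  refine key.trans (OscEquiv.of_eventuallyEq (fun _ _ => rfl) (.of_forall fun z hz => ?_))
  have hx : z.1.1 ≠ 0 := hz.1.ne'
  have hy : z.1.2.1 ≠ 0 := hz.2.ne'
  simp only [reducedPhase, basePhase, sub_dot]
  field_simp
  ring

/-- Every nondegenerate phase is equivalent to the canonical phase of the Legendrian. -/
theorem oscEquiv (h₁ : ContDiff ℝ ∞ φ₁) (h₂ : ContDiff ℝ ∞ φ₂) (hz₀ : z₀.1 = 0)
    (hlift : IsLift t φ₁ φ₂ ν₀ z₀) (hnd₁ : NondegenerateShift t φ₁ (z₀.2.1, z₀.2.2.2.1))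
    (hnd₂ : NondegenerateShift t
      (fun σ : Vec m × Vec k' => φ₂ (z₀.1, z₀.2.1, σ.1, z₀.2.2.2.1, σ.2))
      (z₀.2.2.1, z₀.2.2.2.2)) :
    OscEquiv (cornerInterior l m) (cornerWeight (k / 2) (k' / 2))
      (fun z : (ℝ × ℝ × Vec l × Vec m) × (Vec k × Vec k') => cornerPhase φ₁ φ₂
        (z.1.2.1, z.1.2.2.1, z.1.2.2.2, z.2.1, z.2.2) / (z.1.2.1 * z.1.1))
      ((0, 0, z₀.2.1, z₀.2.2.1), (z₀.2.2.2.1, z₀.2.2.2.2))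
      (cornerWeight (l / 2) (m / 2)) (canonicalPhase t fun ν => cornerMap φ₁ φ₂ (s.lift ν))
      ((0, 0, z₀.2.1, z₀.2.2.1), ν₀.2) := by
  refine (oscEquiv_extendedPhase h₁ h₂ hz₀ hlift).symm.trans (oscEquiv_reorder.trans
    (((s.oscEquiv_reducedPhase h₁ h₂ hz₀ hnd₂).congr_left (fun β hβ => ?_)
      (.of_forall fun _ _ => rfl)).trans
      (s.oscEquiv_canonicalPhase h₁ h₂ (hlift.1.symm.trans hz₀) hnd₁)))
  -- Counting half-powers: `k/2 + l = l/2 + (l + k)/2` at scale `x`, and `k'/2 + m = m/2 + (m +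
  -- k')/2` at scale `x''`.
  rw [cornerWeight_mul hβ]
  congr 1
  · simp; ring
  · simp; ring

end CritSections

end Canonical

end OscInt

namespace OscInt

open MeasureTheory Filter FibredLegendre

/-! ### Independence of the parametrization. -/

section Param

variable {k' l m k : ℕ}

theorem cornerPhase_eventuallyEq {φ₁ Φ₁ : Vec l × Vec k → ℝ} {φ₂ Φ₂ : CornerVar l m k k' → ℝ}
    {z₀ : CornerVar l m k k'} (h₁ : Φ₁ =ᶠ[𝓝 (z₀.2.1, z₀.2.2.2.1)] φ₁) (h₂ : Φ₂ =ᶠ[𝓝 z₀] φ₂) :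
    cornerPhase Φ₁ Φ₂ =ᶠ[𝓝 z₀] cornerPhase φ₁ φ₂ := by
  have hc : Continuous fun z : CornerVar l m k k' => (z.2.1, z.2.2.2.1) := by fun_prop
  filter_upwards [(hc.tendsto z₀).eventually h₁, h₂] with z e₁ e₂
  rw [cornerPhase, cornerPhase, e₁, e₂]

theorem cornerMap_eventuallyEq {φ₁ Φ₁ : Vec l × Vec k → ℝ} {φ₂ Φ₂ : CornerVar l m k k' → ℝ}
    {z₀ : CornerVar l m k k'} (h₁ : Φ₁ =ᶠ[𝓝 (z₀.2.1, z₀.2.2.2.1)] φ₁) (h₂ : Φ₂ =ᶠ[𝓝 z₀] φ₂) :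
    cornerMap Φ₁ Φ₂ =ᶠ[𝓝 z₀] cornerMap φ₁ φ₂ := by
  have h := cornerPhase_eventuallyEq h₁ h₂
  filter_upwards [h, h.fderiv (𝕜 := ℝ), h₂.fderiv (𝕜 := ℝ)] with z e₁ e₂ e₃
  simp only [cornerMap, e₁, e₂, e₃]

theorem mem_cornerCrit_eventually {φ₁ Φ₁ : Vec l × Vec k → ℝ} {φ₂ Φ₂ : CornerVar l m k k' → ℝ}
    {z₀ : CornerVar l m k k'} (h₁ : Φ₁ =ᶠ[𝓝 (z₀.2.1, z₀.2.2.2.1)] φ₁) (h₂ : Φ₂ =ᶠ[𝓝 z₀] φ₂) :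
    ∀ᶠ z in 𝓝 z₀, z ∈ cornerCrit Φ₁ Φ₂ ↔ z ∈ cornerCrit φ₁ φ₂ := by
  have h := cornerPhase_eventuallyEq h₁ h₂
  filter_upwards [h.fderiv (𝕜 := ℝ), h₂.fderiv (𝕜 := ℝ)] with z e₂ e₃
  simp only [cornerCrit, Set.mem_ofPred_eq, e₂, e₃]

theorem contDiff_cornerMap {φ₁ : Vec l × Vec k → ℝ} {φ₂ : CornerVar l m k k' → ℝ}
    (h₁ : ContDiff ℝ ∞ φ₁) (h₂ : ContDiff ℝ ∞ φ₂) : ContDiff ℝ ∞ (cornerMap φ₁ φ₂) := by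
  have h := contDiff_cornerPhase h₁ h₂
  have hd : ∀ u, ContDiff ℝ ∞ fun z => fderiv ℝ (cornerPhase φ₁ φ₂) z u := fun u =>
    (h.fderiv_right (m := ∞) (by simp)).clm_apply contDiff_const
  have hd₂ : ∀ u, ContDiff ℝ ∞ fun z => fderiv ℝ φ₂ z u := fun u =>
    (h₂.fderiv_right (m := ∞) (by simp)).clm_apply contDiff_const
  exact (contDiff_fst.prodMk (ContDiff.prodMk (by fun_prop) (by fun_prop))).prodMk
    (h.neg.prodMk ((hd _).prodMk ((contDiff_pi.2 fun j => hd _).prodMk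
      (contDiff_pi.2 fun j => hd₂ _))))

variable {G : Set (CornerPhase l m)} {c : CornerPhase l m}

/-- Only germs of the phases matter, so globally smooth representatives may be used. -/
theorem exists_contDiff_phases (φ : CornerParam G c k k') :
    ∃ (Φ₁ : Vec l × Vec k → ℝ) (Φ₂ : CornerVar l m k k' → ℝ), ContDiff ℝ ∞ Φ₁ ∧ ContDiff ℝ ∞ Φ₂ ∧
      Φ₁ =ᶠ[𝓝 (φ.pt.2.1, φ.pt.2.2.2.1)] φ.φ₁ ∧ Φ₂ =ᶠ[𝓝 φ.pt] φ.φ₂ := by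
  obtain ⟨Φ₂, h₂, e₂⟩ := exists_contDiff_eventuallyEq (f := φ.φ₂) (p₀ := φ.pt) (by
    filter_upwards [φ.isOpen_dom.mem_nhds φ.pt_mem] with z hz
    exact φ.smooth₂.contDiffAt (φ.isOpen_dom.mem_nhds hz))
  let U : Set (Vec l × Vec k) := (fun p => (φ.pt.1, p.1, φ.pt.2.2.1, p.2, φ.pt.2.2.2.2)) ⁻¹' φ.dom
  have hU : IsOpen U := φ.isOpen_dom.preimage (by fun_prop)
  have hUs : U ⊆ (fun z : CornerVar l m k k' => (z.2.1, z.2.2.2.1)) '' φ.dom :=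
    fun p hp => ⟨_, hp, rfl⟩
  obtain ⟨Φ₁, h₁, e₁⟩ := exists_contDiff_eventuallyEq (f := φ.φ₁)
    (p₀ := (φ.pt.2.1, φ.pt.2.2.2.1)) (by
      filter_upwards [hU.mem_nhds (show (φ.pt.2.1, φ.pt.2.2.2.1) ∈ U from φ.pt_mem)] with p hp
      exact (φ.smooth₁.mono hUs).contDiffAt (hU.mem_nhds hp))
  exact ⟨Φ₁, Φ₂, h₁, h₂, e₁, e₂⟩

/-- Oscillatory integrals with a nondegenerate phase are oscillatory integrals with the canonical
phase of the Legendrian, for all but finitely many parameters `t`. -/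
theorem exists_canonicalPhase (φ : CornerParam G c k k') :
    ∃ T : Set ℝ, T.Finite ∧ ∀ t ∉ T, ∃ Γ : ℝ × Vec l × Vec m → CornerPhase l m,
      ContDiff ℝ ∞ Γ ∧ Γ (momentum t c) = c ∧
      (∀ᶠ ν in 𝓝 (momentum t c), momentum t (Γ ν) = ν) ∧
      (∀ᶠ ν in 𝓝 (momentum t c), 0 ≤ ν.1 → Γ ν ∈ G) ∧
      OscEquiv (cornerInterior l m) (cornerWeight (k / 2) (k' / 2))
        (fun z : (ℝ × ℝ × Vec l × Vec m) × (Vec k × Vec k') => cornerPhase φ.φ₁ φ.φ₂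
          (z.1.2.1, z.1.2.2.1, z.1.2.2.2, z.2.1, z.2.2) / (z.1.2.1 * z.1.1))
        ((0, 0, c.1.2.1, c.1.2.2), (φ.pt.2.2.2.1, φ.pt.2.2.2.2))
        (cornerWeight (l / 2) (m / 2)) (canonicalPhase t Γ)
        ((0, 0, c.1.2.1, c.1.2.2), (momentum t c).2) := by
  obtain ⟨Φ₁, Φ₂, h₁, h₂, e₁, e₂⟩ := exists_contDiff_phases φ
  have hmap := cornerMap_eventuallyEq e₁ e₂
  have hcrit := mem_cornerCrit_eventually e₁ e₂
  have hc : cornerMap Φ₁ Φ₂ φ.pt = c := hmap.self_of_nhds.trans φ.pt_eq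
  have hc' : c.1.2 = (φ.pt.2.1, φ.pt.2.2.1) :=
    (congrArg (fun c : CornerPhase l m => c.1.2) hc).symm
  have hslice : ∀ j : Fin k', (fun z : Vec m × Vec k' => fderiv ℝ (fun σ : Vec m × Vec k' =>
      Φ₂ (φ.pt.1, φ.pt.2.1, σ.1, φ.pt.2.2.2.1, σ.2)) z (0, Pi.single j 1)) =ᶠ[
        𝓝 (φ.pt.2.2.1, φ.pt.2.2.2.2)] fun z : Vec m × Vec k' =>
      fderiv ℝ φ.φ₂ (φ.pt.1, φ.pt.2.1, z.1, φ.pt.2.2.2.1, z.2) (0, 0, 0, 0, Pi.single j 1) := by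
    intro j
    have hcont : Continuous fun z : Vec m × Vec k' =>
      ((φ.pt.1, φ.pt.2.1, z.1, φ.pt.2.2.2.1, z.2) : CornerVar l m k k') := by fun_prop
    filter_upwards [(hcont.tendsto (φ.pt.2.2.1, φ.pt.2.2.2.2)).eventually
      (e₂.fderiv (𝕜 := ℝ))] with z hz
    rw [fderiv_fibreSlice h₂, hz]
  have hT₁ := finite_degenerate_hessian (z₀ := (φ.pt.2.1, φ.pt.2.2.2.1)) h₁ (by
    convert φ.nondegenerate₁ using 2 with j
    refine Filter.EventuallyEq.fderiv_eq ?_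
    filter_upwards [e₁.fderiv (𝕜 := ℝ)] with z hz
    rw [hz])
  have hT₂ := finite_degenerate_hessian (z₀ := (φ.pt.2.2.1, φ.pt.2.2.2.2))
    (g := fun σ : Vec m × Vec k' => Φ₂ (φ.pt.1, φ.pt.2.1, σ.1, φ.pt.2.2.2.1, σ.2))
    (h₂.comp (by fun_prop)) (by
      convert φ.nondegenerate₂ using 2 with j
      exact (hslice j).fderiv_eq)
  refine ⟨_, hT₁.union hT₂, fun t ht => ?_⟩
  rw [Set.mem_union, not_or] at ht
  have hnd₁ : NondegenerateShift t Φ₁ (φ.pt.2.1, φ.pt.2.2.2.1) := fun u hu => by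
    by_contra h0
    exact ht.1 ⟨u, h0, hu⟩
  have hnd₂ : NondegenerateShift t (fun σ : Vec m × Vec k' =>
      Φ₂ (φ.pt.1, φ.pt.2.1, σ.1, φ.pt.2.2.2.1, σ.2)) (φ.pt.2.2.1, φ.pt.2.2.2.2) := fun u hu => by
    by_contra h0
    exact ht.2 ⟨u, h0, hu⟩
  have hlift : IsLift t Φ₁ Φ₂ (momentum t c) φ.pt := by
    have := IsLift.of_crit (t := t) (hcrit.self_of_nhds.2 φ.crit_pt)
    rwa [hc] at this
  have hν₀ : (momentum t c).1 = 0 := hlift.1.symm.trans φ.pt_zero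
  obtain ⟨s⟩ := exists_critSections h₁ h₂ φ.pt_zero hlift hnd₁ hnd₂
  have hs0 := s.lift_eq hν₀ φ.pt_zero
  have hst : Tendsto s.lift (𝓝 (momentum t c)) (𝓝 φ.pt) := by
    have := s.contDiff_lift.continuous.tendsto (momentum t c)
    rwa [hs0] at this
  have hΓ : ContDiff ℝ ∞ fun ν => cornerMap Φ₁ Φ₂ (s.lift ν) :=
    (contDiff_cornerMap h₁ h₂).comp s.contDiff_lift
  have hΓ0 : cornerMap Φ₁ Φ₂ (s.lift (momentum t c)) = c := by rw [hs0, hc]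
  have hlifts := s.isLift h₁ h₂ hν₀
  obtain ⟨W, hW, hcW, hGW⟩ := φ.parametrizes
  refine ⟨_, hΓ, hΓ0, hlifts.mono fun ν hν => hν.momentum_eq, ?_, ?_⟩
  -- `Γ` is smooth on both sides of `x̃ = 0`, but the parametrization places it in the Legendrian
  -- only for `x̃ ≥ 0`.
  · have hW' : ∀ᶠ ν in 𝓝 (momentum t c), cornerMap Φ₁ Φ₂ (s.lift ν) ∈ W :=
      hΓ.continuous.continuousAt.eventually_mem (hW.mem_nhds (by rw [hΓ0]; exact hcW))
    filter_upwards [hlifts, hst.eventually hmap, hst.eventually hcrit, hW',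
      hst.eventually (φ.isOpen_dom.mem_nhds φ.pt_mem)] with ν a1 a2 a3 a4 a5 hν
    have : cornerMap Φ₁ Φ₂ (s.lift ν) ∈ G ∩ W := by
      rw [hGW]
      refine ⟨⟨s.lift ν, ⟨a5, a3.1 (a1.mem_cornerCrit hν)⟩, a2.symm⟩, a4⟩
    exact this.1
  · have key := s.oscEquiv h₁ h₂ φ.pt_zero hlift hnd₁ hnd₂
    rw [hc']
    refine key.congr_left (fun _ _ => rfl) ?_
    have hcont : Continuous fun z : (ℝ × ℝ × Vec l × Vec m) × (Vec k × Vec k') =>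
      ((z.1.2.1, z.1.2.2.1, z.1.2.2.2, z.2.1, z.2.2) : CornerVar l m k k') := by fun_prop
    have hz : ((0, φ.pt.2.1, φ.pt.2.2.1, φ.pt.2.2.2.1, φ.pt.2.2.2.2) : CornerVar l m k k') =
      φ.pt := by rw [← φ.pt_zero]
    have ht := hcont.tendsto ((0, 0, φ.pt.2.1, φ.pt.2.2.1), (φ.pt.2.2.2.1, φ.pt.2.2.2.2))
    simp only [hz] at ht
    filter_upwards [ht.eventually (cornerPhase_eventuallyEq e₁ e₂)] with z hz _
    rw [hz]

/-- Two nondegenerate parametrizations of a Legendrian define the same oscillatory integrals. -/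
theorem oscEquiv_of_cornerParam {kt kt' : ℕ} (hG : IsLegendreCorner G) (φ : CornerParam G c k k')
    (ψ : CornerParam G c kt kt') :
    OscEquiv (cornerInterior l m) (cornerWeight (k / 2) (k' / 2))
      (fun z : (ℝ × ℝ × Vec l × Vec m) × (Vec k × Vec k') => cornerPhase φ.φ₁ φ.φ₂
        (z.1.2.1, z.1.2.2.1, z.1.2.2.2, z.2.1, z.2.2) / (z.1.2.1 * z.1.1))
      ((0, 0, c.1.2.1, c.1.2.2), (φ.pt.2.2.2.1, φ.pt.2.2.2.2))
      (cornerWeight (kt / 2) (kt' / 2))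
      (fun z : (ℝ × ℝ × Vec l × Vec m) × (Vec kt × Vec kt') => cornerPhase ψ.φ₁ ψ.φ₂
        (z.1.2.1, z.1.2.2.1, z.1.2.2.2, z.2.1, z.2.2) / (z.1.2.1 * z.1.1))
      ((0, 0, c.1.2.1, c.1.2.2), (ψ.pt.2.2.2.1, ψ.pt.2.2.2.2)) := by
  obtain ⟨T, hT, Hφ⟩ := exists_canonicalPhase φ
  obtain ⟨T', hT', Hψ⟩ := exists_canonicalPhase ψ
  -- One `t` outside both finite exceptional sets, so that both phases reduce to canonical phases in
  -- the same variables.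
  obtain ⟨t, ht⟩ := (hT.union hT').exists_notMem
  rw [Set.mem_union, not_or] at ht
  obtain ⟨Γ, hΓ, hΓ0, hpr, hΓG, key⟩ := Hφ t ht.1
  obtain ⟨Γ', hΓ', hΓ0', hpr', hΓG', key'⟩ := Hψ t ht.2
  have hc1 : c.1.1 = 0 := by rw [← φ.pt_eq]; exact φ.pt_zero
  have hcG : c ∈ G := by
    have := hΓG.self_of_nhds (by rw [momentum_apply]; exact hc1.ge)
    rwa [hΓ0] at this
  obtain ⟨W, F, hW, hcW, hF, hGW, hFd⟩ := hG c hcG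
  have hFG : ∀ {Γ : ℝ × Vec l × Vec m → CornerPhase l m}, ContDiff ℝ ∞ Γ → Γ (momentum t c) = c →
      (∀ᶠ ν in 𝓝 (momentum t c), 0 ≤ ν.1 → Γ ν ∈ G) →
      ∀ᶠ ν in 𝓝[{ν | 0 ≤ ν.1}] (momentum t c), F (Γ ν) = 0 := by
    intro Γ hΓ hΓ0 hΓG
    have hW' : ∀ᶠ ν in 𝓝 (momentum t c), Γ ν ∈ W :=
      hΓ.continuous.continuousAt.eventually_mem (hW.mem_nhds (by rw [hΓ0]; exact hcW))
    filter_upwards [nhdsWithin_le_nhds hΓG, nhdsWithin_le_nhds hW', self_mem_nhdsWithin]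
      with ν a1 a2 a3
    have : Γ ν ∈ G ∩ W := ⟨a1 a3, a2⟩
    rw [hGW] at this
    exact this.2.2
  have hs : UniqueDiffWithinAt ℝ {ν : ℝ × Vec l × Vec m | 0 ≤ ν.1} (momentum t c) := by
    have h1 : {ν : ℝ × Vec l × Vec m | 0 ≤ ν.1} = Set.Ici (0 : ℝ) ×ˢ Set.univ := by
      ext ν; simp
    rw [h1]
    refine UniqueDiffWithinAt.prod (x := (momentum t c).1) (y := (momentum t c).2) ?_
      uniqueDiffWithinAt_univ
    exact uniqueDiffOn_Ici 0 _ (by rw [momentum_apply]; exact hc1.ge)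
  -- Both `Γ` and `Γ'` are sections of `momentum t` with values in the zero set of `F` for `x̃ ≥ 0`.
  -- The dimensions match: `2l + 2m + 3 = (l + m + 2) + (l + m + 1)`.
  have heq := eventually_eq_of_sections (F := F) (c := c) (by
      filter_upwards [hW.mem_nhds hcW] with z hz
      exact hF.contDiffAt (hW.mem_nhds hz)) (hFd c ⟨hcG, hcW⟩).1 (momentum t)
    (by simp; ring) hs (by rw [momentum_apply]; exact hc1.ge)
    (hΓ.differentiable (by simp)).differentiableAt hΓ'.continuous.continuousAt hΓ0 hΓ0'
    (hFG hΓ hΓ0 hΓG) (hFG hΓ' hΓ0' hΓG') hpr hpr'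
  refine key.trans (OscEquiv.trans (OscEquiv.of_eventuallyEq (fun _ _ => rfl) ?_) key'.symm)
  rw [eventually_nhdsWithin_iff] at heq
  have hcont : Continuous fun z : (ℝ × ℝ × Vec l × Vec m) × (Vec l × Vec m) =>
    ((z.1.2.1, z.2) : ℝ × Vec l × Vec m) := by fun_prop
  have ht := hcont.tendsto ((0, 0, c.1.2.1, c.1.2.2), (momentum t c).2)
  have hν : ((0, (momentum t c).2) : ℝ × Vec l × Vec m) = momentum t c :=
    Prod.ext hc1.symm rfl
  simp only [hν] at ht
  filter_upwards [ht.eventually heq] with z hz hp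
  have hz' := hz hp.2.le
  simp only [canonicalPhase, hz']

end Param

end OscInt

namespace OscInt

open MeasureTheory Filter FibredLegendre

/-! ### Powers of the boundary defining functions; the corner case in coordinates. -/

section Reparametrize

variable {l m k k' kt kt' : ℕ}

theorem tsupport_comp_subset {X Y : Type} [TopologicalSpace X] [TopologicalSpace Y] {f : Y → ℂ}
    {g : X → Y} (hg : Continuous g) : tsupport (fun x => f (g x)) ⊆ g ⁻¹' tsupport f :=
  closure_minimal (fun _ hx => subset_tsupport f hx) ((isClosed_tsupport f).preimage hg)

/-- Substituting `x'' = x/x̃` turns the natural weights at the two scales into powers of `x` and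
`x̃`. -/
theorem cornerWeight_eq {p p' : ℝ} {β : ℝ × ℝ × Vec l × Vec m} (hβ : β ∈ cornerInterior l m) :
    cornerWeight p p' β = (β.2.1 * β.1) ^ (-(p + p')) * β.2.1 ^ p' := by
  have h1 := hβ.1
  have h2 := hβ.2
  rw [cornerWeight, neg_add, Real.rpow_add (mul_pos h2 h1), Real.mul_rpow (z := -p') h2.le h1.le,
    Real.rpow_neg h2.le]
  have : β.2.1 ^ p' ≠ 0 := (Real.rpow_pos_of_pos h2 _).ne'
  field_simp

theorem cornerWeight_mul_eq {q r p p' : ℝ} {β : ℝ × ℝ × Vec l × Vec m}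
    (hβ : β ∈ cornerInterior l m) : (β.2.1 * β.1) ^ q * β.2.1 ^ r * cornerWeight p p' β =
      (β.2.1 * β.1) ^ (q - (p + p')) * β.2.1 ^ (r + p') := by
  rw [cornerWeight_eq hβ, sub_eq_add_neg, Real.rpow_add (mul_pos hβ.2 hβ.1), Real.rpow_add hβ.2]
  ring

/-- The change of parametrization, in coordinates. -/
theorem cornerOsc_reparametrize {G : Set (CornerPhase l m)} {c : CornerPhase l m}
    (hG : IsLegendreCorner G) (φ : CornerParam G c k k') (ψ : CornerParam G c kt kt')
    {V : Set (ℝ × ℝ × Vec l × Vec m)} (hV : IsOpen V) (hcV : (0, c.1) ∈ V) :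
    ∃ O : Set (ℝ × CornerVar l m k k'), IsOpen O ∧ (0, φ.pt) ∈ O ∧
      ∀ (q r : ℝ) (a : ℝ × CornerVar l m k k' → ℂ),
        ContDiff ℝ ∞ a → HasCompactSupport a → tsupport a ⊆ O →
        ∃ b : ℝ × CornerVar l m kt kt' → ℂ, ContDiff ℝ ∞ b ∧ HasCompactSupport b ∧
          (∀ z ∈ tsupport b, z.2 ∈ ψ.dom ∧ (z.1, z.2.1, z.2.2.1, z.2.2.2.1) ∈ V) ∧
          ∀ β ∈ cornerInterior l m, cornerOsc φ.φ₁ φ.φ₂ a q r β = cornerOsc ψ.φ₁ ψ.φ₂ b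
            (q + ((k + k' : ℝ) - (kt + kt')) / 2) (r - ((k' : ℝ) - kt') / 2) β := by
  have hpt : ∀ {k k' : ℕ} (φ : CornerParam G c k k'),
      ((0, c.1.2.1, c.1.2.2, φ.pt.2.2.2.1, φ.pt.2.2.2.2) : CornerVar l m k k') = φ.pt := by
    intro k k' φ
    have h1 : (φ.pt.2.1, φ.pt.2.2.1) = c.1.2 :=
      congrArg (fun c : CornerPhase l m => c.1.2) φ.pt_eq
    rw [← h1, ← φ.pt_zero]
  have hc1 : c.1.1 = 0 := by rw [← φ.pt_eq]; exact φ.pt_zero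
  let f : ∀ k k' : ℕ, (ℝ × ℝ × Vec l × Vec m) × (Vec k × Vec k') → ℝ × CornerVar l m k k' :=
    fun k k' z => (z.1.1, z.1.2.1, z.1.2.2.1, z.1.2.2.2, z.2.1, z.2.2)
  let g : ∀ k k' : ℕ, ℝ × CornerVar l m k k' → (ℝ × ℝ × Vec l × Vec m) × (Vec k × Vec k') :=
    fun k k' z => ((z.1, z.2.1, z.2.2.1, z.2.2.2.1), (z.2.2.2.2.1, z.2.2.2.2.2))
  have hf : ∀ k k', ContDiff ℝ ∞ (f k k') := fun k k' => by fun_prop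
  have hg : ∀ k k', ContDiff ℝ ∞ (g k k') := fun k k' => by fun_prop
  have hfc : ∀ k k', Topology.IsClosedEmbedding (f k k') := fun k k' =>
    Function.LeftInverse.isClosedEmbedding (f := g k k') (fun _ => rfl) (hg k k').continuous
      (hf k k').continuous
  have hgc : ∀ k k', Topology.IsClosedEmbedding (g k k') := fun k k' =>
    Function.LeftInverse.isClosedEmbedding (f := f k k') (fun _ => rfl) (hf k k').continuous
      (hg k k').continuous
  have hf0 : ∀ {k k' : ℕ} (φ : CornerParam G c k k'),
      f k k' ((0, 0, c.1.2.1, c.1.2.2), (φ.pt.2.2.2.1, φ.pt.2.2.2.2)) = (0, φ.pt) :=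
    fun φ => Prod.ext rfl (hpt φ)
  obtain ⟨U, hU, H⟩ := (oscEquiv_of_cornerParam hG φ ψ).1
    (f kt kt' ⁻¹' {z | z.2 ∈ ψ.dom ∧ (z.1, z.2.1, z.2.2.1, z.2.2.2.1) ∈ V}) (by
      have ho : IsOpen {z : ℝ × CornerVar l m kt kt' |
          z.2 ∈ ψ.dom ∧ (z.1, z.2.1, z.2.2.1, z.2.2.2.1) ∈ V} :=
        (ψ.isOpen_dom.preimage continuous_snd).inter (hV.preimage (by fun_prop))
      refine (ho.preimage (hf kt kt').continuous).mem_nhds ?_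
      rw [Set.mem_preimage, hf0 ψ]
      refine ⟨ψ.pt_mem, ?_⟩
      have := hpt ψ
      rw [← this]
      convert hcV using 1
      exact Prod.ext rfl (Prod.ext hc1.symm rfl))
  obtain ⟨U₀, hU₀, hU₀o, hmem⟩ := mem_nhds_iff.1 hU
  refine ⟨g k k' ⁻¹' U₀, hU₀o.preimage (hg k k').continuous, ?_, fun q r a ha hac has => ?_⟩
  · rw [Set.mem_preimage, ← hf0 φ]
    exact hmem
  obtain ⟨b, hb, hbc, hbs, hab⟩ := H (fun z => a (f k k' z)) (ha.comp (hf k k'))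
    (hac.comp_isClosedEmbedding (hfc k k'))
    ((tsupport_comp_subset (hf k k').continuous).trans fun z hz => hU₀ (has hz))
  refine ⟨fun z => b (g kt kt' z), hb.comp (hg kt kt'), hbc.comp_isClosedEmbedding (hgc kt kt'),
    fun z hz => hbs (tsupport_comp_subset (hg kt kt').continuous hz), fun β hβ => ?_⟩
  -- This factor cancels the weight `x^(-k/2) (x'')^(-k'/2)` of `φ` up to `x^q x̃^r`; with the
  -- weight of `ψ` it leaves the shifted exponents.
  have e := congrArg (fun y : ℂ =>
    (((β.2.1 * β.1) ^ (q + (k + k') / 2) * β.2.1 ^ (r - k' / 2) : ℝ) : ℂ) * y) (hab β hβ)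
  simp only [← mul_assoc, ← Complex.ofReal_mul] at e
  rw [cornerWeight_mul_eq hβ, cornerWeight_mul_eq hβ] at e
  have e1 : q + ((k : ℝ) + k') / 2 - (k / 2 + k' / 2) = q := by ring
  have e2 : r - (k' : ℝ) / 2 + k' / 2 = r := by ring
  have e3 : q + ((k : ℝ) + k') / 2 - (kt / 2 + kt' / 2) = q + ((k + k' : ℝ) - (kt + kt')) / 2 := by
    ring
  have e4 : r - (k' : ℝ) / 2 + kt' / 2 = r - ((k' : ℝ) - kt') / 2 := by ring
  rw [e1, e2, e3, e4] at e
  exact e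

end Reparametrize

/-! ### The interior case, as a product with a half line. -/

section Interior

variable {n k kt : ℕ} {G : Set (JetSpace n)} {c : JetSpace n}

/-- The product of a Legendrian with a half line. -/
def productLegendrian (G : Set (JetSpace n)) : Set (CornerPhase n 0) :=
  {c | 0 ≤ c.1.1 ∧ toBase c ∈ G ∧ c.2.2.1 = 0}

/-- The projection to the base, as a linear map. -/
noncomputable def toBaseL (n : ℕ) : CornerPhase n 0 →L[ℝ] JetSpace n :=
  LinearMap.toContinuousLinearMap
    { toFun := toBase
      map_add' := fun _ _ => rfl
      map_smul' := fun _ _ => rfl }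

/-- The defining functions are those of `G` together with `η`. On `η = 0`, with no `y''` variables,
the corner contact form is `dτ + μ · dy`. -/
theorem isLegendreCorner_productLegendrian (hG : IsLegendreJet G) :
    IsLegendreCorner (productLegendrian G) := by
  intro g hg
  obtain ⟨W, F, hW, hgW, hF, hGW, hFd⟩ := hG (toBase g) hg.2.1
  let A : (ℝ × Vec (n + 1)) ≃L[ℝ] Vec (n + 0 + 2) :=
    ContinuousLinearEquiv.ofFinrankEq (by simp; ring)
  let F' : CornerPhase n 0 → Vec (n + 0 + 2) := fun z => A (z.2.2.1, F (toBaseL n z))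
  have hmem : productLegendrian G ∩ toBaseL n ⁻¹' W =
      {z ∈ toBaseL n ⁻¹' W | 0 ≤ z.1.1 ∧ F' z = 0} := by
    ext z
    have h1 : toBase z ∈ G ∩ W ↔ toBase z ∈ W ∧ F (toBase z) = 0 := by rw [hGW]; rfl
    have h2 : F' z = 0 ↔ z.2.2.1 = 0 ∧ F (toBase z) = 0 := by
      simp only [F', map_eq_zero_iff A A.injective, Prod.mk_eq_zero]; rfl
    constructor
    · rintro ⟨⟨a1, a2, a3⟩, a4⟩
      exact ⟨a4, a1, h2.2 ⟨a3, (h1.1 ⟨a2, a4⟩).2⟩⟩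
    · rintro ⟨a4, a1, a2⟩
      exact ⟨⟨a1, (h1.2 ⟨a4, (h2.1 a2).2⟩).1, (h2.1 a2).1⟩, a4⟩
  have hpre := hW.preimage (toBaseL n).continuous
  have hη : ContDiff ℝ ∞ fun z : CornerPhase n 0 => z.2.2.1 := by fun_prop
  refine ⟨toBaseL n ⁻¹' W, F', hpre, hgW, A.contDiff.comp_contDiffOn (hη.contDiffOn.prodMk
    (hF.comp (toBaseL n).contDiff.contDiffOn fun _ hz => hz)), hmem, fun z hz => ?_⟩
  have hzG : toBase z ∈ G ∩ W := ⟨hz.1.2.1, hz.2⟩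
  have hd : ∀ v, fderiv ℝ F' z v = A (v.2.2.1, fderiv ℝ F (toBase z) (toBase v)) := by
    intro v
    have e1 : HasFDerivAt F (fderiv ℝ F (toBaseL n z)) (toBaseL n z) :=
      ((hF.contDiffAt (hW.mem_nhds hz.2)).differentiableAt (by simp)).hasFDerivAt
    have e2 := A.hasFDerivAt.comp z (((hasFDerivAt_snd (𝕜 := ℝ) (p := z)).snd.fst).prodMk
      (e1.comp z (toBaseL n).hasFDerivAt))
    have e3 : fderiv ℝ F' z = _ := e2.fderiv
    rw [e3]; rfl
  obtain ⟨hs, ht⟩ := hFd _ hzG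
  -- The defining functions do not involve `x̃`, so vectors tangent to `x̃ = 0` suffice; this is the
  -- transversality.
  have hs' : ∀ c, ∃ v : CornerPhase n 0, v.1.1 = 0 ∧ fderiv ℝ F' z v = c := by
    intro c
    obtain ⟨u, hu⟩ := hs (A.symm c).2
    refine ⟨((0, u.1, 0), (u.2.1, (A.symm c).1, u.2.2, 0)), rfl, ?_⟩
    rw [hd]
    change A ((A.symm c).1, fderiv ℝ F (toBase z) u) = c
    rw [hu]
    exact A.apply_symm_apply c
  refine ⟨fun c => ?_, fun _ => hs', fun v hv => ?_⟩
  · obtain ⟨v, -, hv⟩ := hs' c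
    exact ⟨v, hv⟩
  · rw [hd, map_eq_zero_iff A A.injective, Prod.mk_eq_zero] at hv
    have h1 := ht _ hv.2
    have h2 : z.2.2.1 = 0 := hz.1.2.2
    rw [h2]
    simp only [zero_mul, add_zero, Finset.univ_eq_empty, Finset.sum_empty, mul_zero]
    exact h1

theorem cornerPhase_zero (φ : Vec n × Vec k → ℝ) :
    cornerPhase φ (fun _ : CornerVar n 0 k 0 => 0) = fun z => φ (z.2.1, z.2.2.2.1) := by
  funext z; simp [cornerPhase]

theorem fderiv_cornerPhase_zero {φ : Vec n × Vec k → ℝ} {z : CornerVar n 0 k 0}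
    (h : DifferentiableAt ℝ φ (z.2.1, z.2.2.2.1)) (u : CornerVar n 0 k 0) :
    fderiv ℝ (cornerPhase φ fun _ : CornerVar n 0 k 0 => 0) z u =
      fderiv ℝ φ (z.2.1, z.2.2.2.1) (u.2.1, u.2.2.2.1) := by
  rw [cornerPhase_zero]
  have hs := hasFDerivAt_snd (𝕜 := ℝ) (p := z)
  have e : fderiv ℝ (fun z : CornerVar n 0 k 0 => φ (z.2.1, z.2.2.2.1)) z = _ :=
    (HasFDerivAt.comp (g := φ) z h.hasFDerivAt (hs.fst.prodMk hs.snd.snd.fst)).fderiv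
  rw [e]; rfl

theorem cornerMap_zero {φ : Vec n × Vec k → ℝ} {z : CornerVar n 0 k 0}
    (h : DifferentiableAt ℝ φ (z.2.1, z.2.2.2.1)) :
    cornerMap φ (fun _ : CornerVar n 0 k 0 => 0) z = ((z.1, z.2.1, 0),
      (-φ (z.2.1, z.2.2.2.1), 0,
        (fun j => fderiv ℝ φ (z.2.1, z.2.2.2.1) (Pi.single j 1, 0)), 0)) := by
  simp only [cornerMap, fderiv_cornerPhase_zero h]
  refine Prod.ext (Prod.ext rfl (Prod.ext rfl (Subsingleton.elim _ _)))
    (Prod.ext ?_ (Prod.ext ?_ (Prod.ext rfl (Subsingleton.elim _ _))))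
  · simp [cornerPhase]
  · exact map_zero (fderiv ℝ φ (z.2.1, z.2.2.2.1))

theorem mem_cornerCrit_zero {φ : Vec n × Vec k → ℝ} {z : CornerVar n 0 k 0}
    (h : DifferentiableAt ℝ φ (z.2.1, z.2.2.2.1)) :
    z ∈ cornerCrit φ (fun _ : CornerVar n 0 k 0 => 0) ↔
      0 ≤ z.1 ∧ ∀ j, fderiv ℝ φ (z.2.1, z.2.2.2.1) (0, Pi.single j 1) = 0 := by
  simp [cornerCrit, fderiv_cornerPhase_zero h]

/-- A parametrization over the interior of the main face, regarded as one of the product. -/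
noncomputable def productParam (φ : MfParam G c k) : CornerParam (productLegendrian G)
    ((0, c.1, 0), (c.2.1, 0, c.2.2, 0)) k 0 where
  φ₁ := φ.φ
  φ₂ := fun _ => 0
  dom := {z | (z.2.1, z.2.2.2.1) ∈ φ.dom}
  pt := (0, φ.pt.1, 0, φ.pt.2, 0)
  isOpen_dom := φ.isOpen_dom.preimage (by fun_prop)
  pt_mem := φ.pt_mem
  pt_zero := rfl
  smooth₁ := φ.smooth.mono (by rintro _ ⟨z, hz, rfl⟩; exact hz)
  smooth₂ := contDiffOn_const
  crit_pt := by
    have h := (φ.smooth.contDiffAt (φ.isOpen_dom.mem_nhds φ.pt_mem)).differentiableAt (by simp)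
    exact (mem_cornerCrit_zero (z := (0, φ.pt.1, 0, φ.pt.2, 0)) h).2 ⟨le_rfl, φ.crit_pt⟩
  pt_eq := by
    have h := (φ.smooth.contDiffAt (φ.isOpen_dom.mem_nhds φ.pt_mem)).differentiableAt (by simp)
    rw [cornerMap_zero (z := (0, φ.pt.1, 0, φ.pt.2, 0)) h]
    have h1 := φ.pt_eq
    have e1 := congrArg (fun c : JetSpace n => c.1) h1
    have e2 := congrArg (fun c : JetSpace n => c.2.1) h1
    have e3 := congrArg (fun c : JetSpace n => c.2.2) h1
    exact Prod.ext (Prod.ext rfl (Prod.ext e1 rfl))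
      (Prod.ext e2 (Prod.ext rfl (Prod.ext e3 rfl)))
  nondegenerate₁ := φ.nondegenerate
  nondegenerate₂ := linearIndependent_empty_type
  parametrizes := by
    obtain ⟨W, hW, hcW, hGW⟩ := φ.parametrizes
    have hd : ∀ p ∈ φ.dom, DifferentiableAt ℝ φ.φ p := fun p hp =>
      (φ.smooth.contDiffAt (φ.isOpen_dom.mem_nhds hp)).differentiableAt (by simp)
    refine ⟨toBaseL n ⁻¹' W, hW.preimage (toBaseL n).continuous, hcW, ?_⟩
    ext g
    constructor
    · rintro ⟨⟨a1, a2, a3⟩, a4⟩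
      have h1 : toBase g ∈ G ∩ W := ⟨a2, a4⟩
      rw [hGW] at h1
      obtain ⟨⟨p, ⟨hp, hc⟩, hpg⟩, -⟩ := h1
      refine ⟨⟨(g.1.1, p.1, 0, p.2, 0), ⟨hp, ?_⟩, ?_⟩, a4⟩
      · exact (mem_cornerCrit_zero (z := (g.1.1, p.1, 0, p.2, 0)) (hd p hp)).2 ⟨a1, hc⟩
      · rw [cornerMap_zero (z := (g.1.1, p.1, 0, p.2, 0)) (hd p hp)]
        have e1 := congrArg (fun c : JetSpace n => c.1) hpg
        have e2 := congrArg (fun c : JetSpace n => c.2.1) hpg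
        have e3 := congrArg (fun c : JetSpace n => c.2.2) hpg
        exact Prod.ext (Prod.ext rfl (Prod.ext e1 (Subsingleton.elim _ _)))
          (Prod.ext e2 (Prod.ext a3.symm (Prod.ext e3 (Subsingleton.elim _ _))))
    · rintro ⟨⟨z, ⟨hz, hc⟩, rfl⟩, a4⟩
      have hc' := (mem_cornerCrit_zero (hd _ hz)).1 hc
      have hm := cornerMap_zero (hd _ hz)
      refine ⟨?_, a4⟩
      have h1 : toBase (cornerMap φ.φ (fun _ : CornerVar n 0 k 0 => 0) z) ∈ G ∩ W := by
        rw [hGW]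
        refine ⟨⟨(z.2.1, z.2.2.2.1), ⟨hz, hc'.2⟩, ?_⟩, a4⟩
        rw [hm]; rfl
      refine ⟨hc'.1, h1.1, ?_⟩
      rw [hm]

theorem integral_prod_vec_zero (f : Vec k × Vec 0 → ℂ) :
    ∫ t, f t = ∫ v, f (v, 0) := by
  rw [Measure.volume_eq_prod, Measure.volume_pi_eq_dirac (0 : Vec 0), Measure.prod_dirac]
  have : MeasurableEmbedding fun v : Vec k => ((v, 0) : Vec k × Vec 0) :=
    (Function.LeftInverse.isClosedEmbedding (f := Prod.fst) (fun _ => rfl) continuous_fst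
      (by fun_prop)).measurableEmbedding
  exact this.integral_map f

/-- On the slice `x̃ = ε` the coordinate `x''` is `x/ε`, so the total boundary defining function is
still `x`. -/
theorem cornerOsc_zero {φ : Vec n × Vec k → ℝ} {a : ℝ × CornerVar n 0 k 0 → ℂ} {q ε : ℝ}
    (hε : 0 < ε) (b : ℝ × Vec n) :
    cornerOsc φ (fun _ : CornerVar n 0 k 0 => 0) a q 0 (b.1 / ε, ε, b.2, 0) =
      mfOsc φ (fun z => a (z.1 / ε, ε, z.2.1, 0, z.2.2, 0)) q b := by
  have h : ε * (b.1 / ε) = b.1 := by field_simp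
  simp only [cornerOsc, mfOsc, h, cornerPhase_zero, Real.rpow_zero, mul_one]
  rw [integral_prod_vec_zero]

end Interior

end OscInt

namespace OscInt

open MeasureTheory Filter FibredLegendre

section Interior

variable {n k kt : ℕ} {G : Set (JetSpace n)} {c : JetSpace n}

/-- The change of parametrization over the interior of the main face, in coordinates. -/
theorem mfOsc_reparametrize (hG : IsLegendreJet G) (φ : MfParam G c k) (ψ : MfParam G c kt)
    {V : Set (ℝ × Vec n)} (hV : IsOpen V) (hcV : (0, c.1) ∈ V) :
    ∃ O : Set (ℝ × Vec n × Vec k), IsOpen O ∧ (0, φ.pt) ∈ O ∧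
      ∀ (q : ℝ) (a : ℝ × Vec n × Vec k → ℂ),
        ContDiff ℝ ∞ a → HasCompactSupport a → tsupport a ⊆ O →
        ∃ b : ℝ × Vec n × Vec kt → ℂ, ContDiff ℝ ∞ b ∧ HasCompactSupport b ∧
          (∀ z ∈ tsupport b, z.2 ∈ ψ.dom ∧ (z.1, z.2.1) ∈ V) ∧
          ∀ β : ℝ × Vec n, 0 < β.1 →
            mfOsc φ.φ a q β = mfOsc ψ.φ b (q + ((k : ℝ) - kt) / 2) β := by
  obtain ⟨O, hO, hmem, H⟩ := cornerOsc_reparametrize (isLegendreCorner_productLegendrian hG)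
    (productParam φ) (productParam ψ) (V := {β | (β.2.1 * β.1, β.2.2.1) ∈ V})
    (hV.preimage (by fun_prop)) (by simpa using hcV)
  let J : ℝ × ℝ × Vec n × Vec k → ℝ × CornerVar n 0 k 0 := fun z =>
    (z.1, z.2.1, z.2.2.1, 0, z.2.2.2, 0)
  have hJ : Continuous J := by fun_prop
  obtain ⟨δ, hδ, hball⟩ := Metric.isOpen_iff.1 (hO.preimage hJ) (0, 0, φ.pt) hmem
  have hJO : ∀ x s p, |x| < δ → |s| < δ → dist p φ.pt < δ → J (x, s, p) ∈ O := by
    intro x s p hx hs hp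
    apply hball
    simp only [Metric.mem_ball, Prod.dist_eq, max_lt_iff, Real.dist_eq, sub_zero]
    exact ⟨hx, hs, (max_lt_iff.1 hp)⟩
  -- The cutoff `χ` is `1` on `|x̃| ≤ ε` and supported in `|x̃| ≤ 2ε < δ`. The bound `|x| < δε` on
  -- the support of `a` gives `|x''| = |x|/ε < δ`, which keeps the corner amplitude inside `O`.
  set ε := δ / 3 with hε
  have hε0 : 0 < ε := by positivity
  let χ : ContDiffBump (0 : ℝ) := ⟨ε, 2 * ε, hε0, by linarith⟩
  have hχ : χ ε = 1 := χ.one_of_mem_closedBall (by simp [χ, abs_of_pos hε0])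
  refine ⟨{z | |z.1| < δ * ε ∧ dist z.2 φ.pt < δ}, ?_,
    ⟨by simpa using by positivity, by simpa using hδ⟩, fun q a ha hac has => ?_⟩
  · have h1 : Continuous fun z : ℝ × Vec n × Vec k => |z.1| := by fun_prop
    have h2 : Continuous fun z : ℝ × Vec n × Vec k => dist z.2 φ.pt := by fun_prop
    exact (isOpen_lt h1 continuous_const).inter (isOpen_lt h2 continuous_const)
  -- A corner amplitude whose restriction to `x̃ = ε`, with `x'' = x/ε`, is `a`.
  let a' : ℝ × CornerVar n 0 k 0 → ℂ := fun z =>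
    a (ε * z.1, z.2.2.1, z.2.2.2.2.1) * (χ z.2.1 : ℂ)
  let K : Set (ℝ × CornerVar n 0 k 0) := (fun z : (ℝ × Vec n × Vec k) × ℝ =>
    J (z.1.1 / ε, z.2, z.1.2)) '' (tsupport a ×ˢ tsupport χ)
  have hK : IsCompact K := (hac.isCompact.prod χ.hasCompactSupport.isCompact).image (by fun_prop)
  have ha'K : ∀ z, z ∉ K → a' z = 0 := by
    intro z hz
    by_contra h0
    obtain ⟨h1, h2⟩ := mul_ne_zero_iff.1 h0
    refine hz ⟨((ε * z.1, z.2.2.1, z.2.2.2.2.1), z.2.1), ⟨subset_tsupport _ h1,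
      subset_tsupport _ fun h => h2 (by rw [h]; simp)⟩, ?_⟩
    refine Prod.ext ?_ (Prod.ext rfl (Prod.ext rfl (Prod.ext (Subsingleton.elim _ _)
      (Prod.ext rfl (Subsingleton.elim _ _)))))
    change ε * z.1 / ε = z.1
    field_simp
  have hKO : K ⊆ O := by
    rintro _ ⟨z, ⟨hz1, hz2⟩, rfl⟩
    have h1 := has hz1
    refine hJO _ _ _ ?_ ?_ h1.2
    · rw [abs_div, abs_of_pos hε0, div_lt_iff₀ hε0]
      exact h1.1
    · rw [χ.tsupport_eq, Metric.mem_closedBall, Real.dist_eq, sub_zero] at hz2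
      have : χ.rOut = 2 * ε := rfl
      linarith
  have hχs : ContDiff ℝ ∞ fun z : ℝ × CornerVar n 0 k 0 => ((χ z.2.1 : ℝ) : ℂ) :=
    Complex.ofRealCLM.contDiff.comp (χ.contDiff.comp (by fun_prop))
  obtain ⟨b, hb, hbc, hbs, hab⟩ := H q 0 a' ((ha.comp (by fun_prop)).mul hχs)
    (HasCompactSupport.intro hK ha'K)
    ((closure_minimal (fun z hz => by
      by_contra h
      exact hz (ha'K z h)) hK.isClosed).trans hKO)
  let I : ℝ × Vec n × Vec kt → ℝ × CornerVar n 0 kt 0 := fun z =>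
    (z.1 / ε, ε, z.2.1, 0, z.2.2, 0)
  have hI : ContDiff ℝ ∞ I := by
    simp only [I, div_eq_mul_inv]
    fun_prop
  have hIc : Topology.IsClosedEmbedding I := by
    refine Function.LeftInverse.isClosedEmbedding
      (f := fun z => (ε * z.1, z.2.2.1, z.2.2.2.2.1)) (fun z => ?_) (by fun_prop) hI.continuous
    refine Prod.ext ?_ rfl
    change ε * (z.1 / ε) = z.1
    field_simp
  refine ⟨fun z => b (I z), hb.comp hI, hbc.comp_isClosedEmbedding hIc, fun z hz => ?_,
    fun β hβ => ?_⟩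
  · obtain ⟨h1, h2⟩ := hbs _ (tsupport_comp_subset hI.continuous hz)
    refine ⟨h1, ?_⟩
    have h3 : (ε * (z.1 / ε), z.2.1) ∈ V := h2
    rwa [mul_div_cancel₀ _ hε0.ne'] at h3
  · have h1 := hab (β.1 / ε, ε, β.2, 0) ⟨div_pos hβ hε0, hε0⟩
    have e1 : q + (((k : ℝ) + (0 : ℕ)) - (kt + (0 : ℕ))) / 2 = q + ((k : ℝ) - kt) / 2 := by simp
    have e2 : (0 : ℝ) - (((0 : ℕ) : ℝ) - (0 : ℕ)) / 2 = 0 := by simp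
    rw [e1, e2] at h1
    have h2 := cornerOsc_zero (φ := φ.φ) (a := a') (q := q) hε0 β
    have h3 := cornerOsc_zero (φ := ψ.φ) (a := b) (q := q + ((k : ℝ) - kt) / 2) hε0 β
    have h4 : (fun z : ℝ × Vec n × Vec k => a' (z.1 / ε, ε, z.2.1, 0, z.2.2, 0)) = a := by
      funext z
      change a (ε * (z.1 / ε), z.2.1, z.2.2) * (χ ε : ℂ) = a z
      rw [hχ, mul_div_cancel₀ _ hε0.ne']
      simp
    rw [h4] at h2
    exact h2.symm.trans (h1.trans h3)

end Interior

end OscInt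

/-! ### Transfer from coordinates to the manifold. -/

open FibredLegendre in
theorem proposition4p4 {n : ℕ} {M : Type*} [TopologicalSpace M] [T2Space M]
    [SecondCountableTopology M] [ChartedSpace (EuclideanQuadrant (n + 1)) M]
    [IsManifold (IQ (n + 1)) ∞ M]
    {ι : Type*} [Fintype ι] {l m : ι → ℕ} {Z : ι → Type*} [∀ i, TopologicalSpace (Z i)]
    [∀ i, T2Space (Z i)] [∀ i, CompactSpace (Z i)]
    [∀ i, ChartedSpace (EuclideanSpace ℝ (Fin (l i))) (Z i)] [∀ i, IsManifold (𝓡 (l i)) ∞ (Z i)]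
    (S : FibredCorners n M l m Z) (L : Set S.SfPoint) (hL : FibredCorners.IsLegendre L)
    (P : S.SfPoint) (hP : P ∈ L) :
    -- `P` lies over the corner of the main face and `H i`
    (∀ (i : ι) (χ : S.CornerChart i) (c : CornerPhase (l i) (m i)), χ.IsCoord P c →
      ∀ (k k' kt kt' : ℕ) (φ : CornerParam (χ.image L) c k k')
        (ψ : CornerParam (χ.image L) c kt kt'),
      ∃ O : Set (ℝ × CornerVar (l i) (m i) k k'), IsOpen O ∧ (0, φ.pt) ∈ O ∧
        ∀ (q r : ℝ) (a : ℝ × CornerVar (l i) (m i) k k' → ℂ),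
          ContDiff ℝ ∞ a → HasCompactSupport a → tsupport a ⊆ O →
          ∃ (b : ℝ × CornerVar (l i) (m i) kt kt' → ℂ) (u₀ : M → ℂ),
            ContDiff ℝ ∞ b ∧ HasCompactSupport b ∧
            (∀ z ∈ tsupport b, z.2 ∈ ψ.dom ∧
              (0 ≤ z.1 → 0 ≤ z.2.1 → (z.1, z.2.1, z.2.2.1, z.2.2.2.1) ∈ χ.e.target)) ∧
            S.IsDotSmooth u₀ ∧
            ∀ p, 0 < S.x p →
              χ.e.source.indicator (fun p' => cornerOsc φ.φ₁ φ.φ₂ a q r (χ.e p')) p =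
                u₀ p + χ.e.source.indicator (fun p' => cornerOsc ψ.φ₁ ψ.φ₂ b
                  (q + ((k + k' : ℝ) - (kt + kt')) / 2) (r - ((k' : ℝ) - kt') / 2) (χ.e p')) p) ∧
    -- `P` lies over the interior of the main face
    (∀ (χ : S.MfChart) (c : JetSpace n), χ.IsCoord P c →
      ∀ (k kt : ℕ) (φ : MfParam (χ.image L) c k) (ψ : MfParam (χ.image L) c kt),
      ∃ O : Set (ℝ × Vec n × Vec k), IsOpen O ∧ (0, φ.pt) ∈ O ∧
        ∀ (q : ℝ) (a : ℝ × Vec n × Vec k → ℂ),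
          ContDiff ℝ ∞ a → HasCompactSupport a → tsupport a ⊆ O →
          ∃ (b : ℝ × Vec n × Vec kt → ℂ) (u₀ : M → ℂ),
            ContDiff ℝ ∞ b ∧ HasCompactSupport b ∧
            (∀ z ∈ tsupport b, z.2 ∈ ψ.dom ∧ (0 ≤ z.1 → (z.1, z.2.1) ∈ χ.e.target)) ∧
            S.IsDotSmooth u₀ ∧
            ∀ p, 0 < S.x p →
              χ.e.source.indicator (fun p' => mfOsc φ.φ a q (χ.e p')) p =
                u₀ p + χ.e.source.indicator (fun p' => mfOsc ψ.φ b
                  (q + ((k : ℝ) - kt) / 2) (χ.e p')) p) := by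
  -- The coordinate identities hold exactly, so the remainder is taken to be zero.
  have hzero : S.IsDotSmooth (fun _ => 0) :=
    ⟨contMDiff_const, fun j => ⟨fun _ => 0, contMDiff_const, fun p => by simp⟩⟩
  refine ⟨fun i χ c hc k k' kt kt' φ ψ => ?_, fun χ c hc k kt φ ψ => ?_⟩
  · obtain ⟨V, hV, htarget⟩ := χ.open_target
    have hpt : χ.e P.1 = (0, c.1) :=
      Prod.ext ((χ.mf_iff P.1 hc.1).1 hc.2.1) hc.2.2.1.symm
    have hcV : (0, c.1) ∈ V := by
      have h := χ.e.map_source hc.1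
      rw [htarget, hpt] at h
      exact h.1
    obtain ⟨O, hO, hmem, H⟩ := OscInt.cornerOsc_reparametrize (hL.corner i χ) φ ψ hV hcV
    refine ⟨O, hO, hmem, fun q r a ha hac has => ?_⟩
    obtain ⟨b, hb, hbc, hbs, hab⟩ := H q r a ha hac has
    refine ⟨b, fun _ => 0, hb, hbc, fun z hz => ⟨(hbs z hz).1, fun h1 h2 => ?_⟩, hzero,
      fun p hp => ?_⟩
    · rw [htarget]
      exact ⟨(hbs z hz).2, h1, h2⟩
    · rw [zero_add]
      by_cases hps : p ∈ χ.e.source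
      · rw [Set.indicator_of_mem hps, Set.indicator_of_mem hps]
        have h := χ.e.map_source hps
        rw [htarget] at h
        rw [χ.x_eq p hps] at hp
        -- From `x = x̃ x'' > 0` and nonnegativity of both coordinates on the target, both are
        -- positive.
        exact hab _ ⟨pos_of_mul_pos_right hp h.2.2, pos_of_mul_pos_left hp h.2.1⟩
      · rw [Set.indicator_of_notMem hps, Set.indicator_of_notMem hps]
  · obtain ⟨V, hV, htarget⟩ := χ.open_target
    have hpt : χ.e P.1 = (0, c.1) := by
      refine Prod.ext ?_ hc.2.2.1.symm
      rw [χ.x_eq P.1 hc.1, FibredCorners.x, hc.2.1, zero_mul]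
    have hcV : (0, c.1) ∈ V := by
      have h := χ.e.map_source hc.1
      rw [htarget, hpt] at h
      exact h.1
    obtain ⟨O, hO, hmem, H⟩ := OscInt.mfOsc_reparametrize (hL.interior χ) φ ψ hV hcV
    refine ⟨O, hO, hmem, fun q a ha hac has => ?_⟩
    obtain ⟨b, hb, hbc, hbs, hab⟩ := H q a ha hac has
    refine ⟨b, fun _ => 0, hb, hbc, fun z hz => ⟨(hbs z hz).1, fun h1 => ?_⟩, hzero,
      fun p hp => ?_⟩
    · rw [htarget]
      exact ⟨(hbs z hz).2, h1⟩
    · rw [zero_add]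
      by_cases hps : p ∈ χ.e.source
      · rw [Set.indicator_of_mem hps, Set.indicator_of_mem hps]
        exact hab _ (by rw [χ.x_eq p hps]; exact hp)
      · rw [Set.indicator_of_notMem hps, Set.indicator_of_notMem hps]
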